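/- Let $d=2$, $\Omega=(-\pi,\pi)^2$, let $\vec n\in\mathbb R^2$ be a unit vector, $\delta>0$ and $T>0$. Let $w\ge 0$ be a radial kernel supported on the closed unit ball, positive almost everywhere there, with $\int_{\mathbb R^2} w(|x|)\,|x|\,dx=2$, and put $w_\delta(r)=\delta^{-3}w(r/\delta)$. Let $\chi_{\vec n}$ be the indicator function of $\mathcal H_{\vec n}=\{z\in\mathbb R^2: z\cdot\vec n\ge 0\}$. The nonlocal gradient, divergence and diffusion operators are $$\mathcal G\,\varphi(x)=2\int_{\mathbb R^2}\chi_{\vec n}(y-x)\,w_\delta(|y-x|)\,(y-x)\otimes\frac{\varphi(y)-\varphi(x)}{|y-x|}\,dy,$$ $$\mathcal D\,v(x)=2\int_{\mathbb R^2}\chi_{\vec n}(s)\,\frac{w_\delta(|s|)}{|s|}\,s\cdot\big(v(x)-v(x-s)\big)\,ds,\qquad \mathcal L=\mathcal D\circ\mathcal G,$$ where $\mathcal L$ acts componentwise on vector fields. They act on smooth periodic functions by these formulas, and on periodic $L^2$ functions by duality with smooth periodic functions, through $\int_\Omega u\cdot\mathcal G\varphi=-\int_\Omega(\mathcal D u)\,\varphi$.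 All functions are real (scalar or $\mathbb R^2$-valued), $2\pi$-periodic in each coordinate, and have zero mean over $\Omega$; $L^2(\Omega)$ denotes the corresponding space of square integrable functions. Let $$\lambda(\xi)=2\int_{\mathcal H_{\vec n}}\frac{w_\delta(|s|)}{|s|}\,s\,\big(e^{i\xi\cdot s}-1\big)\,ds,\qquad \xi\in\mathbb Z^2,$$ be the Fourier symbol of $\mathcal G$, let $S$ be the space of vector fields $u\in L^2(\Omega)$ with $\|u\|_S^2=\sum_{\xi\in\mathbb Z^2}|\lambda(\xi)|^2|\widehat u(\xi)|^2<\infty$, and let $S^*$ be its dual with respect to the $L^2$ pairing. Then for every $f\in L^2(0,T;S^*)$ and every vector field $u_0\in L^2(\Omega)$ with $-\mathcal D u_0=0$, the time-dependent nonlocal Stokes equation $$u_t-\mathcal L u+\mathcal G p=f,\qquad -\mathcal D u=0\quad\text{in }(0,T)\times\Omega,\qquad u|_{t=0}=u_0,$$ has a unique solution $(u,p)$ with $u\in L^2(0,T;S)\cap C([0,T];L^2(\Omega))$, $u_t\in L^2(0,T;S^*)$ and $p\in L^2(0,T;L^2(\Omega))$. -/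

import Mathlib

open MeasureTheory Set
open scoped ContDiff

noncomputable section

namespace NonlocalStokes

/-- The plane with the Euclidean norm. -/
abbrev Plane : Type := EuclideanSpace ℝ (Fin 2)

/-- The periodicity cell `Ω = (-π, π)²`. A periodic function is identified with its
restriction to `Ω`. -/
def cell : Set Plane := {x | ∀ i, x i ∈ Ioo (-Real.pi) Real.pi}

/-! ### Interaction kernels -/

/-- Admissible (unscaled) radial kernels `x ↦ w |x|` on the plane: nonnegative, supported on the
unit ball, positive almost everywhere there, with `∫ w(|x|) |x| dx = d = 2`. -/
structure IsKernel (w : ℝ → ℝ) : Prop where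
  nonneg : ∀ r, 0 ≤ r → 0 ≤ w r
  support : ∀ r, 1 < r → w r = 0
  pos : ∀ᵐ x : Plane, ‖x‖ ≤ 1 → 0 < w ‖x‖
  integrable : Integrable (fun x : Plane => w ‖x‖ * ‖x‖)
  moment : ∫ x : Plane, w ‖x‖ * ‖x‖ = 2

/-- The scaled kernel `w_δ(r) = δ^{-(d+1)} w(r/δ)` with `d = 2`. -/
def scaledKernel (w : ℝ → ℝ) (δ r : ℝ) : ℝ := (1 / δ ^ 3) * w (r / δ)

/-- The closed half space `H_n = {z : z · n ≥ 0}`. -/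
def halfSpace (n : Plane) : Set Plane := {z | 0 ≤ inner ℝ z n}

/-! ### The nonlocal operators, acting pointwise on (smooth) functions on the plane -/

/-- The nonlocal gradient of a scalar function,
`2 ∫ χ_n(y - x) w_δ(|y - x|) (y - x) (φ(y) - φ(x)) / |y - x| dy`. -/
def grad (w : ℝ → ℝ) (δ : ℝ) (n : Plane) (φ : Plane → ℝ) (x : Plane) : Plane :=
  (2 : ℝ) • ∫ y : Plane, (halfSpace n).indicator (fun _ => (1 : ℝ)) (y - x) •
    (scaledKernel w δ ‖y - x‖ * ((φ y - φ x) / ‖y - x‖)) • (y - x)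

/-- The nonlocal divergence of a vector field,
`2 ∫ χ_n(s) (w_δ(|s|) / |s|) s · (v(x) - v(x - s)) ds`. -/
def div (w : ℝ → ℝ) (δ : ℝ) (n : Plane) (v : Plane → Plane) (x : Plane) : ℝ :=
  2 * ∫ s : Plane, (halfSpace n).indicator (fun _ => (1 : ℝ)) s *
    (scaledKernel w δ ‖s‖ / ‖s‖) * inner ℝ s (v x - v (x - s))

/-- The nonlocal diffusion operator `div ∘ grad` on scalar functions. -/
def lap (w : ℝ → ℝ) (δ : ℝ) (n : Plane) (φ : Plane → ℝ) : Plane → ℝ :=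
  div w δ n (grad w δ n φ)

/-- The nonlocal diffusion operator on vector fields. The nonlocal gradient of a field `v` is the
matrix with entries `(i, j) ↦ (grad vⱼ)ᵢ`, so the operator acts componentwise. -/
def vlap (w : ℝ → ℝ) (δ : ℝ) (n : Plane) (v : Plane → Plane) (x : Plane) : Plane :=
  WithLp.toLp 2 fun j => lap w δ n (fun y => v y j) x

/-! ### Square integrable periodic functions with zero mean -/

/-- `2π`-periodicity in each coordinate. -/
def IsPeriodic {F : Type*} (φ : Plane → F) : Prop :=
  ∀ (i : Fin 2) (x : Plane), φ (x + EuclideanSpace.single i (2 * Real.pi)) = φ x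

/-- Periodic test functions (or test fields): smooth and periodic. -/
structure IsTest {F : Type*} [NormedAddCommGroup F] [NormedSpace ℝ F] (φ : Plane → F) :
    Prop where
  smooth : ContDiff ℝ ∞ φ
  periodic : IsPeriodic φ

instance : IsFiniteMeasure (volume.restrict cell) := by
  refine ⟨?_⟩
  rw [Measure.restrict_apply_univ]
  refine lt_of_le_of_lt (measure_mono ?_)
    (measure_closedBall_lt_top (x := (0 : Plane)) (r := 2 * Real.pi))
  intro x hx
  have h0 := hx 0
  have h1 := hx 1
  simp only [mem_Ioo] at h0 h1
  rw [mem_closedBall_zero_iff, EuclideanSpace.norm_eq, Fin.sum_univ_two]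
  refine Real.sqrt_le_iff.2 ⟨by positivity, ?_⟩
  simp only [Real.norm_eq_abs, sq_abs]
  nlinarith [Real.pi_pos]

/-- `L²(Ω)`, with values in `F`. -/
abbrev L2 (F : Type) [NormedAddCommGroup F] : Type := Lp F 2 (volume.restrict cell)

theorem L2.integrable {F : Type} [NormedAddCommGroup F] (u : L2 F) :
    Integrable u (volume.restrict cell) :=
  (Lp.memLp u).integrable (by norm_num)

/-- The subspace of `L²(Ω)` of functions with zero mean. -/
def L2Zero (F : Type) [NormedAddCommGroup F] [NormedSpace ℝ F] : Submodule ℝ (L2 F) where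
  carrier := {u | ∫ x in cell, u x = 0}
  zero_mem' := by
    change ∫ x in cell, (0 : L2 F) x = 0
    rw [integral_congr_ae (Lp.coeFn_zero F 2 (volume.restrict cell))]
    simp
  add_mem' := by
    intro u v hu hv
    change ∫ x in cell, (u + v : L2 F) x = 0
    rw [integral_congr_ae (Lp.coeFn_add u v)]
    simp only [Pi.add_apply]
    rw [integral_add u.integrable v.integrable, show ∫ x in cell, u x = 0 from hu,
      show ∫ x in cell, v x = 0 from hv, add_zero]
  smul_mem' := by
    intro c u hu
    change ∫ x in cell, (c • u : L2 F) x = 0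
    rw [integral_congr_ae (Lp.coeFn_smul c u)]
    simp only [Pi.smul_apply]
    rw [integral_smul, show ∫ x in cell, u x = 0 from hu, smul_zero]

/-! ### Fourier coefficients and the symbol of the nonlocal gradient -/

/-- `ξ · x` for a frequency `ξ ∈ ℤ²`. -/
def freqDot (ξ : Fin 2 → ℤ) (x : Plane) : ℝ := ∑ i, (ξ i : ℝ) * x i

/-- The Fourier coefficients `û(ξ) = (2π)⁻² ∫_Ω u(x) e^{-iξ·x} dx ∈ ℂ²` of a vector field. -/
def fourierCoeff (u : Plane → Plane) (ξ : Fin 2 → ℤ) : EuclideanSpace ℂ (Fin 2) :=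
  WithLp.toLp 2 fun j => (1 / (2 * (Real.pi : ℂ)) ^ 2) *
    ∫ x in cell, Complex.exp (-(Complex.I * (freqDot ξ x : ℂ))) * ((u x j : ℝ) : ℂ)

/-- The Fourier symbol of the nonlocal gradient,
`λ(ξ) = 2 ∫_{H_n} (w_δ(|s|) / |s|) s (e^{iξ·s} - 1) ds ∈ ℂ²`. -/
def symbol (w : ℝ → ℝ) (δ : ℝ) (n : Plane) (ξ : Fin 2 → ℤ) : EuclideanSpace ℂ (Fin 2) :=
  WithLp.toLp 2 fun j => 2 * ∫ s in halfSpace n,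
    ((scaledKernel w δ ‖s‖ / ‖s‖ * s j : ℝ) : ℂ) *
      (Complex.exp (Complex.I * (freqDot ξ s : ℂ)) - 1)

theorem integrable_fourier (u : L2 Plane) (ξ : Fin 2 → ℤ) (j : Fin 2) :
    Integrable (fun x => Complex.exp (-(Complex.I * (freqDot ξ x : ℂ))) * ((u x j : ℝ) : ℂ))
      (volume.restrict cell) := by
  have h1 : Integrable (fun x => ((u x j : ℝ) : ℂ)) (volume.restrict cell) :=
    ((EuclideanSpace.proj j : Plane →L[ℝ] ℝ).integrable_comp u.integrable).ofReal
  refine h1.bdd_mul (c := 1) ?_ ?_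
  · refine Continuous.aestronglyMeasurable ?_
    unfold freqDot
    fun_prop
  · refine Filter.Eventually.of_forall fun x => ?_
    rw [← mul_neg, ← Complex.ofReal_neg, mul_comm, Complex.norm_exp_ofReal_mul_I]

theorem fourierCoeff_add (u v : L2 Plane) (ξ : Fin 2 → ℤ) :
    fourierCoeff (u + v : L2 Plane) ξ = fourierCoeff u ξ + fourierCoeff v ξ := by
  ext j
  simp only [fourierCoeff, PiLp.add_apply]
  rw [← mul_add, ← integral_add (integrable_fourier u ξ j) (integrable_fourier v ξ j)]
  congr 1
  refine integral_congr_ae ?_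
  filter_upwards [Lp.coeFn_add u v] with x hx
  rw [hx]
  simp [mul_add]

theorem fourierCoeff_smul (c : ℝ) (u : L2 Plane) (ξ : Fin 2 → ℤ) :
    fourierCoeff (c • u : L2 Plane) ξ = c • fourierCoeff u ξ := by
  ext j
  simp only [fourierCoeff, PiLp.smul_apply, Complex.real_smul]
  rw [mul_left_comm, ← integral_const_mul (c : ℂ)]
  refine congrArg _ (integral_congr_ae ?_)
  filter_upwards [Lp.coeFn_smul c u] with x hx
  rw [hx]
  simp [mul_left_comm]

/-! ### The energy space -/

/-- The weighted Fourier coefficients `|λ(ξ)| û(ξ)`. -/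
def weightedCoeff (w : ℝ → ℝ) (δ : ℝ) (n : Plane) (u : Plane → Plane) (ξ : Fin 2 → ℤ) :
    EuclideanSpace ℂ (Fin 2) :=
  ‖symbol w δ n ξ‖ • fourierCoeff u ξ

theorem memℓp_weightedCoeff_iff (w : ℝ → ℝ) (δ : ℝ) (n : Plane) (u : Plane → Plane) :
    Memℓp (weightedCoeff w δ n u) 2 ↔
      Summable fun ξ => ‖symbol w δ n ξ‖ ^ 2 * ‖fourierCoeff u ξ‖ ^ 2 := by
  rw [memℓp_gen_iff (by norm_num)]
  simp [weightedCoeff, norm_smul, mul_pow]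

theorem weightedCoeff_add (w : ℝ → ℝ) (δ : ℝ) (n : Plane) (u v : L2 Plane) :
    weightedCoeff w δ n (u + v : L2 Plane) = weightedCoeff w δ n u + weightedCoeff w δ n v := by
  funext ξ
  simp only [weightedCoeff, Pi.add_apply, fourierCoeff_add, smul_add]

theorem weightedCoeff_smul (w : ℝ → ℝ) (δ : ℝ) (n : Plane) (c : ℝ) (u : L2 Plane) :
    weightedCoeff w δ n (c • u : L2 Plane) = c • weightedCoeff w δ n u := by
  funext ξ
  simp only [weightedCoeff, Pi.smul_apply, fourierCoeff_smul, smul_comm c]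

/-- The zero mean fields `u ∈ L²(Ω)` with `∑ |λ(ξ)|² |û(ξ)|² < ∞`, as a vector space. -/
def energySubmodule (w : ℝ → ℝ) (δ : ℝ) (n : Plane) : Submodule ℝ (L2Zero Plane) where
  carrier := {u | Summable fun ξ =>
    ‖symbol w δ n ξ‖ ^ 2 * ‖fourierCoeff (u : L2 Plane) ξ‖ ^ 2}
  zero_mem' := by
    have h : ∀ ξ, fourierCoeff (0 : L2 Plane) ξ = 0 := fun ξ => by
      simpa using fourierCoeff_smul 0 0 ξ
    change Summable fun ξ => ‖symbol w δ n ξ‖ ^ 2 * ‖fourierCoeff (0 : L2 Plane) ξ‖ ^ 2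
    simp only [h, norm_zero, ne_eq, OfNat.ofNat_ne_zero, not_false_eq_true, zero_pow, mul_zero]
    exact summable_zero
  add_mem' := by
    intro u v hu hv
    simp only [mem_ofPred_eq, ← memℓp_weightedCoeff_iff] at hu hv ⊢
    rw [Submodule.coe_add, weightedCoeff_add]
    exact hu.add hv
  smul_mem' := by
    intro c u hu
    simp only [mem_ofPred_eq, ← memℓp_weightedCoeff_iff] at hu ⊢
    rw [Submodule.coe_smul, weightedCoeff_smul]
    exact hu.const_smul c

/-- The energy space `S`, a type of its own because it does not carry the `L²` norm. -/
def EnergySpace (w : ℝ → ℝ) (δ : ℝ) (n : Plane) : Type := energySubmodule w δ n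

instance (w : ℝ → ℝ) (δ : ℝ) (n : Plane) : AddCommGroup (EnergySpace w δ n) :=
  inferInstanceAs (AddCommGroup (energySubmodule w δ n))

instance (w : ℝ → ℝ) (δ : ℝ) (n : Plane) : Module ℝ (EnergySpace w δ n) :=
  inferInstanceAs (Module ℝ (energySubmodule w δ n))

/-- The inclusion of the energy space in `L²(Ω)`. -/
def EnergySpace.toL2 {w : ℝ → ℝ} {δ : ℝ} {n : Plane} :
    EnergySpace w δ n →ₗ[ℝ] L2Zero Plane :=
  (energySubmodule w δ n).subtype

/-- The map `u ↦ (|λ(ξ)| û(ξ))_ξ` from the energy space to `ℓ²`. -/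
def EnergySpace.toSeq {w : ℝ → ℝ} {δ : ℝ} {n : Plane} :
    EnergySpace w δ n →ₗ[ℝ] lp (fun _ : Fin 2 → ℤ => EuclideanSpace ℂ (Fin 2)) 2 where
  toFun u := ⟨weightedCoeff w δ n (u.toL2 : L2 Plane),
    (memℓp_weightedCoeff_iff w δ n _).2 u.2⟩
  map_add' u v := by
    apply Subtype.ext
    simp only [map_add, Submodule.coe_add, weightedCoeff_add]
    rfl
  map_smul' c u := by
    apply Subtype.ext
    simp only [map_smul, Submodule.coe_smul, weightedCoeff_smul]
    rfl

/-- The energy (semi)norm `(∑ |λ(ξ)|² |û(ξ)|²)^{1/2}`, see `EnergySpace.norm_eq`. For an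
admissible kernel `λ(ξ) ≠ 0` for all `ξ ≠ 0`, and it is a norm. -/
instance (w : ℝ → ℝ) (δ : ℝ) (n : Plane) : SeminormedAddCommGroup (EnergySpace w δ n) :=
  SeminormedAddCommGroup.induced _ _ (EnergySpace.toSeq (w := w) (δ := δ) (n := n))

instance (w : ℝ → ℝ) (δ : ℝ) (n : Plane) : NormedSpace ℝ (EnergySpace w δ n) :=
  NormedSpace.induced ℝ _ _ (EnergySpace.toSeq (w := w) (δ := δ) (n := n))

theorem EnergySpace.norm_eq {w : ℝ → ℝ} {δ : ℝ} {n : Plane} (u : EnergySpace w δ n) :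
    ‖u‖ = √(∑' ξ, ‖symbol w δ n ξ‖ ^ 2 * ‖fourierCoeff (u.toL2 : L2 Plane) ξ‖ ^ 2) := by
  have h : ‖u‖ = ‖EnergySpace.toSeq u‖ := rfl
  rw [h, lp.norm_eq_tsum_rpow (by norm_num), Real.sqrt_eq_rpow]
  simp [EnergySpace.toSeq, weightedCoeff, norm_smul, mul_pow]

/-- The dual `S*` of the energy space. -/
abbrev EnergyDual (w : ℝ → ℝ) (δ : ℝ) (n : Plane) : Type := StrongDual ℝ (EnergySpace w δ n)

/-! ### The operators on `L²(Ω)`, by duality with periodic test functions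

The pairings are those given by `∫_Ω u · grad φ = -∫_Ω (div u) φ` and `lap = div ∘ grad`. -/

/-- `⟨div u, φ⟩ = -∫_Ω u · grad φ`. -/
def divPairing (w : ℝ → ℝ) (δ : ℝ) (n : Plane) (u : L2 Plane) (φ : Plane → ℝ) : ℝ :=
  -∫ x in cell, inner ℝ (u x) (grad w δ n φ x)

/-- `⟨grad p, φ⟩ = -∫_Ω p div φ`. -/
def gradPairing (w : ℝ → ℝ) (δ : ℝ) (n : Plane) (p : L2 ℝ) (φ : Plane → Plane) : ℝ :=
  -∫ x in cell, p x * div w δ n φ x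

/-- `⟨lap u, φ⟩ = ∫_Ω u · lap φ`. -/
def lapPairing (w : ℝ → ℝ) (δ : ℝ) (n : Plane) (u : L2 Plane) (φ : Plane → Plane) : ℝ :=
  ∫ x in cell, inner ℝ (u x) (vlap w δ n φ x)

/-- `-div u = 0` in `Ω`, for `u ∈ L²(Ω)`. -/
def IsDivFree (w : ℝ → ℝ) (δ : ℝ) (n : Plane) (u : L2 Plane) : Prop :=
  ∀ φ : Plane → ℝ, IsTest φ → -divPairing w δ n u φ = 0

/-! ### Solutions of the time dependent nonlocal Stokes equation -/

/-- `u'` is the weak time derivative on `(0, T)` of `u`, as a function with values in `S*`, where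
`L²(Ω)` acts on `S` through the `L²` inner product. -/
def IsTimeDeriv {w : ℝ → ℝ} {δ : ℝ} {n : Plane} (T : ℝ) (u : ℝ → L2Zero Plane)
    (u' : ℝ → EnergyDual w δ n) : Prop :=
  ∀ (v : EnergySpace w δ n) (η : ℝ → ℝ), ContDiff ℝ ∞ η → HasCompactSupport η →
    tsupport η ⊆ Ioo 0 T →
    ∫ t in Ioo 0 T, deriv η t * inner ℝ (u t) v.toL2 = -∫ t in Ioo 0 T, η t * u' t v

/-- `(u, p)` solves `u_t - lap u + grad p = f`, `-div u = 0` in `(0, T) × Ω`, `u(0) = u₀`, with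
`u ∈ L²(0,T;S) ∩ C([0,T];L²)`, `u_t ∈ L²(0,T;S*)` and `p ∈ L²(0,T;L²)`. The first equation is
tested with the elements of `S` that are smooth periodic fields. -/
structure IsSolution {w : ℝ → ℝ} {δ : ℝ} {n : Plane} (T : ℝ) (f : ℝ → EnergyDual w δ n)
    (u₀ : L2Zero Plane) (u : ℝ → L2Zero Plane) (p : ℝ → L2Zero ℝ) : Prop where
  velocity_continuous : ContinuousOn u (Icc 0 T)
  velocity_energy : ∃ U : ℝ → EnergySpace w δ n, MemLp U 2 (volume.restrict (Ioo 0 T)) ∧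
    ∀ᵐ t ∂volume.restrict (Ioo 0 T), (U t).toL2 = u t
  pressure : MemLp p 2 (volume.restrict (Ioo 0 T))
  momentum : ∃ u' : ℝ → EnergyDual w δ n, MemLp u' 2 (volume.restrict (Ioo 0 T)) ∧
    IsTimeDeriv T u u' ∧
    ∀ᵐ t ∂volume.restrict (Ioo 0 T), ∀ (v : EnergySpace w δ n) (φ : Plane → Plane),
      IsTest φ → ((v.toL2 : L2 Plane) : Plane → Plane) =ᵐ[volume.restrict cell] φ →
      u' t v - lapPairing w δ n (u t) φ + gradPairing w δ n (p t) φ = f t v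
  divergence : ∀ᵐ t ∂volume.restrict (Ioo 0 T), IsDivFree w δ n (u t)
  initial : u 0 = u₀

end NonlocalStokes

end

/-!
The problem is diagonal in Fourier space. The nonlocal gradient multiplies the Fourier coefficient
at `ξ` by the vector `λ(ξ) ∈ ℂ²`, the nonlocal divergence takes the product with minus the
conjugate of `λ(ξ)`, and the diffusion operator multiplies by `-|λ(ξ)|²`. Since the kernel is
positive almost everywhere on the unit ball and `n` selects a half space, `λ(ξ) ≠ 0` for `ξ ≠ 0`
(`symbol_ne_zero`): the component of `λ(ξ)` along `n` is an integral of
`w_δ(|s|) (s·n) / |s| * (exp (i ξ·s) - 1)`, whose real part is negative unless `exp (i ξ·s) = 1`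
for almost all `s` in a half disc.

To stay within real functions, the exponentials are replaced by real modes. The functions
`cos (ξ·x) + sin (ξ·x)`, normalised and with `ξ ≠ 0`, form a Hilbert basis of the zero mean scalar
functions (`sbasis`). Dividing their nonlocal gradients by `|λ(ξ)|` gives the gradient modes, and
turning the direction of the symbol by a right angle gives the solenoidal modes; together they
are a Hilbert basis of the zero mean fields (`vbasis`). In it the energy norm is, up to the factor
`2π`, a weighted `ℓ²` norm (`summable_energy_iff`, `EnergySpace.norm_coord`), the weak diffusion
operator is diagonal (`lapPairing_eq`), the weak gradient of a pressure sees only the gradient modes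
(`gradPairing_eq`), and a field is free of divergence when its gradient modes vanish
(`isDivFree_of_inner_fieldL`).

Hence the equation splits. On a gradient mode the velocity vanishes and the equation reads
`|λ(ξ)| p(ξ) = f(ξ)`, which determines the pressure; this is bounded from `S*` to `L²`, because
the coordinates `f(ξ) / |λ(ξ)|` of a functional on `S` are square summable (`sum_sq_dual_le`). On a
solenoidal mode the equation is the scalar equation `y' + |λ(ξ)|² y = f(ξ)`. Its Duhamel solution
obeys an energy estimate (`duhamel_energy`), and summation over the modes gives a curve that is
continuous in `L²` and square integrable with values in `S` (`exists_continuousOn_duhamel`,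
`exists_energy_lift`). For uniqueness both equations are tested with single modes: the difference
of two velocities satisfies `y' + |λ(ξ)|² y = 0` weakly with `y(0) = 0`, and so vanishes
(`eq_zero_of_weak_decay`).
-/


noncomputable section

namespace NonlocalStokes

/-! ### The scalar equation `y' + μ y = g` -/

theorem setIntegral_Ioo_eq_intervalIntegral {E : Type*} [NormedAddCommGroup E] [NormedSpace ℝ E]
    {T : ℝ} (hT : 0 ≤ T) (f : ℝ → E) : ∫ t in Ioo 0 T, f t = ∫ t in (0 : ℝ)..T, f t := by
  rw [intervalIntegral.integral_of_le hT, integral_Ioc_eq_integral_Ioo]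

/-- The variation of constants formula for `y' + μ y = g`, `y 0 = y₀`. -/
def duhamel (μ y₀ : ℝ) (g : ℝ → ℝ) (t : ℝ) : ℝ :=
  Real.exp (-(μ * t)) * (y₀ + ∫ s in (0 : ℝ)..t, Real.exp (μ * s) * g s)

theorem duhamel_zero (μ y₀ : ℝ) (g : ℝ → ℝ) : duhamel μ y₀ g 0 = y₀ := by
  simp [duhamel]

theorem duhamel_absolutelyContinuous {μ y₀ T : ℝ} {g : ℝ → ℝ}
    (hg : IntervalIntegrable g volume 0 T) :
    AbsolutelyContinuousOnInterval (duhamel μ y₀ g) 0 T := by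
  have h1 : AbsolutelyContinuousOnInterval (fun t : ℝ => Real.exp (-(μ * t))) 0 T := by
    refine ContDiffOn.absolutelyContinuousOnInterval (ContDiff.contDiffOn ?_)
    fun_prop
  have h2 : IntervalIntegrable (fun s => Real.exp (μ * s) * g s) volume 0 T :=
    hg.continuousOn_mul (Continuous.continuousOn (by fun_prop))
  have h3 := h2.absolutelyContinuousOnInterval_intervalIntegral (c := 0) (by simp)
  have h4 : AbsolutelyContinuousOnInterval (fun _ : ℝ => y₀) 0 T :=
    (contDiff_const.contDiffOn).absolutelyContinuousOnInterval
  exact h1.fun_mul (h4.fun_add h3)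

theorem ae_hasDerivAt_duhamel {μ y₀ T : ℝ} {g : ℝ → ℝ}
    (hg : IntervalIntegrable g volume 0 T) :
    ∀ᵐ t, t ∈ uIcc 0 T → HasDerivAt (duhamel μ y₀ g) (g t - μ * duhamel μ y₀ g t) t := by
  have h2 : IntervalIntegrable (fun s => Real.exp (μ * s) * g s) volume 0 T :=
    hg.continuousOn_mul (Continuous.continuousOn (by fun_prop))
  filter_upwards [h2.ae_hasDerivAt_integral] with t ht htT
  have h3 := (ht htT 0 (by simp)).const_add y₀
  have h1 : HasDerivAt (fun t : ℝ => Real.exp (-(μ * t))) (Real.exp (-(μ * t)) * -(μ * 1)) t :=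
    (((hasDerivAt_id t).const_mul μ).neg).exp
  refine (h1.mul h3).congr_deriv ?_
  have h4 : Real.exp (-(μ * t)) * Real.exp (μ * t) = 1 := by
    rw [← Real.exp_add]; simp
  simp only [duhamel]
  linear_combination g t * h4

/-- The weak derivative of an absolutely continuous function is its almost everywhere
derivative. -/
theorem integral_deriv_mul_of_absolutelyContinuous {T : ℝ} (hT : 0 ≤ T) {y y' η : ℝ → ℝ}
    (hy : AbsolutelyContinuousOnInterval y 0 T)
    (hy' : ∀ᵐ t, t ∈ uIcc 0 T → HasDerivAt y (y' t) t)
    (hη : ContDiff ℝ ∞ η) (hηs : tsupport η ⊆ Ioo 0 T) :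
    ∫ t in Ioo 0 T, deriv η t * y t = -∫ t in Ioo 0 T, η t * y' t := by
  have hη1 : AbsolutelyContinuousOnInterval η 0 T :=
    ((hη.of_le (by simp)).contDiffOn).absolutelyContinuousOnInterval
  have h := hη1.integral_mul_deriv_eq_deriv_mul hy
  have h0 : η 0 = 0 := image_eq_zero_of_notMem_tsupport fun h => lt_irrefl _ (hηs h).1
  have hT0 : η T = 0 := image_eq_zero_of_notMem_tsupport fun h => lt_irrefl _ (hηs h).2
  rw [h0, hT0] at h
  rw [setIntegral_Ioo_eq_intervalIntegral hT, setIntegral_Ioo_eq_intervalIntegral hT]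
  have h2 : ∫ t in (0 : ℝ)..T, η t * y' t = ∫ t in (0 : ℝ)..T, η t * deriv y t := by
    refine intervalIntegral.integral_congr_ae ?_
    filter_upwards [hy'] with t ht htT
    rw [(ht (uIoc_subset_uIcc htT)).deriv]
  rw [h2, h]
  simp

theorem integral_deriv_mul_duhamel {μ y₀ T : ℝ} (hT : 0 ≤ T) {g η : ℝ → ℝ}
    (hg : IntervalIntegrable g volume 0 T) (hη : ContDiff ℝ ∞ η) (hηs : tsupport η ⊆ Ioo 0 T) :
    ∫ t in Ioo 0 T, deriv η t * duhamel μ y₀ g t =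
      -∫ t in Ioo 0 T, η t * (g t - μ * duhamel μ y₀ g t) :=
  integral_deriv_mul_of_absolutelyContinuous hT (duhamel_absolutelyContinuous hg)
    (ae_hasDerivAt_duhamel hg) hη hηs

/-- The energy estimate for `y' + μ y = g`: integrate `(y²)' = 2 g y - 2 μ y²` and bound `2 g y` by
`μ⁻¹ g² + μ y²`. -/
theorem duhamel_energy {μ y₀ T : ℝ} (hμ : 0 < μ) {g : ℝ → ℝ}
    (hg : MemLp g 2 (volume.restrict (Ioo 0 T))) {t : ℝ} (ht : t ∈ Icc 0 T) :
    duhamel μ y₀ g t ^ 2 + μ * ∫ s in Ioo 0 t, duhamel μ y₀ g s ^ 2 ≤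
      y₀ ^ 2 + μ⁻¹ * ∫ s in Ioo 0 T, g s ^ 2 := by
  have hT : 0 ≤ T := ht.1.trans ht.2
  set y := duhamel μ y₀ g with hydef
  have hgi : IntervalIntegrable g volume 0 T := by
    rw [intervalIntegrable_iff_integrableOn_Ioo_of_le hT]
    exact hg.integrable (by norm_num)
  have hg2 : IntervalIntegrable (fun s => g s ^ 2) volume 0 T := by
    rw [intervalIntegrable_iff_integrableOn_Ioo_of_le hT]
    exact hg.integrable_sq
  have hsub : uIcc 0 t ⊆ uIcc 0 T := by
    rw [uIcc_of_le ht.1, uIcc_of_le hT]; exact Icc_subset_Icc_right ht.2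
  have hac : AbsolutelyContinuousOnInterval y 0 t := (duhamel_absolutelyContinuous hgi).mono hsub
  have hcont : ContinuousOn y (uIcc 0 t) := hac.continuousOn
  have h1 := hac.integral_deriv_mul_eq_sub hac
  have hgt : IntervalIntegrable g volume 0 t := hgi.mono_set hsub
  have hg2t : IntervalIntegrable (fun s => g s ^ 2) volume 0 t := hg2.mono_set hsub
  have hy2 : IntervalIntegrable (fun s => y s ^ 2) volume 0 t :=
    (hcont.pow 2).intervalIntegrable
  have h2 : ∫ s in (0 : ℝ)..t, deriv y s * y s + y s * deriv y s =
      ∫ s in (0 : ℝ)..t, (2 * (g s * y s) - 2 * μ * y s ^ 2) := by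
    refine intervalIntegral.integral_congr_ae ?_
    filter_upwards [ae_hasDerivAt_duhamel (μ := μ) (y₀ := y₀) hgi] with s hs hst
    have := (hs (hsub (uIoc_subset_uIcc hst))).deriv
    rw [← hydef] at this
    rw [this]; ring
  have h3 : ∫ s in (0 : ℝ)..t, (2 * (g s * y s) - 2 * μ * y s ^ 2) ≤
      ∫ s in (0 : ℝ)..t, (μ⁻¹ * g s ^ 2 - μ * y s ^ 2) := by
    refine intervalIntegral.integral_mono_on ht.1 ?_ ?_ fun s _ => ?_
    · exact ((hgt.mul_continuousOn hcont).const_mul 2).sub (hy2.const_mul (2 * μ))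
    · exact (hg2t.const_mul _).sub (hy2.const_mul _)
    · have h4 : 0 ≤ μ⁻¹ * (g s - μ * y s) ^ 2 := by positivity
      have h5 : μ⁻¹ * (g s - μ * y s) ^ 2 = μ⁻¹ * g s ^ 2 - 2 * (g s * y s) + μ * y s ^ 2 := by
        field_simp
        ring
      linarith
  rw [intervalIntegral.integral_sub (hg2t.const_mul _) (hy2.const_mul _),
    intervalIntegral.integral_const_mul, intervalIntegral.integral_const_mul] at h3
  have h6 : ∫ s in (0 : ℝ)..t, g s ^ 2 ≤ ∫ s in Ioo 0 T, g s ^ 2 := by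
    rw [← setIntegral_Ioo_eq_intervalIntegral ht.1]
    exact setIntegral_mono_set hg.integrable_sq (Filter.Eventually.of_forall fun s => sq_nonneg _)
      (Ioo_subset_Ioo_right ht.2).eventuallyLE
  have h7 : μ⁻¹ * ∫ s in (0 : ℝ)..t, g s ^ 2 ≤ μ⁻¹ * ∫ s in Ioo 0 T, g s ^ 2 :=
    mul_le_mul_of_nonneg_left h6 (by positivity)
  rw [setIntegral_Ioo_eq_intervalIntegral ht.1]
  have h8 : y 0 = y₀ := duhamel_zero _ _ _
  rw [h8] at h1
  nlinarith

/-- The lemma of du Bois-Reymond for continuous functions. With `η₀` a fixed bump function of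
integral one, `η - (∫ η) η₀` is the derivative of a test function for each test function `η`, so
that `z - ∫ η₀ z` is orthogonal to all test functions. -/
theorem eqOn_const_of_integral_deriv_mul_eq_zero {T : ℝ} (hT : 0 < T) {z : ℝ → ℝ}
    (hz : ContinuousOn z (Icc 0 T))
    (h : ∀ η : ℝ → ℝ, ContDiff ℝ ∞ η → HasCompactSupport η → tsupport η ⊆ Ioo 0 T →
      ∫ t in Ioo 0 T, deriv η t * z t = 0) :
    ∃ c, ∀ t ∈ Icc 0 T, z t = c := by
  -- a fixed bump function of integral one
  let B : ContDiffBump (T / 2) := ⟨T / 8, T / 4, by positivity, by linarith⟩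
  let η₀ : ℝ → ℝ := B.normed volume
  have hη₀ : ContDiff ℝ ∞ η₀ := B.contDiff_normed
  have hη₀c : HasCompactSupport η₀ := B.hasCompactSupport_normed
  have hη₀s : tsupport η₀ ⊆ Ioo 0 T := by
    change tsupport (B.normed volume) ⊆ _
    rw [B.tsupport_normed_eq, Real.closedBall_eq_Icc]
    intro x hx
    change x ∈ Icc (T / 2 - T / 4) (T / 2 + T / 4) at hx
    constructor <;> linarith [hx.1, hx.2]
  have hη₀i : ∫ x, η₀ x = 1 := B.integral_normed
  have hzi : IntegrableOn z (Ioo 0 T) :=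
    (hz.integrableOn_compact isCompact_Icc).mono_set Ioo_subset_Icc_self
  set c := ∫ t in Ioo 0 T, η₀ t * z t with hc
  have key : ∀ η : ℝ → ℝ, ContDiff ℝ ∞ η → HasCompactSupport η → tsupport η ⊆ Ioo 0 T →
      ∫ t in Ioo 0 T, η t * z t = (∫ t in Ioo 0 T, η t) * c := by
    intro η hη hηc hηs
    set I := ∫ t, η t with hI
    let θ : ℝ → ℝ := fun t => η t - I * η₀ t
    have hθ : ContDiff ℝ ∞ θ := hη.sub (contDiff_const.mul hη₀)
    let ζ : ℝ → ℝ := fun t => ∫ s in (0 : ℝ)..t, θ s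
    have hζd : ∀ t, HasDerivAt ζ (θ t) t := fun t =>
      intervalIntegral.integral_hasDerivAt_right (hθ.continuous.intervalIntegrable _ _)
        (hθ.continuous.stronglyMeasurableAtFilter _ _) hθ.continuous.continuousAt
    have hζ' : deriv ζ = θ := funext fun t => (hζd t).deriv
    have hζ : ContDiff ℝ ∞ ζ := by
      rw [contDiff_infty_iff_deriv, hζ']
      exact ⟨fun t => (hζd t).differentiableAt, hθ⟩
    -- the supports lie in a compact subinterval `[a, b]` of `(0, T)`
    have hK : IsCompact (tsupport η ∪ tsupport η₀) := hηc.isCompact.union hη₀c.isCompact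
    have hKs : tsupport η ∪ tsupport η₀ ⊆ Ioo 0 T := union_subset hηs hη₀s
    obtain ⟨a, b, ha, hb, hab⟩ : ∃ a b, 0 < a ∧ b < T ∧ tsupport η ∪ tsupport η₀ ⊆ Icc a b := by
      rcases (tsupport η ∪ tsupport η₀).eq_empty_or_nonempty with he | hne
      · exact ⟨1, T - 1, one_pos, by linarith, by rw [he]; exact empty_subset _⟩
      · exact ⟨sInf _, sSup _, (hKs (hK.sInf_mem hne)).1, (hKs (hK.sSup_mem hne)).2,
          fun x hx => ⟨csInf_le hK.bddBelow hx, le_csSup hK.bddAbove hx⟩⟩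
    have hθ0 : ∀ t, t ∉ Icc a b → θ t = 0 := by
      intro t ht
      have h1 : η t = 0 := image_eq_zero_of_notMem_tsupport fun h => ht (hab (Or.inl h))
      have h2 : η₀ t = 0 := image_eq_zero_of_notMem_tsupport fun h => ht (hab (Or.inr h))
      simp [θ, h1, h2]
    have hθi : ∫ t, θ t = 0 := by
      have h1 : Integrable η := hη.continuous.integrable_of_hasCompactSupport hηc
      have h2 : Integrable η₀ := hη₀.continuous.integrable_of_hasCompactSupport hη₀c
      simp only [θ]
      rw [integral_sub h1 (h2.const_mul I), integral_const_mul, hη₀i, ← hI]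
      ring
    have hζ0 : ∀ t, t ∉ Icc a b → ζ t = 0 := by
      intro t ht
      rw [mem_Icc, not_and_or, not_le, not_le] at ht
      rcases ht with ht | ht
      · refine (intervalIntegral.integral_congr fun s hs => ?_).trans
          intervalIntegral.integral_zero
        refine hθ0 s fun hs' => ?_
        have : max 0 t < a := max_lt ha ht
        exact absurd (hs'.1.trans hs.2) (not_le.2 this)
      · by_cases hab' : a ≤ b
        · have h0t : (0 : ℝ) ≤ t := (ha.le.trans hab').trans ht.le
          have : ζ t = ∫ s, θ s := by
            change ∫ s in (0 : ℝ)..t, θ s = _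
            rw [intervalIntegral.integral_of_le h0t]
            refine setIntegral_eq_integral_of_forall_compl_eq_zero fun s hs => hθ0 s fun hs' => ?_
            exact hs ⟨ha.trans_le hs'.1, hs'.2.trans ht.le⟩
          rw [this, hθi]
        · refine (intervalIntegral.integral_congr fun s hs => ?_).trans
            intervalIntegral.integral_zero
          exact hθ0 s fun hs' => hab' (hs'.1.trans hs'.2)
    have hζs : tsupport ζ ⊆ Icc a b :=
      closure_minimal (fun t ht => by_contra fun h => ht (hζ0 t h)) isClosed_Icc
    have h1 := h ζ hζ (isCompact_Icc.of_isClosed_subset (isClosed_tsupport _) hζs)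
      (hζs.trans fun t ht => ⟨ha.trans_le ht.1, ht.2.trans_lt hb⟩)
    rw [hζ'] at h1
    have hb1 : ∀ {ψ : ℝ → ℝ}, Continuous ψ → IntegrableOn (fun t => ψ t * z t) (Ioo 0 T) := by
      intro ψ hψ
      exact ((hψ.continuousOn.mul hz).integrableOn_compact isCompact_Icc).mono_set
        Ioo_subset_Icc_self
    have h2 : ∫ t in Ioo 0 T, θ t * z t =
        (∫ t in Ioo 0 T, η t * z t) - I * ∫ t in Ioo 0 T, η₀ t * z t := by
      rw [← integral_const_mul, ← integral_sub (hb1 hη.continuous)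
        ((hb1 hη₀.continuous).const_mul I)]
      congr 1; ext t; simp only [θ]; ring
    have h3 : ∫ t in Ioo 0 T, η t = I :=
      setIntegral_eq_integral_of_forall_compl_eq_zero fun t ht =>
        image_eq_zero_of_notMem_tsupport fun h => ht (hηs h)
    rw [h3]
    linarith
  have hae : ∀ᵐ t, t ∈ Ioo 0 T → z t - c = 0 := by
    refine isOpen_Ioo.ae_eq_zero_of_integral_contDiff_smul_eq_zero ?_ fun η hη hηc hηs => ?_
    · exact (hzi.sub (integrableOn_const (by simp))).locallyIntegrableOn
    · have h0 : ∫ t, η t • (z t - c) = ∫ t in Ioo 0 T, η t • (z t - c) := by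
        refine (setIntegral_eq_integral_of_forall_compl_eq_zero fun t ht => ?_).symm
        rw [image_eq_zero_of_notMem_tsupport fun h => ht (hηs h), zero_smul]
      have h1 : IntegrableOn (fun t => η t * z t) (Ioo 0 T) :=
        ((hη.continuous.continuousOn.mul hz).integrableOn_compact isCompact_Icc).mono_set
          Ioo_subset_Icc_self
      have h2 : IntegrableOn η (Ioo 0 T) :=
        (hη.continuous.integrable_of_hasCompactSupport hηc).integrableOn
      rw [h0]
      simp only [smul_eq_mul, mul_sub]
      rw [integral_sub h1 (h2.mul_const c), integral_mul_const, key η hη hηc hηs, sub_self]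
  refine ⟨c, ?_⟩
  have h1 : EqOn z (fun _ => c) (Ioo 0 T) := by
    refine Measure.eqOn_open_of_ae_eq (μ := volume) ?_ isOpen_Ioo
      (hz.mono Ioo_subset_Icc_self) continuousOn_const
    rw [Filter.EventuallyEq, ae_restrict_iff' measurableSet_Ioo]
    filter_upwards [hae] with t ht htT
    linarith [ht htT]
  have h2 : EqOn z (fun _ => c) (Icc 0 T) := by
    refine h1.of_subset_closure hz continuousOn_const Ioo_subset_Icc_self ?_
    rw [closure_Ioo hT.ne]
  exact h2

/-- A continuous weak solution of `y' = -μ y` with `y 0 = 0` vanishes. -/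
theorem eq_zero_of_weak_decay {T : ℝ} (hT : 0 < T) {μ : ℝ} {y : ℝ → ℝ}
    (hy : ContinuousOn y (Icc 0 T)) (hy0 : y 0 = 0)
    (h : ∀ η : ℝ → ℝ, ContDiff ℝ ∞ η → HasCompactSupport η → tsupport η ⊆ Ioo 0 T →
      ∫ t in Ioo 0 T, deriv η t * y t = -∫ t in Ioo 0 T, η t * (-(μ * y t))) :
    ∀ t ∈ Icc 0 T, y t = 0 := by
  have hexp : ContDiff ℝ ∞ fun t : ℝ => Real.exp (μ * t) := by fun_prop
  -- the weak derivative of `exp (μ t) y` is zero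
  obtain ⟨c, hc⟩ := eqOn_const_of_integral_deriv_mul_eq_zero hT
    (z := fun t => Real.exp (μ * t) * y t) (hexp.continuous.continuousOn.mul hy) (by
      intro ζ hζ hζc hζs
      have hcont : ∀ {ψ : ℝ → ℝ}, Continuous ψ → IntegrableOn (fun t => ψ t * y t) (Ioo 0 T) :=
        fun hψ => ((hψ.continuousOn.mul hy).integrableOn_compact isCompact_Icc).mono_set
          Ioo_subset_Icc_self
      have h1 := h (fun t => ζ t * Real.exp (μ * t)) (hζ.mul hexp) hζc.mul_right
        ((tsupport_mul_subset_left).trans hζs)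
      have hd : deriv (fun t => ζ t * Real.exp (μ * t)) =
          fun t => deriv ζ t * Real.exp (μ * t) + μ * (ζ t * Real.exp (μ * t)) := by
        funext t
        have h3 : HasDerivAt ζ (deriv ζ t) t :=
          (hζ.differentiable (by simp)).differentiableAt.hasDerivAt
        have h4 : HasDerivAt (fun t : ℝ => Real.exp (μ * t)) (Real.exp (μ * t) * (μ * 1)) t :=
          ((hasDerivAt_id t).const_mul μ).exp
        rw [show (fun t => ζ t * Real.exp (μ * t)) = ζ * fun t => Real.exp (μ * t) from rfl,
          (h3.mul h4).deriv]
        ring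
      rw [hd] at h1
      have hζ'c : Continuous (deriv ζ) := hζ.continuous_deriv (by simp)
      have e1 : ∀ t, (deriv ζ t * Real.exp (μ * t) + μ * (ζ t * Real.exp (μ * t))) * y t =
          (deriv ζ t * Real.exp (μ * t)) * y t + (μ * (ζ t * Real.exp (μ * t))) * y t :=
        fun t => by ring
      have e2 : ∀ t, ζ t * Real.exp (μ * t) * (-(μ * y t)) =
          -((μ * (ζ t * Real.exp (μ * t))) * y t) := fun t => by ring
      simp only [e1, e2] at h1
      have i1 : IntegrableOn (fun t => deriv ζ t * Real.exp (μ * t) * y t) (Ioo 0 T) :=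
        hcont (hζ'c.mul hexp.continuous)
      have i2 : IntegrableOn (fun t => μ * (ζ t * Real.exp (μ * t)) * y t) (Ioo 0 T) :=
        hcont (continuous_const.mul (hζ.continuous.mul hexp.continuous))
      rw [integral_neg, neg_neg, integral_add i1 i2] at h1
      simp only [← mul_assoc] at h1 ⊢
      linarith)
  intro t ht
  have h0 := hc 0 ⟨le_rfl, hT.le⟩
  have h1 := hc t ht
  simp only [hy0, mul_zero] at h0
  rw [← h0] at h1
  exact (mul_eq_zero.1 h1).resolve_left (Real.exp_pos _).ne'

/-! ### Diagonal heat flow in a Hilbert space -/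

section Heat

variable {ι : Type*} {μ y₀ : ι → ℝ} {G : ι → ℝ → ℝ} {T : ℝ}

theorem sq_duhamel_le (hμ : ∀ i, 0 < μ i)
    (hG : ∀ i, MemLp (G i) 2 (volume.restrict (Ioo 0 T))) {t : ℝ} (ht : t ∈ Icc 0 T) (i : ι) :
    duhamel (μ i) (y₀ i) (G i) t ^ 2 ≤ y₀ i ^ 2 + (μ i)⁻¹ * ∫ s in Ioo 0 T, G i s ^ 2 := by
  refine le_trans ?_ (duhamel_energy (hμ i) (hG i) ht)
  have : 0 ≤ ∫ s in Ioo 0 t, duhamel (μ i) (y₀ i) (G i) s ^ 2 :=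
    integral_nonneg fun s => sq_nonneg _
  have := mul_nonneg (hμ i).le this
  linarith

theorem continuousOn_duhamel {μ y₀ : ℝ} {g : ℝ → ℝ} (hT : 0 ≤ T)
    (hg : MemLp g 2 (volume.restrict (Ioo 0 T))) :
    ContinuousOn (duhamel μ y₀ g) (Icc 0 T) := by
  rw [← uIcc_of_le hT]
  refine (duhamel_absolutelyContinuous ?_).continuousOn
  rw [intervalIntegrable_iff_integrableOn_Ioo_of_le hT]
  exact hg.integrable (by norm_num)

/-- The bound of the energy estimate, summed over the modes, gives `√μ y ∈ L²(0,T;ℓ²)`. -/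
theorem lintegral_tsum_duhamel_lt_top [Countable ι] (hT : 0 ≤ T) (hμ : ∀ i, 0 < μ i)
    (hy₀ : Summable fun i => y₀ i ^ 2)
    (hG : ∀ i, MemLp (G i) 2 (volume.restrict (Ioo 0 T)))
    (hs : Summable fun i => (μ i)⁻¹ * ∫ s in Ioo 0 T, G i s ^ 2) :
    ∫⁻ t in Ioo 0 T, ∑' i, ENNReal.ofReal (μ i * duhamel (μ i) (y₀ i) (G i) t ^ 2) < ⊤ := by
  have hint : ∀ i, IntegrableOn (fun t => μ i * duhamel (μ i) (y₀ i) (G i) t ^ 2) (Ioo 0 T) :=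
    fun i => ((((continuousOn_duhamel hT (hG i)).pow 2).integrableOn_compact
      isCompact_Icc).mono_set Ioo_subset_Icc_self).const_mul (μ i)
  rw [lintegral_tsum fun i => (hint i).aestronglyMeasurable.aemeasurable.ennreal_ofReal]
  refine lt_of_le_of_lt (ENNReal.tsum_le_tsum fun i => ?_) (hy₀.add hs).tsum_ofReal_lt_top
  rw [← ofReal_integral_eq_lintegral_ofReal (hint i)
    (Filter.Eventually.of_forall fun t => mul_nonneg (hμ i).le (sq_nonneg _))]
  refine ENNReal.ofReal_le_ofReal ?_
  rw [integral_const_mul]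
  refine le_trans ?_ (duhamel_energy (y₀ := y₀ i) (hμ i) (hG i) ⟨hT, le_rfl⟩)
  have := sq_nonneg (duhamel (μ i) (y₀ i) (G i) T)
  linarith

theorem ae_summable_duhamel [Countable ι] (hT : 0 ≤ T) (hμ : ∀ i, 0 < μ i)
    (hy₀ : Summable fun i => y₀ i ^ 2)
    (hG : ∀ i, MemLp (G i) 2 (volume.restrict (Ioo 0 T)))
    (hs : Summable fun i => (μ i)⁻¹ * ∫ s in Ioo 0 T, G i s ^ 2) :
    ∀ᵐ t ∂volume.restrict (Ioo 0 T),
      Summable fun i => μ i * duhamel (μ i) (y₀ i) (G i) t ^ 2 := by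
  have hm : AEMeasurable
      (fun t => ∑' i, ENNReal.ofReal (μ i * duhamel (μ i) (y₀ i) (G i) t ^ 2))
      (volume.restrict (Ioo 0 T)) := by
    refine AEMeasurable.tsum fun i => ?_
    refine (ContinuousOn.aemeasurable ?_ measurableSet_Ioo).ennreal_ofReal
    exact (continuousOn_const.mul ((continuousOn_duhamel hT (hG i)).pow 2)).mono
      Ioo_subset_Icc_self
  filter_upwards [ae_lt_top' hm (lintegral_tsum_duhamel_lt_top hT hμ hy₀ hG hs).ne] with t ht
  have h := ENNReal.summable_toReal ht.ne
  refine h.congr fun i => ?_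
  rw [ENNReal.toReal_ofReal (mul_nonneg (hμ i).le (sq_nonneg _))]

variable {H : Type*} [NormedAddCommGroup H] [InnerProductSpace ℝ H]

theorem hasSum_sq_inner (b : HilbertBasis ι ℝ H) (u : H) :
    HasSum (fun i => inner ℝ (b i) u ^ 2) (‖u‖ ^ 2) := by
  have h := b.hasSum_inner_mul_inner u u
  rw [real_inner_self_eq_norm_sq] at h
  refine h.congr_fun fun i => ?_
  rw [real_inner_comm, sq]

/-- The curve whose coordinates in a Hilbert basis solve `yᵢ' + μᵢ yᵢ = gᵢ` exists and is
continuous: by the energy estimate the squares of the coordinates are dominated by a summable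
family, uniformly in time. -/
theorem exists_continuousOn_duhamel (b : HilbertBasis ι ℝ H) (hT : 0 ≤ T) (hμ : ∀ i, 0 < μ i)
    (u₀ : H) (hG : ∀ i, MemLp (G i) 2 (volume.restrict (Ioo 0 T)))
    (hs : Summable fun i => (μ i)⁻¹ * ∫ s in Ioo 0 T, G i s ^ 2) :
    ∃ u : ℝ → H, ContinuousOn u (Icc 0 T) ∧ u 0 = u₀ ∧
      ∀ t ∈ Icc 0 T, ∀ i, inner ℝ (b i) (u t) = duhamel (μ i) (inner ℝ (b i) u₀) (G i) t := by
  classical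
  set Y : ι → ℝ → ℝ := fun i => duhamel (μ i) (inner ℝ (b i) u₀) (G i) with hY
  set M : ι → ℝ := fun i => inner ℝ (b i) u₀ ^ 2 + (μ i)⁻¹ * ∫ s in Ioo 0 T, G i s ^ 2 with hM
  have hMs : Summable M := (hasSum_sq_inner b u₀).summable.add hs
  have hYM : ∀ t ∈ Icc 0 T, ∀ i, Y i t ^ 2 ≤ M i := fun t ht i =>
    sq_duhamel_le (y₀ := fun i => inner ℝ (b i) u₀) hμ hG ht i
  have hmem : ∀ t ∈ Icc 0 T, Memℓp (fun i => Y i t) 2 := by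
    intro t ht
    rw [memℓp_gen_iff (by norm_num)]
    refine Summable.of_nonneg_of_le (fun i => by positivity) (fun i => ?_) hMs
    simpa using hYM t ht i
  let u : ℝ → H := fun t => if h : Memℓp (fun i => Y i t) 2 then b.repr.symm ⟨_, h⟩ else 0
  have hu : ∀ t ∈ Icc 0 T, ∀ i, inner ℝ (b i) (u t) = Y i t := by
    intro t ht i
    have : u t = b.repr.symm ⟨_, hmem t ht⟩ := dif_pos (hmem t ht)
    rw [this, ← b.repr_apply_apply, LinearIsometryEquiv.apply_symm_apply]
  have hext : ∀ x y : H, (∀ i, inner ℝ (b i) x = inner ℝ (b i) y) → x = y := by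
    intro x y hxy
    apply b.repr.injective
    ext i
    rw [b.repr_apply_apply, b.repr_apply_apply, hxy]
  refine ⟨u, ?_, ?_, hu⟩
  · intro t₀ ht₀
    rw [ContinuousWithinAt, tendsto_iff_norm_sub_tendsto_zero]
    have h1 : Filter.Tendsto (fun t => ∑' i, (Y i t - Y i t₀) ^ 2) (nhdsWithin t₀ (Icc 0 T))
        (nhds (∑' _ : ι, (0 : ℝ))) := by
      refine tendsto_tsum_of_dominated_convergence (bound := fun i => 4 * M i)
        (hMs.mul_left 4) (fun i => ?_) ?_
      · have h2 : Filter.Tendsto (Y i) (nhdsWithin t₀ (Icc 0 T)) (nhds (Y i t₀)) :=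
          continuousOn_duhamel hT (hG i) t₀ ht₀
        simpa using (h2.sub_const (Y i t₀)).pow 2
      · filter_upwards [self_mem_nhdsWithin] with t ht i
        rw [Real.norm_of_nonneg (sq_nonneg _)]
        have h3 := hYM t ht i
        have h4 := hYM t₀ ht₀ i
        nlinarith [sq_nonneg (Y i t + Y i t₀)]
    rw [tsum_zero] at h1
    have h2 := (Real.continuous_sqrt.tendsto 0).comp h1
    rw [Real.sqrt_zero] at h2
    refine h2.congr' ?_
    filter_upwards [self_mem_nhdsWithin] with t ht
    have h3 := (hasSum_sq_inner b (u t - u t₀)).tsum_eq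
    simp only [inner_sub_right, hu t ht, hu t₀ ht₀] at h3
    simp only [Function.comp, h3, Real.sqrt_sq (norm_nonneg _)]
  · refine hext _ _ fun i => ?_
    rw [hu 0 ⟨le_rfl, hT⟩ i]
    exact duhamel_zero _ _ _

end Heat

/-! ### Fourier analysis on the periodicity cell -/

-- The circle carries its Haar probability measure.
attribute [local instance] instMeasureSpaceUnitAddCircle

local instance : Measure.IsAddHaarMeasure (volume : Measure UnitAddCircle) :=
  inferInstanceAs (Measure.IsAddHaarMeasure AddCircle.haarAddCircle)

/-- The point of the half-open cell `(-π, π]²` that represents a point of the torus `(ℝ/ℤ)²`. -/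
def torusRep (τ : UnitAddTorus (Fin 2)) : Plane :=
  WithLp.toLp 2 fun i => 2 * Real.pi * (AddCircle.equivIoc (1 : ℝ) (-(1 / 2)) (τ i) : ℝ)

theorem measurableSet_cell : MeasurableSet cell := by
  have : cell = ⋂ i : Fin 2, (fun x : Plane => x i) ⁻¹' Ioo (-Real.pi) Real.pi := by
    ext x; simp [cell]
  rw [this]
  exact MeasurableSet.iInter fun i => measurableSet_preimage (by fun_prop) measurableSet_Ioo

theorem cell_subset_closedBall : cell ⊆ Metric.closedBall (0 : Plane) (2 * Real.pi) := by
  intro x hx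
  rw [mem_closedBall_zero_iff, EuclideanSpace.norm_eq, Fin.sum_univ_two]
  refine Real.sqrt_le_iff.2 ⟨by positivity, ?_⟩
  have h0 := hx 0
  have h1 := hx 1
  simp only [mem_Ioo] at h0 h1
  simp only [Real.norm_eq_abs, sq_abs]
  nlinarith [Real.pi_pos]

/-- Continuous functions on the plane are square integrable over the cell. -/
theorem memLp_cell {F : Type*} [NormedAddCommGroup F] {g : Plane → F} (hg : Continuous g) :
    MemLp g 2 (volume.restrict cell) := by
  obtain ⟨C, hC⟩ := (isCompact_closedBall (0 : Plane) (2 * Real.pi)).exists_bound_of_continuousOn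
    hg.continuousOn
  refine MemLp.of_bound hg.aestronglyMeasurable C ?_
  filter_upwards [ae_restrict_mem measurableSet_cell] with x hx
  exact hC x (cell_subset_closedBall hx)

theorem cell_ae_eq_Ioc : cell =ᵐ[volume] {x : Plane | ∀ i, x i ∈ Ioc (-Real.pi) Real.pi} := by
  have h : (univ : Set (Fin 2)).pi (fun _ => Ioo (-Real.pi) Real.pi) =ᵐ[volume]
      (univ : Set (Fin 2)).pi (fun _ => Ioc (-Real.pi) Real.pi) :=
    Measure.pi_Ioo_ae_eq_pi_Ioc (μ := fun _ => volume)
  have h2 := (PiLp.volume_preserving_ofLp (Fin 2)).quasiMeasurePreserving.preimage_ae_eq h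
  have e : ∀ I : Set ℝ, {x : Plane | ∀ i, x i ∈ I} =
      (WithLp.ofLp : Plane → Fin 2 → ℝ) ⁻¹' (univ : Set (Fin 2)).pi fun _ => I := by
    intro I; ext x; simp
  rw [cell, e, e]
  exact h2

theorem measurePreserving_torusRep :
    MeasurePreserving torusRep volume
      (ENNReal.ofReal ((2 * Real.pi) ^ 2)⁻¹ • volume.restrict cell) := by
  have h1 := UnitAddTorus.measurePreserving_equivPiIoc (d := Fin 2) (fun _ => -(1 / 2 : ℝ))
  have hR : MeasurableSet {x : Fin 2 → ℝ | ∀ i, x i ∈ Ioc (-(1 / 2 : ℝ)) (-(1 / 2) + 1)} :=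
    MeasurableSet.univ_pi' fun i => measurableSet_Ioc
  have h2 : MeasurePreserving
      (Subtype.val : {x : Fin 2 → ℝ // ∀ i, x i ∈ Ioc (-(1 / 2 : ℝ)) (-(1 / 2) + 1)} → _)
      (Measure.comap Subtype.val volume)
      (volume.restrict {x : Fin 2 → ℝ | ∀ i, x i ∈ Ioc (-(1 / 2 : ℝ)) (-(1 / 2) + 1)}) :=
    ⟨measurable_subtype_coe, map_comap_subtype_coe hR volume⟩
  have h3 : MeasurePreserving (fun x : Plane => (2 * Real.pi) • x) volume
      (ENNReal.ofReal ((2 * Real.pi) ^ 2)⁻¹ • volume) := by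
    refine ⟨by fun_prop, ?_⟩
    rw [Measure.map_addHaar_smul _ (by positivity)]
    congr 2
    rw [finrank_euclideanSpace_fin, abs_of_nonneg (by positivity)]
  have h4 := h3.comp (PiLp.volume_preserving_toLp (Fin 2))
  have h5 := h4.restrict_preimage
    (s := {x : Plane | ∀ i, x i ∈ Ioc (-Real.pi) Real.pi}) (by
      have : {x : Plane | ∀ i, x i ∈ Ioc (-Real.pi) Real.pi} =
          ⋂ i : Fin 2, (fun x : Plane => x i) ⁻¹' Ioc (-Real.pi) Real.pi := by
        ext x; simp
      rw [this]
      exact MeasurableSet.iInter fun i => measurableSet_preimage (by fun_prop) measurableSet_Ioc)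
  have h6 : ((fun x : Plane => (2 * Real.pi) • x) ∘ (@WithLp.toLp 2 (Fin 2 → ℝ))) ⁻¹'
      {x : Plane | ∀ i, x i ∈ Ioc (-Real.pi) Real.pi} =
      {x : Fin 2 → ℝ | ∀ i, x i ∈ Ioc (-(1 / 2 : ℝ)) (-(1 / 2) + 1)} := by
    ext x
    refine forall_congr' fun i => ?_
    simp only [Function.comp, PiLp.smul_apply, smul_eq_mul, mem_Ioc]
    have := Real.pi_pos
    constructor
    · rintro ⟨h, h'⟩; constructor <;> nlinarith
    · rintro ⟨h, h'⟩; constructor <;> nlinarith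
  rw [h6, Measure.restrict_smul, ← Measure.restrict_congr_set cell_ae_eq_Ioc] at h5
  exact (h5.comp h2).comp h1

theorem torus_weight_ne_zero : ENNReal.ofReal ((2 * Real.pi) ^ 2)⁻¹ ≠ 0 := by
  simp [Real.pi_ne_zero]

theorem integral_torusRep {F : Type*} [NormedAddCommGroup F] [NormedSpace ℝ F] {g : Plane → F}
    (hg : AEStronglyMeasurable g (volume.restrict cell)) :
    ∫ τ, g (torusRep τ) = ((2 * Real.pi) ^ 2)⁻¹ • ∫ x in cell, g x := by
  have h := measurePreserving_torusRep
  rw [← integral_map (φ := torusRep) h.measurable.aemeasurable, h.map_eq, integral_smul_measure,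
    ENNReal.toReal_ofReal (by positivity)]
  rw [h.map_eq]
  exact hg.smul_measure _

theorem coe_torusRep_div (τ : UnitAddTorus (Fin 2)) (i : Fin 2) :
    ((torusRep τ i / (2 * Real.pi) : ℝ) : UnitAddCircle) = τ i := by
  have : torusRep τ i / (2 * Real.pi) = (AddCircle.equivIoc (1 : ℝ) (-(1 / 2)) (τ i) : ℝ) := by
    simp only [torusRep]
    field_simp
  rw [this]
  exact AddCircle.coe_equivIoc

theorem mFourier_eq_exp (ξ : Fin 2 → ℤ) (τ : UnitAddTorus (Fin 2)) :
    UnitAddTorus.mFourier ξ τ = Complex.exp (Complex.I * (freqDot ξ (torusRep τ) : ℂ)) := by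
  simp only [UnitAddTorus.mFourier, ContinuousMap.coe_mk, freqDot, Complex.ofReal_sum,
    Finset.mul_sum, Complex.exp_sum]
  refine Finset.prod_congr rfl fun i _ => ?_
  conv_lhs => rw [← coe_torusRep_div τ i, fourier_coe_apply]
  congr 1
  have := Real.pi_pos.ne'
  push_cast
  field_simp

theorem continuous_freqDot (ξ : Fin 2 → ℤ) : Continuous (freqDot ξ) := by
  unfold freqDot; fun_prop

/-- Orthogonality of the exponentials. -/
theorem integral_exp_freqDot (ξ : Fin 2 → ℤ) :
    ∫ x in cell, Complex.exp (Complex.I * (freqDot ξ x : ℂ)) =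
      if ξ = 0 then ((2 * Real.pi : ℝ) : ℂ) ^ 2 else 0 := by
  have h := integral_torusRep (g := fun x => Complex.exp (Complex.I * (freqDot ξ x : ℂ)))
    (Continuous.aestronglyMeasurable (by have := continuous_freqDot ξ; fun_prop))
  simp only [← mFourier_eq_exp] at h
  have h2 : ∫ τ, UnitAddTorus.mFourier ξ τ = if ξ = 0 then 1 else 0 := by
    have h3 := (orthonormal_iff_ite.1 (UnitAddTorus.orthonormal_mFourier (d := Fin 2))) 0 ξ
    rw [ContinuousMap.inner_toLp] at h3
    simp only [UnitAddTorus.mFourier_zero, ContinuousMap.one_apply, map_one, mul_one] at h3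
    simpa [eq_comm] using h3.symm
  rw [h2] at h
  have hpi : ((2 * Real.pi) ^ 2 : ℝ) ≠ 0 := by positivity
  have h4 := congrArg (fun z => ((2 * Real.pi) ^ 2 : ℝ) • z) h
  simp only [smul_smul, mul_inv_cancel₀ hpi, one_smul] at h4
  rw [← h4]
  split_ifs <;> simp

/-- The Fourier coefficients of a scalar function on the cell. -/
def scalarCoeff (g : Plane → ℝ) (ξ : Fin 2 → ℤ) : ℂ :=
  (1 / (2 * (Real.pi : ℂ)) ^ 2) *
    ∫ x in cell, Complex.exp (-(Complex.I * (freqDot ξ x : ℂ))) * (g x : ℂ)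

theorem fourierCoeff_apply (u : Plane → Plane) (ξ : Fin 2 → ℤ) (j : Fin 2) :
    fourierCoeff u ξ j = scalarCoeff (fun x => u x j) ξ := rfl

/-- Completeness of the trigonometric system on the cell. -/
theorem ae_eq_zero_of_scalarCoeff_eq_zero {g : Plane → ℝ}
    (hg : MemLp g 2 (volume.restrict cell)) (h : ∀ ξ, scalarCoeff g ξ = 0) :
    g =ᵐ[volume.restrict cell] 0 := by
  have hs := measurePreserving_torusRep
  have hg2 : MemLp g 2 (ENNReal.ofReal ((2 * Real.pi) ^ 2)⁻¹ • volume.restrict cell) :=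
    hg.smul_measure ENNReal.ofReal_ne_top
  have hG : MemLp (fun τ => ((g (torusRep τ) : ℝ) : ℂ)) 2
      (volume : Measure (UnitAddTorus (Fin 2))) :=
    (hg2.comp_measurePreserving hs).ofReal
  have h0 : hG.toLp _ = 0 := by
    apply UnitAddTorus.mFourierBasis.repr.injective
    ext ξ
    rw [UnitAddTorus.mFourierBasis_repr, map_zero, lp.coeFn_zero, Pi.zero_apply,
      UnitAddTorus.mFourierCoeff]
    have h1 : ∫ τ, UnitAddTorus.mFourier (-ξ) τ • hG.toLp _ τ =
        ∫ τ, Complex.exp (-(Complex.I * (freqDot ξ (torusRep τ) : ℂ))) *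
          (g (torusRep τ) : ℂ) := by
      refine integral_congr_ae ?_
      filter_upwards [hG.coeFn_toLp] with τ hτ
      rw [hτ, mFourier_eq_exp, smul_eq_mul]
      congr 2
      simp [freqDot]
      ring
    rw [h1, integral_torusRep (g := fun x => Complex.exp (-(Complex.I * (freqDot ξ x : ℂ))) *
          (g x : ℂ))]
    · have h2 := h ξ
      rw [scalarCoeff, mul_eq_zero] at h2
      rcases h2 with h2 | h2
      · exfalso
        have := Real.pi_pos.ne'
        simp [this] at h2
      · rw [h2, smul_zero]
    · refine AEStronglyMeasurable.mul (Continuous.aestronglyMeasurable ?_)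
        (Complex.continuous_ofReal.comp_aestronglyMeasurable hg.1)
      have := continuous_freqDot ξ
      fun_prop
  have h1 : eLpNorm (g ∘ torusRep) 2 volume = 0 := by
    rw [eLpNorm_eq_zero_iff (hg2.comp_measurePreserving hs).1 (by norm_num)]
    have h2 := hG.coeFn_toLp
    rw [h0] at h2
    filter_upwards [h2, Lp.coeFn_zero ℂ 2 (volume : Measure (UnitAddTorus (Fin 2)))] with τ h3 h4
    rw [h4] at h3
    simpa using h3.symm
  rw [eLpNorm_comp_measurePreserving hg2.1 hs, eLpNorm_eq_zero_iff hg2.1 (by norm_num)] at h1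
  exact (Measure.ae_ennreal_smul_measure_iff torus_weight_ne_zero).1 h1

theorem IsPeriodic.add_int {F : Type*} {g : Plane → F} (hg : IsPeriodic g) (m : Fin 2 → ℤ)
    (x : Plane) : g (x + WithLp.toLp 2 fun i => (m i : ℝ) * (2 * Real.pi)) = g x := by
  have key : ∀ (i : Fin 2) (k : ℤ) (x : Plane),
      g (x + EuclideanSpace.single i ((k : ℝ) * (2 * Real.pi))) = g x := by
    intro i k x
    have hp : Function.Periodic (fun r : ℝ => g (x + EuclideanSpace.single i r))
        (2 * Real.pi) := by
      intro r
      have := hg i (x + EuclideanSpace.single i r)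
      rw [add_assoc, ← PiLp.single_add] at this
      exact this
    have := hp.int_mul k 0
    simp only [zero_add] at this
    rw [this, show (EuclideanSpace.single i (0 : ℝ) : Plane) = 0 by ext j; simp, add_zero]
  have : (WithLp.toLp 2 fun i => (m i : ℝ) * (2 * Real.pi) : Plane) =
      EuclideanSpace.single 0 ((m 0 : ℝ) * (2 * Real.pi)) +
        EuclideanSpace.single 1 ((m 1 : ℝ) * (2 * Real.pi)) := by
    ext i; fin_cases i <;> simp
  rw [this, ← add_assoc, key, key]

/-- Integrals of periodic functions over the cell are translation invariant. -/
theorem setIntegral_cell_add {F : Type*} [NormedAddCommGroup F] [NormedSpace ℝ F] {g : Plane → F}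
    (hg : Continuous g) (hp : IsPeriodic g) (v : Plane) :
    ∫ x in cell, g (x + v) = ∫ x in cell, g x := by
  let σ : UnitAddTorus (Fin 2) := fun i => ((v i / (2 * Real.pi) : ℝ) : UnitAddCircle)
  have h1 : ∀ τ, g (torusRep (τ + σ)) = g (torusRep τ + v) := by
    intro τ
    have h2 : ∀ i, ∃ m : ℤ, torusRep τ i + v i = torusRep (τ + σ) i + m * (2 * Real.pi) := by
      intro i
      have h3 : ((torusRep (τ + σ) i / (2 * Real.pi) : ℝ) : UnitAddCircle) =
          (((torusRep τ i + v i) / (2 * Real.pi) : ℝ) : UnitAddCircle) := by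
        rw [coe_torusRep_div, add_div, AddCircle.coe_add, coe_torusRep_div]
        rfl
      rw [← sub_eq_zero, ← AddCircle.coe_sub, AddCircle.coe_eq_zero_iff] at h3
      obtain ⟨m, hm⟩ := h3
      refine ⟨-m, ?_⟩
      rw [← sub_div, eq_div_iff (by positivity)] at hm
      simp only [zsmul_eq_mul, mul_one] at hm
      push_cast
      linarith
    choose m hm using h2
    have h4 : torusRep τ + v = torusRep (τ + σ) +
        WithLp.toLp 2 fun i => (m i : ℝ) * (2 * Real.pi) := by
      ext i; simpa using hm i
    rw [h4, hp.add_int]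
  have h2 : ∫ τ, g (torusRep (τ + σ)) = ∫ τ, g (torusRep τ) :=
    integral_add_right_eq_self (fun τ => g (torusRep τ)) σ
  simp only [h1] at h2
  rw [integral_torusRep hg.aestronglyMeasurable,
    integral_torusRep (g := fun x => g (x + v))
      (Continuous.aestronglyMeasurable (by fun_prop))] at h2
  have hpi : (((2 * Real.pi) ^ 2)⁻¹ : ℝ) ≠ 0 := by positivity
  exact smul_right_injective F hpi h2

/-! ### The interaction kernel and the symbol -/

section Kernel

variable {w : ℝ → ℝ} {δ : ℝ} {n : Plane}

/-- The kernel `χ_n(s) w_δ(|s|) / |s|` of the nonlocal operators. -/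
def kern (w : ℝ → ℝ) (δ : ℝ) (n : Plane) (s : Plane) : ℝ :=
  (halfSpace n).indicator (fun _ => (1 : ℝ)) s * (scaledKernel w δ ‖s‖ / ‖s‖)

theorem measurableSet_halfSpace (n : Plane) : MeasurableSet (halfSpace n) :=
  (isClosed_le continuous_const (by fun_prop)).measurableSet

theorem kern_nonneg (hw : IsKernel w) (hδ : 0 < δ) (s : Plane) : 0 ≤ kern w δ n s := by
  refine mul_nonneg (indicator_nonneg (fun _ _ => zero_le_one) _) ?_
  have := hw.nonneg (‖s‖ / δ) (by positivity)
  unfold scaledKernel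
  positivity

theorem kern_mul_sq (s : Plane) : kern w δ n s * ‖s‖ ^ 2 =
    (halfSpace n).indicator (fun s => scaledKernel w δ ‖s‖ * ‖s‖) s := by
  by_cases hs : s = 0
  · subst hs
    by_cases h : (0 : Plane) ∈ halfSpace n <;> simp [kern, h]
  · have : ‖s‖ ≠ 0 := norm_ne_zero_iff.2 hs
    by_cases h : s ∈ halfSpace n
    · simp only [kern, indicator_of_mem h]; field_simp
    · simp [kern, indicator_of_notMem h]

theorem integrable_kern (hw : IsKernel w) (hδ : 0 < δ) :
    Integrable fun s : Plane => kern w δ n s * ‖s‖ ^ 2 := by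
  simp only [kern_mul_sq]
  refine Integrable.indicator ?_ (measurableSet_halfSpace n)
  have h := (hw.integrable.comp_smul (R := δ⁻¹) (by positivity)).const_mul (δ ^ 2)⁻¹
  refine h.congr (Filter.Eventually.of_forall fun s => ?_)
  simp only [scaledKernel, norm_smul, norm_inv, Real.norm_of_nonneg hδ.le]
  rw [show δ⁻¹ * ‖s‖ = ‖s‖ / δ by ring]
  field_simp

theorem aestronglyMeasurable_kern (hw : IsKernel w) (hδ : 0 < δ) :
    AEStronglyMeasurable (kern w δ n) volume := by
  have h1 := (integrable_kern (n := n) hw hδ).aestronglyMeasurable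
  have h2 : AEStronglyMeasurable (fun s : Plane => (‖s‖ ^ 2)⁻¹) volume :=
    (Measurable.inv (by fun_prop)).aestronglyMeasurable
  refine (h1.mul h2).congr (Filter.Eventually.of_forall fun s => ?_)
  by_cases hs : s = 0
  · subst hs; simp [kern]
  · have : ‖s‖ ≠ 0 := norm_ne_zero_iff.2 hs
    simp only [Pi.mul_apply]
    field_simp

/-- Functions dominated by the kernel times `|s|²` are integrable. -/
theorem integrable_kern_smul (hw : IsKernel w) (hδ : 0 < δ) {F : Type*} [NormedAddCommGroup F]
    [NormedSpace ℝ F] {g : Plane → F} (hg : Continuous g) {C : ℝ}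
    (hC : ∀ s, ‖g s‖ ≤ C * ‖s‖ ^ 2) : Integrable fun s => kern w δ n s • g s := by
  refine ((integrable_kern (n := n) hw hδ).const_mul C).mono'
    ((aestronglyMeasurable_kern hw hδ).smul hg.aestronglyMeasurable)
    (Filter.Eventually.of_forall fun s => ?_)
  rw [norm_smul, Real.norm_of_nonneg (kern_nonneg hw hδ s)]
  have := mul_le_mul_of_nonneg_left (hC s) (kern_nonneg (n := n) hw hδ s)
  linarith

theorem ae_kern_pos (hw : IsKernel w) (hδ : 0 < δ) :
    ∀ᵐ s : Plane, ‖s‖ < δ → 0 < inner ℝ s n → 0 < kern w δ n s := by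
  have hq : Measure.QuasiMeasurePreserving (fun x : Plane => δ⁻¹ • x) volume volume := by
    refine ⟨by fun_prop, ?_⟩
    rw [Measure.map_addHaar_smul _ (by positivity)]
    exact Measure.smul_absolutelyContinuous
  filter_upwards [hq.ae hw.pos] with s hs h1 h2
  have h3 : ‖δ⁻¹ • s‖ = ‖s‖ / δ := by
    rw [norm_smul, norm_inv, Real.norm_of_nonneg hδ.le]; ring
  rw [h3] at hs
  have h4 := hs ((div_le_one hδ).2 h1.le)
  have h5 : s ≠ 0 := by rintro rfl; simp at h2
  have h6 : 0 < ‖s‖ := norm_pos_iff.2 h5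
  have h7 : s ∈ halfSpace n := h2.le
  simp only [kern, indicator_of_mem h7, scaledKernel]
  positivity

/-- The complex exponential `e^{iξ·x}`. -/
def expI (ξ : Fin 2 → ℤ) (x : Plane) : ℂ := Complex.exp (Complex.I * (freqDot ξ x : ℂ))

theorem continuous_expI (ξ : Fin 2 → ℤ) : Continuous (expI ξ) := by
  have := continuous_freqDot ξ
  unfold expI; fun_prop

theorem freqDot_add (ξ : Fin 2 → ℤ) (x y : Plane) :
    freqDot ξ (x + y) = freqDot ξ x + freqDot ξ y := by
  simp only [freqDot, PiLp.add_apply, mul_add, Finset.sum_add_distrib]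

theorem freqDot_neg (ξ : Fin 2 → ℤ) (x : Plane) : freqDot ξ (-x) = -freqDot ξ x := by
  simp [freqDot]

theorem freqDot_smul (ξ : Fin 2 → ℤ) (c : ℝ) (x : Plane) :
    freqDot ξ (c • x) = c * freqDot ξ x := by
  simp [freqDot]; ring

theorem neg_freqDot (ξ : Fin 2 → ℤ) (x : Plane) : freqDot (-ξ) x = -freqDot ξ x := by
  simp [freqDot]

theorem expI_add (ξ : Fin 2 → ℤ) (x y : Plane) : expI ξ (x + y) = expI ξ x * expI ξ y := by
  simp only [expI, freqDot_add, ← Complex.exp_add]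
  congr 1; push_cast; ring

theorem conj_expI (ξ : Fin 2 → ℤ) (x : Plane) :
    (starRingEnd ℂ) (expI ξ x) = Complex.exp (-(Complex.I * (freqDot ξ x : ℂ))) := by
  rw [expI, ← Complex.exp_conj]
  simp

theorem expI_neg_right (ξ : Fin 2 → ℤ) (x : Plane) :
    expI ξ (-x) = (starRingEnd ℂ) (expI ξ x) := by
  rw [conj_expI, expI, freqDot_neg]; simp

theorem expI_neg_left (ξ : Fin 2 → ℤ) (x : Plane) :
    expI (-ξ) x = (starRingEnd ℂ) (expI ξ x) := by
  rw [conj_expI, expI, neg_freqDot]; simp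

theorem norm_expI (ξ : Fin 2 → ℤ) (x : Plane) : ‖expI ξ x‖ = 1 := by
  rw [expI, mul_comm, Complex.norm_exp_ofReal_mul_I]

theorem abs_coord_le (x : Plane) (j : Fin 2) : |x j| ≤ ‖x‖ := by
  simpa using PiLp.norm_apply_le x j

theorem norm_expI_sub_one_le (ξ : Fin 2 → ℤ) (s : Plane) :
    ‖expI ξ s - 1‖ ≤ (∑ i, |(ξ i : ℝ)|) * ‖s‖ := by
  refine Real.norm_exp_I_mul_ofReal_sub_one_le.trans ?_
  rw [freqDot, Finset.sum_mul]
  refine (norm_sum_le _ _).trans (Finset.sum_le_sum fun i _ => ?_)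
  rw [norm_mul]
  exact mul_le_mul_of_nonneg_left (abs_coord_le s i) (norm_nonneg _)

theorem integrable_symbol (hw : IsKernel w) (hδ : 0 < δ) (ξ : Fin 2 → ℤ) (j : Fin 2) :
    Integrable fun s : Plane => kern w δ n s • ((s j : ℂ) * (expI ξ s - 1)) := by
  refine integrable_kern_smul hw hδ (C := ∑ i, |(ξ i : ℝ)|) ?_ fun s => ?_
  · have := continuous_expI ξ
    fun_prop
  · rw [norm_mul, Complex.norm_real]
    have h1 := norm_expI_sub_one_le ξ s
    have h2 := abs_coord_le s j
    calc ‖s j‖ * ‖expI ξ s - 1‖ ≤ ‖s‖ * ((∑ i, |(ξ i : ℝ)|) * ‖s‖) :=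
          mul_le_mul h2 h1 (norm_nonneg _) (norm_nonneg _)
      _ = _ := by ring

theorem symbol_apply (ξ : Fin 2 → ℤ) (j : Fin 2) :
    symbol w δ n ξ j = 2 * ∫ s : Plane, kern w δ n s • ((s j : ℂ) * (expI ξ s - 1)) := by
  simp only [symbol]
  rw [← integral_indicator (measurableSet_halfSpace n)]
  congr 2
  funext s
  by_cases h : s ∈ halfSpace n
  · simp only [kern, indicator_of_mem h, Complex.real_smul, expI]; push_cast; ring
  · simp [kern, indicator_of_notMem h]

theorem symbol_neg (ξ : Fin 2 → ℤ) (j : Fin 2) :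
    symbol w δ n (-ξ) j = (starRingEnd ℂ) (symbol w δ n ξ j) := by
  rw [symbol_apply, symbol_apply, map_mul, ← integral_conj]
  congr 2
  · exact (map_ofNat (starRingEnd ℂ) 2).symm
  · funext s
    simp only [expI_neg_left, Complex.real_smul, map_mul, map_sub, map_one, Complex.conj_ofReal]

theorem norm_symbol_neg (ξ : Fin 2 → ℤ) : ‖symbol w δ n (-ξ)‖ = ‖symbol w δ n ξ‖ := by
  simp [EuclideanSpace.norm_eq, symbol_neg]

/-- There are small vectors in the open half space with `cos (ξ · s) ≠ 1`. -/
theorem exists_cos_freqDot_ne_one (hδ : 0 < δ) (hn : ‖n‖ = 1) {ξ : Fin 2 → ℤ} (hξ : ξ ≠ 0) :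
    ∃ s : Plane, ‖s‖ < δ ∧ 0 < inner ℝ s n ∧ Real.cos (freqDot ξ s) ≠ 1 := by
  obtain ⟨r, hr1, hr2⟩ : ∃ r : Plane, 0 < inner ℝ r n ∧ freqDot ξ r ≠ 0 := by
    have hnn : inner ℝ n n = (1 : ℝ) := by rw [real_inner_self_eq_norm_sq, hn]; norm_num
    by_cases h : freqDot ξ n = 0
    · let x : Plane := WithLp.toLp 2 fun i => (ξ i : ℝ)
      have h1 : inner ℝ x n = (0 : ℝ) := by
        rw [← h]; simp [x, freqDot, PiLp.inner_apply, mul_comm]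
      refine ⟨n + x, by rw [inner_add_left, hnn, h1]; norm_num, ?_⟩
      rw [freqDot_add, h, zero_add]
      simp only [freqDot, x]
      obtain ⟨i, hi⟩ : ∃ i, ξ i ≠ 0 := Function.ne_iff.1 hξ
      have h2 : 0 < ∑ i, (ξ i : ℝ) * (ξ i : ℝ) := by
        refine Finset.sum_pos' (fun i _ => mul_self_nonneg _) ⟨i, Finset.mem_univ i, ?_⟩
        exact mul_self_pos.2 (by exact_mod_cast hi)
      exact h2.ne'
    · exact ⟨n, by rw [hnn]; norm_num, h⟩
  set D := 1 + ‖r‖ / δ + |freqDot ξ r| with hD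
  have h0 : 0 ≤ ‖r‖ / δ := by positivity
  have h0' := abs_nonneg (freqDot ξ r)
  have hDpos : 0 < D := by positivity
  refine ⟨D⁻¹ • r, ?_, ?_, ?_⟩
  · rw [norm_smul, norm_inv, Real.norm_of_nonneg hDpos.le, inv_mul_lt_iff₀ hDpos, hD]
    have : ‖r‖ = ‖r‖ / δ * δ := by field_simp
    nlinarith [mul_nonneg h0' hδ.le]
  · rw [real_inner_smul_left]; positivity
  · rw [freqDot_smul]
    have h1 : |D⁻¹ * freqDot ξ r| < 1 := by
      rw [abs_mul, abs_inv, abs_of_pos hDpos, inv_mul_lt_iff₀ hDpos, hD]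
      linarith
    have h2 := abs_lt.1 h1
    have h3 := Real.pi_gt_three
    rw [Ne, Real.cos_eq_one_iff_of_lt_of_lt (by linarith) (by linarith)]
    exact mul_ne_zero (by positivity) hr2

/-- The symbol has no zeros besides the zero frequency: the component of `λ(ξ)` along `n` has
negative real part. -/
theorem symbol_ne_zero (hw : IsKernel w) (hδ : 0 < δ) (hn : ‖n‖ = 1) {ξ : Fin 2 → ℤ}
    (hξ : ξ ≠ 0) : symbol w δ n ξ ≠ 0 := by
  intro h0
  have hj : ∀ j, ∫ s : Plane, kern w δ n s * (s j * (Real.cos (freqDot ξ s) - 1)) = 0 ∧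
      Integrable fun s : Plane => kern w δ n s * (s j * (Real.cos (freqDot ξ s) - 1)) := by
    intro j
    have h1 := symbol_apply (w := w) (δ := δ) (n := n) ξ j
    rw [h0] at h1
    have h2 : ∫ s : Plane, kern w δ n s • ((s j : ℂ) * (expI ξ s - 1)) = 0 := by
      simpa using h1.symm
    have h3 := integrable_symbol (n := n) hw hδ ξ j
    have h4 : ∀ s : Plane, RCLike.re (kern w δ n s • ((s j : ℂ) * (expI ξ s - 1))) =
        kern w δ n s * (s j * (Real.cos (freqDot ξ s) - 1)) := by
      intro s
      simp [expI, Complex.exp_re]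
    constructor
    · have := integral_re h3
      rw [h2] at this
      simpa only [h4, map_zero] using this
    · simpa only [h4] using h3.re
  have h1 : ∫ s : Plane, kern w δ n s * (inner ℝ s n * (1 - Real.cos (freqDot ξ s))) = 0 ∧
      Integrable fun s : Plane => kern w δ n s * (inner ℝ s n * (1 - Real.cos (freqDot ξ s))) := by
    have e : (fun s : Plane => kern w δ n s * (inner ℝ s n * (1 - Real.cos (freqDot ξ s)))) =
        fun s => (-n 0) * (kern w δ n s * (s 0 * (Real.cos (freqDot ξ s) - 1))) +
          (-n 1) * (kern w δ n s * (s 1 * (Real.cos (freqDot ξ s) - 1))) := by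
      funext s
      simp only [PiLp.inner_apply, Fin.sum_univ_two, RCLike.inner_apply, conj_trivial]
      ring
    rw [e]
    have i0 := (hj 0).2.const_mul (-n 0)
    have i1 := (hj 1).2.const_mul (-n 1)
    refine ⟨?_, i0.add i1⟩
    rw [integral_add i0 i1, integral_const_mul, integral_const_mul, (hj 0).1, (hj 1).1]
    simp
  have h2 : ∀ s : Plane, 0 ≤ kern w δ n s * (inner ℝ s n * (1 - Real.cos (freqDot ξ s))) := by
    intro s
    by_cases hs : s ∈ halfSpace n
    · exact mul_nonneg (kern_nonneg hw hδ s)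
        (mul_nonneg hs (sub_nonneg.2 (Real.cos_le_one _)))
    · simp [kern, indicator_of_notMem hs]
  have h3 := (integral_eq_zero_iff_of_nonneg h2 h1.2).1 h1.1
  let U : Set Plane := {s | ‖s‖ < δ ∧ 0 < inner ℝ s n ∧ Real.cos (freqDot ξ s) ≠ 1}
  have hU : IsOpen U := by
    have := continuous_freqDot ξ
    have h4 : IsOpen {s : Plane | ‖s‖ < δ} := isOpen_lt (by fun_prop) continuous_const
    have h5 : IsOpen {s : Plane | 0 < inner ℝ s n} := isOpen_lt continuous_const (by fun_prop)
    have h6 : IsOpen {s : Plane | Real.cos (freqDot ξ s) ≠ 1} :=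
      isOpen_ne_fun (by fun_prop) continuous_const
    exact h4.inter (h5.inter h6)
  have hUne : U.Nonempty := exists_cos_freqDot_ne_one hδ hn hξ
  have hpos := hU.measure_pos volume hUne
  have hzero : volume U = 0 := by
    refine measure_mono_null (t := {s | ¬ ((‖s‖ < δ → 0 < inner ℝ s n → 0 < kern w δ n s) ∧
      kern w δ n s * (inner ℝ s n * (1 - Real.cos (freqDot ξ s))) = 0)}) ?_
      (ae_iff.1 ((ae_kern_pos (n := n) hw hδ).and h3))
    rintro s ⟨hs1, hs2, hs3⟩ ⟨h4, h5⟩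
    have h6 := h4 hs1 hs2
    have h7 : 0 < 1 - Real.cos (freqDot ξ s) :=
      sub_pos.2 (lt_of_le_of_ne (Real.cos_le_one _) hs3)
    have : 0 < kern w δ n s * (inner ℝ s n * (1 - Real.cos (freqDot ξ s))) := by positivity
    exact this.ne' h5
  exact hpos.ne' hzero

end Kernel

/-! ### The nonlocal operators on Lipschitz periodic functions -/

section Operators

variable {w : ℝ → ℝ} {δ : ℝ} {n : Plane}

theorem grad_eq (φ : Plane → ℝ) (x : Plane) :
    grad w δ n φ x = (2 : ℝ) • ∫ s : Plane, kern w δ n s • ((φ (x + s) - φ x) • s) := by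
  rw [grad, ← integral_add_right_eq_self _ x]
  congr 2
  funext s
  simp only [add_sub_cancel_right, kern, smul_smul]
  rw [add_comm s x]
  congr 1
  ring

theorem div_eq (v : Plane → Plane) (x : Plane) :
    div w δ n v x = 2 * ∫ s : Plane, kern w δ n s • inner ℝ s (v x - v (x - s)) := rfl

theorem integrable_grad (hw : IsKernel w) (hδ : 0 < δ) {φ : Plane → ℝ} {L : NNReal}
    (hφ : LipschitzWith L φ) (x : Plane) :
    Integrable fun s : Plane => kern w δ n s • ((φ (x + s) - φ x) • s) := by
  refine integrable_kern_smul hw hδ (C := L) ?_ fun s => ?_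
  · have := hφ.continuous
    fun_prop
  · rw [norm_smul]
    have h := hφ.dist_le_mul (x + s) x
    rw [dist_eq_norm, dist_eq_norm, add_sub_cancel_left] at h
    have := mul_le_mul_of_nonneg_right h (norm_nonneg s)
    linarith

theorem norm_inner_sub_le {v : Plane → Plane} {L : NNReal} (hv : LipschitzWith L v)
    (x s : Plane) : ‖(inner ℝ s (v x - v (x - s)) : ℝ)‖ ≤ L * ‖s‖ ^ 2 := by
  refine (norm_inner_le_norm _ _).trans ?_
  have h := hv.dist_le_mul x (x - s)
  rw [dist_eq_norm, dist_eq_norm, sub_sub_cancel] at h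
  have := mul_le_mul_of_nonneg_left h (norm_nonneg s)
  linarith

theorem integrable_div (hw : IsKernel w) (hδ : 0 < δ) {v : Plane → Plane} {L : NNReal}
    (hv : LipschitzWith L v) (x : Plane) :
    Integrable fun s : Plane => kern w δ n s • (inner ℝ s (v x - v (x - s)) : ℝ) := by
  refine integrable_kern_smul hw hδ (C := L) ?_ (norm_inner_sub_le hv x)
  have := hv.continuous
  fun_prop

theorem continuous_div (hw : IsKernel w) (hδ : 0 < δ) {v : Plane → Plane} {L : NNReal}
    (hv : LipschitzWith L v) : Continuous (div w δ n v) := by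
  have hc := hv.continuous
  have : div w δ n v = fun x => 2 * ∫ s : Plane, kern w δ n s • (inner ℝ s (v x - v (x - s)) : ℝ) :=
    rfl
  rw [this]
  refine continuous_const.mul (continuous_of_dominated
    (bound := fun s => L * (kern w δ n s * ‖s‖ ^ 2))
    (fun x => (integrable_div hw hδ hv x).aestronglyMeasurable) (fun x => ?_)
    ((integrable_kern hw hδ).const_mul _) (Filter.Eventually.of_forall fun s => by fun_prop))
  refine Filter.Eventually.of_forall fun s => ?_
  rw [norm_smul, Real.norm_of_nonneg (kern_nonneg hw hδ s)]
  have := mul_le_mul_of_nonneg_left (norm_inner_sub_le hv x s) (kern_nonneg (n := n) hw hδ s)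
  linarith

theorem IsPeriodic.grad {φ : Plane → ℝ} (hφ : IsPeriodic φ) : IsPeriodic (grad w δ n φ) := by
  intro i x
  rw [grad_eq, grad_eq]
  have h : ∀ s, φ (x + EuclideanSpace.single i (2 * Real.pi) + s) = φ (x + s) := fun s => by
    rw [add_right_comm, hφ i]
  simp only [h, hφ i x]

/-- A continuous periodic function is bounded. -/
theorem IsPeriodic.exists_norm_le {F : Type*} [NormedAddCommGroup F] {g : Plane → F}
    (hp : IsPeriodic g) (hg : Continuous g) : ∃ C, ∀ x, ‖g x‖ ≤ C := by
  obtain ⟨C, hC⟩ := (isCompact_closedBall (0 : Plane) (2 * Real.pi * 2)).exists_bound_of_continuousOn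
    hg.continuousOn
  refine ⟨C, fun x => ?_⟩
  have hpi := Real.two_pi_pos
  let m : Fin 2 → ℤ := fun i => ⌊x i / (2 * Real.pi)⌋
  set y : Plane := x - WithLp.toLp 2 fun i => (m i : ℝ) * (2 * Real.pi) with hy
  have hgx : g x = g y := by
    rw [← hp.add_int m y, hy, sub_add_cancel]
  have hyi : ∀ i, ‖y i‖ ≤ 2 * Real.pi := by
    intro i
    have h1 : y i = x i - (m i : ℝ) * (2 * Real.pi) := by simp [hy]
    have h2 := Int.floor_le (x i / (2 * Real.pi))
    have h3 := Int.lt_floor_add_one (x i / (2 * Real.pi))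
    rw [le_div_iff₀ hpi] at h2
    rw [div_lt_iff₀ hpi] at h3
    rw [Real.norm_eq_abs, abs_le, h1]
    constructor <;> simp only [m] <;> nlinarith
  rw [hgx]
  refine hC y ?_
  rw [mem_closedBall_zero_iff, EuclideanSpace.norm_eq, Fin.sum_univ_two]
  refine Real.sqrt_le_iff.2 ⟨by positivity, ?_⟩
  have h0 := hyi 0
  have h1 := hyi 1
  nlinarith [norm_nonneg (y 0), norm_nonneg (y 1)]

section Test

variable {F : Type*} [NormedAddCommGroup F] [NormedSpace ℝ F]

theorem IsTest.fderiv {φ : Plane → F} (hφ : IsTest φ) : IsTest (fderiv ℝ φ) := by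
  refine ⟨(contDiff_infty_iff_fderiv.1 hφ.smooth).2, fun i x => ?_⟩
  rw [← fderiv_comp_add_right]
  congr 1
  funext y
  exact hφ.periodic i y

theorem IsTest.exists_lipschitzWith {φ : Plane → F} (hφ : IsTest φ) :
    ∃ L : NNReal, LipschitzWith L φ := by
  obtain ⟨C, hC⟩ := hφ.fderiv.periodic.exists_norm_le hφ.fderiv.smooth.continuous
  refine ⟨C.toNNReal, lipschitzWith_of_nnnorm_fderiv_le (hφ.smooth.differentiable (by simp))
    fun x => ?_⟩
  rw [← NNReal.coe_le_coe, coe_nnnorm]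
  exact (hC x).trans (Real.le_coe_toNNReal C)

theorem IsTest.comp_clm {F' : Type*} [NormedAddCommGroup F'] [NormedSpace ℝ F'] {φ : Plane → F}
    (hφ : IsTest φ) (A : F →L[ℝ] F') : IsTest fun x => A (φ x) :=
  ⟨A.contDiff.comp hφ.smooth, fun i x => congrArg A (hφ.periodic i x)⟩

theorem IsTest.coord {φ : Plane → Plane} (hφ : IsTest φ) (j : Fin 2) : IsTest fun x => φ x j :=
  hφ.comp_clm (EuclideanSpace.proj j : Plane →L[ℝ] ℝ)

end Test

/-- The nonlocal gradient of a test function is Lipschitz, because the differences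
`x ↦ φ(x + s) - φ(x)` are Lipschitz with a constant proportional to `|s|`. -/
theorem IsTest.exists_lipschitzWith_grad (hw : IsKernel w) (hδ : 0 < δ) {φ : Plane → ℝ}
    (hφ : IsTest φ) : ∃ L : NNReal, LipschitzWith L (NonlocalStokes.grad w δ n φ) := by
  obtain ⟨L₁, hL₁⟩ := hφ.exists_lipschitzWith
  obtain ⟨L₂, hL₂⟩ := hφ.fderiv.exists_lipschitzWith
  have hdiff : Differentiable ℝ φ := hφ.smooth.differentiable (by simp)
  have hs : ∀ s x y : Plane, ‖(φ (x + s) - φ x) - (φ (y + s) - φ y)‖ ≤ L₂ * ‖s‖ * ‖x - y‖ := by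
    intro s x y
    have h1 : LipschitzWith (L₂ * ‖s‖₊) fun z => φ (z + s) - φ z := by
      refine lipschitzWith_of_nnnorm_fderiv_le (𝕜 := ℝ) (by fun_prop) fun z => ?_
      rw [fderiv_fun_sub (by fun_prop) (by fun_prop), fderiv_comp_add_right, ← NNReal.coe_le_coe]
      have := hL₂.dist_le_mul (z + s) z
      rw [dist_eq_norm, dist_eq_norm, add_sub_cancel_left] at this
      simpa using this
    have := h1.dist_le_mul x y
    rw [dist_eq_norm, dist_eq_norm] at this
    simpa using this
  set I := ∫ s : Plane, kern w δ n s * ‖s‖ ^ 2 with hI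
  have hI0 : 0 ≤ I := integral_nonneg fun s => mul_nonneg (kern_nonneg hw hδ s) (sq_nonneg _)
  refine ⟨(2 * (L₂ * I)).toNNReal, LipschitzWith.of_dist_le_mul fun x y => ?_⟩
  rw [dist_eq_norm, dist_eq_norm, Real.coe_toNNReal _ (by positivity), grad_eq, grad_eq,
    ← smul_sub, ← integral_sub (integrable_grad hw hδ hL₁ x) (integrable_grad hw hδ hL₁ y),
    norm_smul, Real.norm_of_nonneg zero_le_two, mul_assoc 2]
  refine mul_le_mul_of_nonneg_left ?_ zero_le_two
  have h2 : (L₂ : ℝ) * I * ‖x - y‖ = ∫ s : Plane, (L₂ * ‖x - y‖) * (kern w δ n s * ‖s‖ ^ 2) := by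
    rw [integral_const_mul, hI]; ring
  rw [h2]
  refine norm_integral_le_of_norm_le ((integrable_kern hw hδ).const_mul _)
    (Filter.Eventually.of_forall fun s => ?_)
  rw [← smul_sub, ← sub_smul, norm_smul, norm_smul, Real.norm_of_nonneg (kern_nonneg hw hδ s)]
  have := mul_le_mul_of_nonneg_left
    (mul_le_mul_of_nonneg_right (hs s x y) (norm_nonneg s)) (kern_nonneg (n := n) hw hδ s)
  linarith

/-- Nonlocal integration by parts: `∫_Ω (div v) ψ = -∫_Ω v · grad ψ`. After an exchange of the
integrals over `x` and `s` the shift is moved from `v` to `ψ` by periodicity. -/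
theorem setIntegral_div_mul (hw : IsKernel w) (hδ : 0 < δ) {v : Plane → Plane} {ψ : Plane → ℝ}
    {L₁ L₂ : NNReal} (hv : LipschitzWith L₁ v) (hvp : IsPeriodic v) (hψ : LipschitzWith L₂ ψ)
    (hψp : IsPeriodic ψ) :
    ∫ x in cell, div w δ n v x * ψ x = -∫ x in cell, inner ℝ (v x) (grad w δ n ψ x) := by
  have hvc := hv.continuous
  have hψc := hψ.continuous
  obtain ⟨Cv, hCv⟩ := hvp.exists_norm_le hvc
  obtain ⟨Cψ, hCψ⟩ := hψp.exists_norm_le hψc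
  have hk : AEStronglyMeasurable (fun p : Plane × Plane => kern w δ n p.2)
      ((volume.restrict cell).prod volume) := (aestronglyMeasurable_kern hw hδ).comp_snd
  have hA : Integrable (fun p : Plane × Plane =>
      kern w δ n p.2 * (inner ℝ p.2 (v p.1 - v (p.1 - p.2)) * ψ p.1))
      ((volume.restrict cell).prod volume) := by
    refine (((integrable_kern (n := n) hw hδ).const_mul (L₁ * Cψ)).comp_snd
      (volume.restrict cell)).mono' (hk.mul (Continuous.aestronglyMeasurable (by fun_prop)))
      (Filter.Eventually.of_forall fun p => ?_)
    rw [norm_mul, norm_mul, Real.norm_of_nonneg (kern_nonneg hw hδ _)]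
    have h1 := mul_le_mul (norm_inner_sub_le hv p.1 p.2) (hCψ p.1) (norm_nonneg _)
      (by positivity)
    have := mul_le_mul_of_nonneg_left h1 (kern_nonneg (n := n) hw hδ p.2)
    linarith
  have hB : Integrable (fun p : Plane × Plane =>
      kern w δ n p.2 * ((ψ (p.1 + p.2) - ψ p.1) * inner ℝ (v p.1) p.2))
      ((volume.restrict cell).prod volume) := by
    refine (((integrable_kern (n := n) hw hδ).const_mul (L₂ * Cv)).comp_snd
      (volume.restrict cell)).mono' (hk.mul (Continuous.aestronglyMeasurable (by fun_prop)))
      (Filter.Eventually.of_forall fun p => ?_)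
    rw [norm_mul, norm_mul, Real.norm_of_nonneg (kern_nonneg hw hδ _)]
    have h2 := hψ.dist_le_mul (p.1 + p.2) p.1
    rw [dist_eq_norm, dist_eq_norm, add_sub_cancel_left] at h2
    have h3 : ‖(inner ℝ (v p.1) p.2 : ℝ)‖ ≤ Cv * ‖p.2‖ :=
      (norm_inner_le_norm _ _).trans (mul_le_mul_of_nonneg_right (hCv _) (norm_nonneg _))
    have h1 := mul_le_mul h2 h3 (norm_nonneg _) (by positivity)
    have := mul_le_mul_of_nonneg_left h1 (kern_nonneg (n := n) hw hδ p.2)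
    linarith
  have e1 : ∀ x, div w δ n v x * ψ x =
      2 * ∫ s : Plane, kern w δ n s * (inner ℝ s (v x - v (x - s)) * ψ x) := by
    intro x
    rw [div_eq, mul_assoc, ← integral_mul_const]
    simp only [smul_eq_mul, mul_assoc]
  have e2 : ∀ x, inner ℝ (v x) (grad w δ n ψ x) =
      2 * ∫ s : Plane, kern w δ n s * ((ψ (x + s) - ψ x) * inner ℝ (v x) s) := by
    intro x
    rw [grad_eq, real_inner_smul_right, ← integral_inner (integrable_grad hw hδ hψ x)]
    simp only [real_inner_smul_right]
  simp only [e1, e2]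
  have sA := integral_integral_swap (f := fun x s =>
    kern w δ n s * (inner ℝ s (v x - v (x - s)) * ψ x)) hA
  have sB := integral_integral_swap (f := fun x s =>
    kern w δ n s * ((ψ (x + s) - ψ x) * inner ℝ (v x) s)) hB
  rw [integral_const_mul, integral_const_mul, sA, sB, ← mul_neg, ← integral_neg]
  congr 2
  funext s
  rw [integral_const_mul, integral_const_mul, ← mul_neg]
  congr 1
  -- the translation by `s` is moved from `v` to `ψ`
  have hint : ∀ {g : Plane → ℝ}, Continuous g → IntegrableOn g cell := fun hg =>
    (memLp_cell hg).integrable (by norm_num)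
  have hshift := setIntegral_cell_add (g := fun x => inner ℝ s (v (x - s)) * ψ x)
    (by fun_prop) (fun i x => by
      simp only [hψp i x]
      rw [add_sub_right_comm, hvp i]) s
  simp only [add_sub_cancel_right] at hshift
  have e3 : ∀ x, inner ℝ s (v x - v (x - s)) * ψ x =
      inner ℝ s (v x) * ψ x - inner ℝ s (v (x - s)) * ψ x := fun x => by
    rw [inner_sub_right, sub_mul]
  have e4 : ∀ x, (ψ (x + s) - ψ x) * inner ℝ (v x) s =
      inner ℝ s (v x) * ψ (x + s) - inner ℝ s (v x) * ψ x := fun x => by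
    rw [real_inner_comm]; ring
  simp only [e3, e4]
  rw [integral_sub (hint (by fun_prop)) (hint (by fun_prop)),
    integral_sub (hint (by fun_prop)) (hint (by fun_prop)), hshift]
  ring

/-! ### Trigonometric modes -/

/-- The real function `Re (z e^{iξ·x})`. -/
def smode (z : ℂ) (ξ : Fin 2 → ℤ) (x : Plane) : ℝ := (z * expI ξ x).re

/-- The real vector field `Re (a e^{iξ·x})`. -/
def vmode (a : EuclideanSpace ℂ (Fin 2)) (ξ : Fin 2 → ℤ) (x : Plane) : Plane :=
  WithLp.toLp 2 fun j => smode (a j) ξ x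

theorem vmode_apply (a : EuclideanSpace ℂ (Fin 2)) (ξ : Fin 2 → ℤ) (x : Plane) (j : Fin 2) :
    vmode a ξ x j = smode (a j) ξ x := rfl

theorem isTest_smode (z : ℂ) (ξ : Fin 2 → ℤ) : IsTest (smode z ξ) := by
  constructor
  · have h1 : ContDiff ℝ ∞ (freqDot ξ) := by unfold freqDot; fun_prop
    have h2 : ContDiff ℝ ∞ fun x => z * expI ξ x := by
      unfold expI
      exact contDiff_const.mul ((contDiff_const.mul
        (Complex.ofRealCLM.contDiff.comp h1)).cexp)
    exact Complex.reCLM.contDiff.comp h2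
  · intro i x
    have h : expI ξ (EuclideanSpace.single i (2 * Real.pi)) = 1 := by
      rw [expI, Complex.exp_eq_one_iff]
      refine ⟨ξ i, ?_⟩
      simp only [freqDot, PiLp.single_apply, mul_ite, mul_zero, Finset.sum_ite_eq',
        Finset.mem_univ, if_true]
      push_cast; ring
    rw [smode, expI_add, h, mul_one, smode]

theorem isTest_vmode (a : EuclideanSpace ℂ (Fin 2)) (ξ : Fin 2 → ℤ) : IsTest (vmode a ξ) := by
  constructor
  · rw [contDiff_euclidean]
    exact fun j => (isTest_smode (a j) ξ).smooth
  · intro i x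
    ext j
    exact (isTest_smode (a j) ξ).periodic i x

theorem grad_smode (hw : IsKernel w) (hδ : 0 < δ) (z : ℂ) (ξ : Fin 2 → ℤ) :
    grad w δ n (smode z ξ) = vmode (z • symbol w δ n ξ) ξ := by
  funext x
  obtain ⟨L, hL⟩ := (isTest_smode z ξ).exists_lipschitzWith
  ext j
  have h1 : (∫ s : Plane, kern w δ n s • ((smode z ξ (x + s) - smode z ξ x) • s)) j =
      ∫ s : Plane, (kern w δ n s • ((smode z ξ (x + s) - smode z ξ x) • s)) j :=
    ((EuclideanSpace.proj j : Plane →L[ℝ] ℝ).integral_comp_comm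
      (integrable_grad hw hδ hL x)).symm
  have h2 := (integrable_symbol (n := n) hw hδ ξ j).const_mul (z * expI ξ x)
  have h3 : ∀ s : Plane, (kern w δ n s • ((smode z ξ (x + s) - smode z ξ x) • s)) j =
      RCLike.re (z * expI ξ x * (kern w δ n s • ((s j : ℂ) * (expI ξ s - 1)))) := by
    intro s
    simp only [PiLp.smul_apply, smul_eq_mul, smode, expI_add, RCLike.re_to_complex,
      Complex.real_smul]
    rw [← Complex.sub_re, show z * expI ξ x * ((kern w δ n s : ℂ) * ((s j : ℂ) * (expI ξ s - 1))) =
      ((kern w δ n s * s j : ℝ) : ℂ) * (z * (expI ξ x * expI ξ s) - z * expI ξ x) by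
        push_cast; ring, Complex.re_ofReal_mul]
    ring
  rw [grad_eq, PiLp.smul_apply, h1]
  simp only [h3]
  rw [integral_re h2, integral_const_mul, vmode_apply, smode, PiLp.smul_apply, symbol_apply,
    smul_eq_mul, smul_eq_mul, RCLike.re_to_complex,
    show z * (2 * ∫ s : Plane, kern w δ n s • ((s j : ℂ) * (expI ξ s - 1))) * expI ξ x =
      ((2 : ℝ) : ℂ) * (z * expI ξ x * ∫ s : Plane, kern w δ n s • ((s j : ℂ) * (expI ξ s - 1))) by
        push_cast; ring, Complex.re_ofReal_mul]

theorem div_vmode (hw : IsKernel w) (hδ : 0 < δ) (a : EuclideanSpace ℂ (Fin 2))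
    (ξ : Fin 2 → ℤ) :
    div w δ n (vmode a ξ) = smode (-inner ℂ (symbol w δ n ξ) a) ξ := by
  funext x
  have h2 : ∀ j, Integrable fun s : Plane => a j * expI ξ x *
      (starRingEnd ℂ) (kern w δ n s • ((s j : ℂ) * (expI ξ s - 1))) := fun j =>
    ((Complex.conjCLE.toContinuousLinearMap.integrable_comp
      (integrable_symbol (n := n) hw hδ ξ j))).const_mul _
  have h3 : ∀ s : Plane, kern w δ n s • (inner ℝ s (vmode a ξ x - vmode a ξ (x - s)) : ℝ) =
      RCLike.re (-∑ j, a j * expI ξ x *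
        (starRingEnd ℂ) (kern w δ n s • ((s j : ℂ) * (expI ξ s - 1)))) := by
    intro s
    simp only [PiLp.inner_apply, PiLp.sub_apply, vmode_apply, smode, sub_eq_add_neg x s, expI_add,
      expI_neg_right, RCLike.inner_apply, conj_trivial, Fin.sum_univ_two, Complex.real_smul,
      map_mul, map_sub, map_one, Complex.conj_ofReal, RCLike.re_to_complex, smul_eq_mul]
    simp only [Complex.neg_re, Complex.add_re, Complex.mul_re, Complex.sub_re, Complex.sub_im,
      Complex.mul_im, Complex.ofReal_re, Complex.ofReal_im, Complex.one_re, Complex.one_im,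
      Complex.conj_re, Complex.conj_im]
    ring
  have h4 : Integrable fun s : Plane => -∑ j, a j * expI ξ x *
      (starRingEnd ℂ) (kern w δ n s • ((s j : ℂ) * (expI ξ s - 1))) :=
    (integrable_finsetSum _ fun j _ => h2 j).neg
  rw [div_eq]
  simp only [h3]
  rw [integral_re h4, integral_neg, integral_finsetSum _ fun j _ => h2 j, smode,
    RCLike.re_to_complex, ← Complex.re_ofReal_mul]
  congr 1
  simp only [integral_const_mul, integral_conj, PiLp.inner_apply, symbol_apply,
    RCLike.inner_apply, map_mul, Fin.sum_univ_two, map_ofNat]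
  push_cast
  ring

theorem lap_smode (hw : IsKernel w) (hδ : 0 < δ) (z : ℂ) (ξ : Fin 2 → ℤ) :
    lap w δ n (smode z ξ) = fun x => -‖symbol w δ n ξ‖ ^ 2 * smode z ξ x := by
  rw [lap, grad_smode hw hδ, div_vmode hw hδ]
  funext x
  rw [inner_smul_right, inner_self_eq_norm_sq_to_K, smode, smode, ← Complex.re_ofReal_mul]
  congr 1
  push_cast
  simp only [Complex.coe_algebraMap]
  ring

theorem vlap_vmode (hw : IsKernel w) (hδ : 0 < δ) (a : EuclideanSpace ℂ (Fin 2))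
    (ξ : Fin 2 → ℤ) (x : Plane) :
    vlap w δ n (vmode a ξ) x = (-‖symbol w δ n ξ‖ ^ 2) • vmode a ξ x := by
  ext j
  exact congrFun (lap_smode hw hδ (a j) ξ) x

end Operators

/-! ### Fourier coefficients of the modes -/

theorem scalarCoeff_neg (g : Plane → ℝ) (ξ : Fin 2 → ℤ) :
    scalarCoeff g (-ξ) = (starRingEnd ℂ) (scalarCoeff g ξ) := by
  simp only [scalarCoeff, map_mul, ← integral_conj, ← conj_expI, expI_neg_left, Complex.conj_conj,
    Complex.conj_ofReal, map_div₀, map_pow, map_one, map_ofNat]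

/-- The pairing of a function with a mode. -/
theorem setIntegral_mul_smode {g : Plane → ℝ} (hg : IntegrableOn g cell) (z : ℂ)
    (ξ : Fin 2 → ℤ) : ∫ x in cell, g x * smode z ξ x =
      (2 * Real.pi) ^ 2 * (z * (starRingEnd ℂ) (scalarCoeff g ξ)).re := by
  have h1 : Integrable (fun x => expI ξ x * (g x : ℂ)) (volume.restrict cell) := by
    refine hg.ofReal.bdd_mul (c := 1) (continuous_expI ξ).aestronglyMeasurable
      (Filter.Eventually.of_forall fun x => (norm_expI ξ x).le)
  have h2 : ∀ x, g x * smode z ξ x = RCLike.re (z * (expI ξ x * (g x : ℂ))) := by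
    intro x
    rw [smode, ← Complex.re_ofReal_mul, RCLike.re_to_complex]
    congr 1; ring
  simp only [h2]
  rw [integral_re (h1.const_mul z), integral_const_mul, RCLike.re_to_complex]
  simp only [scalarCoeff, map_mul, ← integral_conj, ← conj_expI, Complex.conj_conj,
    Complex.conj_ofReal, map_div₀, map_pow, map_one, map_ofNat]
  rw [← Complex.re_ofReal_mul]
  congr 1
  have := Real.pi_ne_zero
  push_cast
  field_simp

theorem scalarCoeff_smode (z : ℂ) (η ξ : Fin 2 → ℤ) :
    scalarCoeff (smode z η) ξ =
      ((if η = ξ then z else 0) + if η = -ξ then (starRingEnd ℂ) z else 0) / 2 := by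
  have h1 : ∀ x, Complex.exp (-(Complex.I * (freqDot ξ x : ℂ))) * (smode z η x : ℂ) =
      (z / 2) * Complex.exp (Complex.I * (freqDot (η - ξ) x : ℂ)) +
        ((starRingEnd ℂ) z / 2) * Complex.exp (Complex.I * (freqDot (-(η + ξ)) x : ℂ)) := by
    intro x
    have e1 : Complex.exp (Complex.I * (freqDot (η - ξ) x : ℂ)) =
        expI η x * (starRingEnd ℂ) (expI ξ x) := by
      rw [conj_expI, expI, ← Complex.exp_add]
      congr 1; simp [freqDot]; ring
    have e2 : Complex.exp (Complex.I * (freqDot (-(η + ξ)) x : ℂ)) =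
        (starRingEnd ℂ) (expI η x) * (starRingEnd ℂ) (expI ξ x) := by
      rw [conj_expI, conj_expI, ← Complex.exp_add]
      congr 1; simp [freqDot]; ring
    rw [← conj_expI, e1, e2, smode, Complex.re_eq_add_conj, map_mul]
    ring
  have hint : ∀ (c : ℂ) (ζ : Fin 2 → ℤ),
      Integrable (fun x => c * Complex.exp (Complex.I * (freqDot ζ x : ℂ)))
        (volume.restrict cell) := by
    intro c ζ
    have := continuous_freqDot ζ
    exact (memLp_cell (by fun_prop)).integrable (q := 2) (by norm_num)
  rw [scalarCoeff]
  simp only [h1]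
  rw [integral_add (hint _ _) (hint _ _), integral_const_mul, integral_const_mul,
    integral_exp_freqDot, integral_exp_freqDot]
  have e3 : (η - ξ = 0) = (η = ξ) := by rw [sub_eq_zero]
  have e4 : (-(η + ξ) = 0) = (η = -ξ) := by rw [neg_eq_zero, add_eq_zero_iff_eq_neg]
  simp only [e3, e4]
  have := Real.pi_ne_zero
  split_ifs <;> push_cast <;> field_simp <;> ring

theorem fourierCoeff_neg (u : Plane → Plane) (ξ : Fin 2 → ℤ) (j : Fin 2) :
    fourierCoeff u (-ξ) j = (starRingEnd ℂ) (fourierCoeff u ξ j) :=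
  scalarCoeff_neg _ _

theorem fourierCoeff_vmode (a : EuclideanSpace ℂ (Fin 2)) (η ξ : Fin 2 → ℤ) (j : Fin 2) :
    fourierCoeff (vmode a η) ξ j =
      ((if η = ξ then a j else 0) + if η = -ξ then (starRingEnd ℂ) (a j) else 0) / 2 :=
  scalarCoeff_smode _ _ _

theorem fourierCoeff_congr {u v : Plane → Plane} (h : u =ᵐ[volume.restrict cell] v)
    (ξ : Fin 2 → ℤ) : fourierCoeff u ξ = fourierCoeff v ξ := by
  ext j
  simp only [fourierCoeff]
  congr 1
  refine integral_congr_ae ?_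
  filter_upwards [h] with x hx
  rw [hx]

theorem scalarCoeff_congr {u v : Plane → ℝ} (h : u =ᵐ[volume.restrict cell] v)
    (ξ : Fin 2 → ℤ) : scalarCoeff u ξ = scalarCoeff v ξ := by
  simp only [scalarCoeff]
  congr 1
  refine integral_congr_ae ?_
  filter_upwards [h] with x hx
  rw [hx]

theorem integrable_coord (u : L2 Plane) (j : Fin 2) : IntegrableOn (fun x => u x j) cell :=
  (EuclideanSpace.proj j : Plane →L[ℝ] ℝ).integrable_comp u.integrable

theorem setIntegral_inner_vmode (u : L2 Plane) (a : EuclideanSpace ℂ (Fin 2)) (ξ : Fin 2 → ℤ) :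
    ∫ x in cell, inner ℝ (u x) (vmode a ξ x) =
      (2 * Real.pi) ^ 2 * (inner ℂ (fourierCoeff u ξ) a).re := by
  have hint : ∀ j, IntegrableOn (fun x => u x j * smode (a j) ξ x) cell := by
    intro j
    obtain ⟨C, hC⟩ := (isTest_smode (a j) ξ).periodic.exists_norm_le
      (isTest_smode (a j) ξ).smooth.continuous
    exact (integrable_coord u j).mul_bdd (c := C)
      (isTest_smode (a j) ξ).smooth.continuous.aestronglyMeasurable
      (Filter.Eventually.of_forall hC)
  have h1 : ∀ x, inner ℝ (u x) (vmode a ξ x) = ∑ j, u x j * smode (a j) ξ x := by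
    intro x
    simp only [PiLp.inner_apply, vmode_apply, RCLike.inner_apply, conj_trivial, mul_comm]
  simp only [h1]
  rw [integral_finsetSum _ fun j _ => hint j]
  simp only [setIntegral_mul_smode (integrable_coord u _), PiLp.inner_apply, RCLike.inner_apply,
    fourierCoeff_apply, Fin.sum_univ_two, Complex.add_re]
  ring

/-! ### Modes in `L²` -/

/-- The nonzero frequencies. -/
abbrev Freq : Type := {ξ : Fin 2 → ℤ // ξ ≠ 0}

instance : Neg Freq := ⟨fun ξ => ⟨-ξ.1, neg_ne_zero.2 ξ.2⟩⟩

instance : InvolutiveNeg Freq := ⟨fun ξ => Subtype.ext (neg_neg ξ.1)⟩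

/-- The square integrable function given by a continuous function. -/
def toL2 {F : Type} [NormedAddCommGroup F] (g : Plane → F) (hg : Continuous g) : L2 F :=
  (memLp_cell hg).toLp g

theorem coeFn_toL2 {F : Type} [NormedAddCommGroup F] {g : Plane → F} (hg : Continuous g) :
    toL2 g hg =ᵐ[volume.restrict cell] g :=
  MemLp.coeFn_toLp _

theorem inner_toL2 {F : Type} [NormedAddCommGroup F] [InnerProductSpace ℝ F] (u : L2 F)
    {g : Plane → F} (hg : Continuous g) :
    inner ℝ u (toL2 g hg) = ∫ x in cell, inner ℝ (u x) (g x) := by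
  rw [MeasureTheory.L2.inner_def]
  refine integral_congr_ae ?_
  filter_upwards [coeFn_toL2 hg] with x hx
  rw [hx]

theorem isClosed_L2Zero (F : Type) [NormedAddCommGroup F] [InnerProductSpace ℝ F]
    [CompleteSpace F] : IsClosed (L2Zero F : Set (L2 F)) := by
  have h : (L2Zero F : Set (L2 F)) =
      ⋂ c : F, {u | inner ℝ u (toL2 (fun _ => c) continuous_const) = 0} := by
    ext u
    simp only [mem_iInter, mem_ofPred_eq, inner_toL2]
    have h1 : ∀ c : F, ∫ x in cell, inner ℝ (u x) c = inner ℝ (∫ x in cell, u x) c := by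
      intro c
      rw [real_inner_comm, ← integral_inner u.integrable]
      simp only [real_inner_comm]
    simp only [h1]
    constructor
    · intro hu c
      rw [show ∫ x in cell, u x = 0 from hu, inner_zero_left]
    · intro hu
      exact inner_self_eq_zero.1 (hu (∫ x in cell, u x))
  rw [h]
  exact isClosed_iInter fun c => isClosed_eq (by fun_prop) continuous_const

instance (F : Type) [NormedAddCommGroup F] [InnerProductSpace ℝ F] [CompleteSpace F] :
    CompleteSpace (L2Zero F) :=
  (isClosed_L2Zero F).completeSpace_coe

theorem setIntegral_smode (z : ℂ) (ξ : Freq) : ∫ x in cell, smode z ξ x = 0 := by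
  have h := setIntegral_mul_smode (g := fun _ => (1 : ℝ))
    ((memLp_cell continuous_const).integrable (q := 2) (by norm_num)) z ξ
  have h1 : scalarCoeff (fun _ => (1 : ℝ)) ξ = 0 := by
    have e : (fun _ : Plane => (1 : ℝ)) = smode 1 0 := by
      funext x; simp [smode, expI, freqDot]
    rw [e, scalarCoeff_smode, if_neg (Ne.symm ξ.2),
      if_neg (Ne.symm (neg_ne_zero.2 ξ.2))]
    simp
  simpa [h1] using h

/-- The mode `Re (z e^{iξ·x})` as an element of `L²`. -/
def smodeL (z : ℂ) (ξ : Freq) : L2Zero ℝ :=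
  ⟨toL2 (smode z ξ) (isTest_smode z ξ).smooth.continuous, by
    change ∫ x in cell, _ = (0 : ℝ)
    rw [integral_congr_ae (coeFn_toL2 _), setIntegral_smode]⟩

/-- The vector mode `Re (a e^{iξ·x})` as an element of `L²`. -/
def vmodeL (a : EuclideanSpace ℂ (Fin 2)) (ξ : Freq) : L2Zero Plane :=
  ⟨toL2 (vmode a ξ) (isTest_vmode a ξ).smooth.continuous, by
    change ∫ x in cell, _ = (0 : Plane)
    have hc := (isTest_vmode a ξ).smooth.continuous
    rw [integral_congr_ae (coeFn_toL2 hc)]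
    ext j
    have h1 := (EuclideanSpace.proj j : Plane →L[ℝ] ℝ).integral_comp_comm
      ((memLp_cell hc).integrable (by norm_num))
    have h2 := setIntegral_smode (a j) ξ
    exact h1.symm.trans h2⟩

theorem coeFn_smodeL (z : ℂ) (ξ : Freq) :
    ((smodeL z ξ : L2 ℝ) : Plane → ℝ) =ᵐ[volume.restrict cell] smode z ξ :=
  coeFn_toL2 (isTest_smode z ξ).smooth.continuous

theorem coeFn_vmodeL (a : EuclideanSpace ℂ (Fin 2)) (ξ : Freq) :
    ((vmodeL a ξ : L2 Plane) : Plane → Plane) =ᵐ[volume.restrict cell] vmode a ξ :=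
  coeFn_toL2 (isTest_vmode a ξ).smooth.continuous

theorem inner_vmodeL (a : EuclideanSpace ℂ (Fin 2)) (ξ : Freq) (u : L2Zero Plane) :
    inner ℝ (vmodeL a ξ) u =
      (2 * Real.pi) ^ 2 * (inner ℂ (fourierCoeff (u : L2 Plane) ξ) a).re := by
  rw [real_inner_comm, ← setIntegral_inner_vmode]
  exact inner_toL2 (u : L2 Plane) (isTest_vmode a ξ).smooth.continuous

theorem inner_smodeL (z : ℂ) (ξ : Freq) (p : L2Zero ℝ) :
    inner ℝ (smodeL z ξ) p =
      (2 * Real.pi) ^ 2 * (z * (starRingEnd ℂ) (scalarCoeff (p : L2 ℝ) ξ)).re := by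
  rw [real_inner_comm, ← setIntegral_mul_smode (L2.integrable _)]
  refine (inner_toL2 (p : L2 ℝ) (isTest_smode z ξ).smooth.continuous).trans ?_
  simp only [RCLike.inner_apply, conj_trivial, mul_comm]

theorem scalarCoeff_zero_L2Zero (p : L2Zero ℝ) : scalarCoeff (p : L2 ℝ) 0 = 0 := by
  have h : ∫ x in cell, (p : L2 ℝ) x = 0 := p.2
  have e : ∀ x : Plane, freqDot 0 x = 0 := fun x => by simp [freqDot]
  simp only [scalarCoeff, e, Complex.ofReal_zero, mul_zero, neg_zero, Complex.exp_zero, one_mul]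
  have h3 : ∫ x in cell, ((p : L2 ℝ) x : ℂ) = 0 := by rw [integral_complex_ofReal, h]; simp
  rw [h3, mul_zero]

theorem fourierCoeff_zero_L2Zero (u : L2Zero Plane) : fourierCoeff (u : L2 Plane) 0 = 0 := by
  have h : ∫ x in cell, (u : L2 Plane) x = 0 := u.2
  have e : ∀ x : Plane, freqDot 0 x = 0 := fun x => by simp [freqDot]
  ext j
  have h1 := (EuclideanSpace.proj j : Plane →L[ℝ] ℝ).integral_comp_comm
    (L2.integrable (u : L2 Plane))
  rw [h, map_zero] at h1
  have h2 : ∫ x in cell, (u : L2 Plane) x j = 0 := h1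
  simp only [fourierCoeff, e, Complex.ofReal_zero, mul_zero, neg_zero, Complex.exp_zero, one_mul]
  have h3 : ∫ x in cell, ((u : L2 Plane) x j : ℂ) = 0 := by
    rw [integral_complex_ofReal, h2]; simp
  rw [h3, mul_zero]
  rfl

/-! ### Real orthonormal bases -/

/-- The normalizing constant `(1 - i) / 2π`: the functions `Re (c e^{iξ·x})` for it are
`(cos ξ·x + sin ξ·x) / 2π`, which are orthonormal when `ξ` runs over *all* frequencies. -/
def casConst : ℂ := (1 - Complex.I) / (2 * Real.pi)

theorem casConst_mul_conj :
    casConst * (starRingEnd ℂ) casConst = (2 / (2 * Real.pi) ^ 2 : ℝ) := by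
  simp only [casConst, map_div₀, map_sub, map_one, Complex.conj_I, map_mul, map_ofNat,
    Complex.conj_ofReal]
  have := Real.pi_ne_zero
  push_cast
  field_simp
  ring_nf
  simp
  norm_num

theorem casConst_mul_self_re : (casConst * casConst).re = 0 := by
  have h : casConst * casConst = ((2 / (2 * Real.pi) ^ 2 : ℝ) : ℂ) * (-Complex.I) := by
    simp only [casConst]
    have := Real.pi_ne_zero
    push_cast
    field_simp
    ring_nf
    simp only [Complex.I_sq]
    ring
  rw [h, Complex.re_ofReal_mul]
  simp

theorem orthonormal_smodeL : Orthonormal ℝ fun ξ : Freq => smodeL casConst ξ := by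
  classical
  rw [orthonormal_iff_ite]
  intro ξ η
  rw [inner_smodeL, scalarCoeff_congr (coeFn_smodeL _ _), scalarCoeff_smode]
  have hpi := Real.pi_ne_zero
  have hne : ¬ ((ξ : Fin 2 → ℤ) = -ξ) := fun h => ξ.2 (self_eq_neg.1 h)
  by_cases h : ξ = η
  · subst h
    rw [if_pos rfl, if_pos rfl, if_neg hne, add_zero, map_div₀, mul_div_assoc', casConst_mul_conj]
    rw [map_ofNat, ← Complex.ofReal_ofNat, ← Complex.ofReal_div, Complex.ofReal_re]
    field_simp
  · have h1 : ¬ ((η : Fin 2 → ℤ) = ξ) := fun h' => h (Subtype.ext h'.symm)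
    rw [if_neg h, if_neg h1, zero_add]
    split_ifs with h2
    · rw [map_div₀, Complex.conj_conj, mul_div_assoc', map_ofNat, ← Complex.ofReal_ofNat,
        Complex.div_ofReal_re, casConst_mul_self_re]
      simp
    · simp

/-- A complex number is determined by its pairings with a mode and its reflection. -/
theorem casConst_sq_add (z : ℂ) :
    (casConst * z).re ^ 2 + (casConst * (starRingEnd ℂ) z).re ^ 2 =
      2 / (2 * Real.pi) ^ 2 * ‖z‖ ^ 2 := by
  have h : casConst = ((1 / (2 * Real.pi) : ℝ) : ℂ) * (1 - Complex.I) := by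
    rw [casConst]; push_cast; ring
  rw [h, mul_assoc, mul_assoc, Complex.re_ofReal_mul, Complex.re_ofReal_mul, Complex.sq_norm,
    Complex.normSq_apply]
  simp only [Complex.mul_re, Complex.sub_re, Complex.sub_im, Complex.one_re, Complex.one_im,
    Complex.I_re, Complex.I_im, Complex.conj_re, Complex.conj_im]
  have := Real.pi_ne_zero
  field_simp
  ring

theorem eq_zero_of_casConst {z : ℂ} (h1 : (casConst * z).re = 0)
    (h2 : (casConst * (starRingEnd ℂ) z).re = 0) : z = 0 := by
  have h := casConst_sq_add z
  rw [h1, h2] at h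
  have hpos : 0 < 2 / (2 * Real.pi) ^ 2 := by positivity
  have h3 : ‖z‖ ^ 2 = 0 := by
    have := mul_eq_zero.1 (h.symm.trans (by norm_num))
    exact this.resolve_left hpos.ne'
  simpa using h3

/-- The Hilbert basis `(cos ξ·x + sin ξ·x) / 2π` of the scalar functions of zero mean. -/
def sbasis : HilbertBasis Freq ℝ (L2Zero ℝ) :=
  HilbertBasis.mkOfOrthogonalEqBot orthonormal_smodeL (by
    rw [Submodule.eq_bot_iff]
    intro p hp
    have h : ∀ ξ, inner ℝ (smodeL casConst ξ) p = 0 := fun ξ =>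
      (Submodule.mem_orthogonal _ _).1 hp _ (Submodule.subset_span ⟨ξ, rfl⟩)
    have hpi : ((2 * Real.pi) ^ 2 : ℝ) ≠ 0 := by positivity
    have h1 : ∀ ξ, scalarCoeff (p : L2 ℝ) ξ = 0 := by
      intro ξ
      by_cases hξ : ξ = 0
      · rw [hξ, scalarCoeff_zero_L2Zero]
      · have h2 := h ⟨ξ, hξ⟩
        have h3 := h (-⟨ξ, hξ⟩)
        rw [inner_smodeL, mul_eq_zero] at h2 h3
        have h4 := h2.resolve_left hpi
        have h5 : (casConst * (starRingEnd ℂ) (scalarCoeff (p : L2 ℝ) (-ξ))).re = 0 :=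
          h3.resolve_left hpi
        rw [scalarCoeff_neg] at h5
        simpa using eq_zero_of_casConst h4 h5
    have h2 := ae_eq_zero_of_scalarCoeff_eq_zero (Lp.memLp (p : L2 ℝ)) h1
    exact Subtype.ext ((Lp.eq_zero_iff_ae_eq_zero).2 h2))

theorem sbasis_apply (ξ : Freq) : sbasis ξ = smodeL casConst ξ :=
  congrFun (HilbertBasis.coe_mkOfOrthogonalEqBot _ _) ξ

section VectorBasis

variable {w : ℝ → ℝ} {δ : ℝ} {n : Plane}

/-- The unit vector `λ(ξ) / |λ(ξ)|` (for `true`) and the unit vector orthogonal to it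
(for `false`): the polarizations of the gradient and of the divergence-free fields. -/
def dir (w : ℝ → ℝ) (δ : ℝ) (n : Plane) (i : Bool) (ξ : Fin 2 → ℤ) : EuclideanSpace ℂ (Fin 2) :=
  ((‖symbol w δ n ξ‖⁻¹ : ℝ) : ℂ) • if i then symbol w δ n ξ else
    WithLp.toLp 2 ![-(starRingEnd ℂ) (symbol w δ n ξ 1), (starRingEnd ℂ) (symbol w δ n ξ 0)]

theorem dir_neg (i : Bool) (ξ : Fin 2 → ℤ) (j : Fin 2) :
    dir w δ n i (-ξ) j = (starRingEnd ℂ) (dir w δ n i ξ j) := by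
  cases i <;> fin_cases j <;> simp [dir, symbol_neg, norm_symbol_neg]

theorem norm_sq_symbol (ξ : Fin 2 → ℤ) : ((‖symbol w δ n ξ‖ : ℝ) : ℂ) ^ 2 =
    symbol w δ n ξ 0 * (starRingEnd ℂ) (symbol w δ n ξ 0) +
      symbol w δ n ξ 1 * (starRingEnd ℂ) (symbol w δ n ξ 1) := by
  rw [← Complex.ofReal_pow, EuclideanSpace.norm_sq_eq, Fin.sum_univ_two, Complex.mul_conj,
    Complex.mul_conj, Complex.normSq_eq_norm_sq, Complex.normSq_eq_norm_sq]
  push_cast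
  ring

theorem inner_symbol_dir {ξ : Fin 2 → ℤ} (hξ : symbol w δ n ξ ≠ 0) (i : Bool) :
    inner ℂ (symbol w δ n ξ) (dir w δ n i ξ) = if i then ((‖symbol w δ n ξ‖ : ℝ) : ℂ) else 0 := by
  have h0 : ((‖symbol w δ n ξ‖ : ℝ) : ℂ) ≠ 0 := by
    simpa using hξ
  have h1 := norm_sq_symbol (w := w) (δ := δ) (n := n) ξ
  cases i
  · simp only [dir, inner_smul_right, PiLp.inner_apply, RCLike.inner_apply, Fin.sum_univ_two]
    simp
    right
    ring
  · simp only [dir, inner_smul_right, PiLp.inner_apply, RCLike.inner_apply, Fin.sum_univ_two,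
      if_true]
    rw [← h1]
    push_cast
    field_simp

theorem inner_dir {ξ : Fin 2 → ℤ} (hξ : symbol w δ n ξ ≠ 0) (i j : Bool) :
    inner ℂ (dir w δ n i ξ) (dir w δ n j ξ) = if i = j then 1 else 0 := by
  have h0 : ((‖symbol w δ n ξ‖ : ℝ) : ℂ) ≠ 0 := by
    simpa using hξ
  have h1 := norm_sq_symbol (w := w) (δ := δ) (n := n) ξ
  cases i
  · cases j
    · simp only [dir, inner_smul_right, inner_smul_left, PiLp.inner_apply, RCLike.inner_apply,
        Fin.sum_univ_two, Complex.conj_ofReal]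
      simp
      field_simp
      rw [h1]
      ring
    · rw [← inner_conj_symm]
      simp only [dir, inner_smul_right, inner_smul_left, PiLp.inner_apply, RCLike.inner_apply,
        Fin.sum_univ_two, Complex.conj_ofReal]
      simp
      right
      ring
  · have h2 : inner ℂ (dir w δ n true ξ) (dir w δ n j ξ) =
        ((‖symbol w δ n ξ‖⁻¹ : ℝ) : ℂ) * inner ℂ (symbol w δ n ξ) (dir w δ n j ξ) := by
      conv_lhs => rw [show dir w δ n true ξ = ((‖symbol w δ n ξ‖⁻¹ : ℝ) : ℂ) • symbol w δ n ξ by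
        simp [dir]]
      rw [inner_smul_left, Complex.conj_ofReal]
    rw [h2, inner_symbol_dir hξ]
    cases j
    · simp
    · simp only [if_true]
      push_cast
      field_simp

theorem sum_norm_sq_inner_dir {ξ : Fin 2 → ℤ} (hξ : symbol w δ n ξ ≠ 0)
    (v : EuclideanSpace ℂ (Fin 2)) :
    ‖inner ℂ v (dir w δ n true ξ)‖ ^ 2 + ‖inner ℂ v (dir w δ n false ξ)‖ ^ 2 = ‖v‖ ^ 2 := by
  have h0 : ‖symbol w δ n ξ‖ ≠ 0 := by simpa using hξ
  have h1 : ‖symbol w δ n ξ‖ ^ 2 = ‖symbol w δ n ξ 0‖ ^ 2 + ‖symbol w δ n ξ 1‖ ^ 2 := by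
    rw [EuclideanSpace.norm_sq_eq, Fin.sum_univ_two]
  have h2 : ‖v‖ ^ 2 = ‖v 0‖ ^ 2 + ‖v 1‖ ^ 2 := by
    rw [EuclideanSpace.norm_sq_eq, Fin.sum_univ_two]
  have e1 : ‖inner ℂ v (dir w δ n true ξ)‖ ^ 2 = (‖symbol w δ n ξ‖ ^ 2)⁻¹ *
      ‖symbol w δ n ξ 0 * (starRingEnd ℂ) (v 0) + symbol w δ n ξ 1 * (starRingEnd ℂ) (v 1)‖ ^ 2 := by
    simp [dir, PiLp.inner_apply, mul_pow]
  have e2 : ‖inner ℂ v (dir w δ n false ξ)‖ ^ 2 = (‖symbol w δ n ξ‖ ^ 2)⁻¹ *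
      ‖-(starRingEnd ℂ) (symbol w δ n ξ 1) * (starRingEnd ℂ) (v 0) +
        (starRingEnd ℂ) (symbol w δ n ξ 0) * (starRingEnd ℂ) (v 1)‖ ^ 2 := by
    simp [dir, PiLp.inner_apply, mul_pow]
  rw [e1, e2, h2, ← mul_add, inv_mul_eq_iff_eq_mul₀ (pow_ne_zero 2 h0), h1]
  simp only [Complex.sq_norm, Complex.normSq_apply, Complex.add_re, Complex.add_im,
    Complex.mul_re, Complex.mul_im, Complex.conj_re, Complex.conj_im, Complex.neg_re,
    Complex.neg_im]
  ring

/-- The basis fields `Re (c · dir · e^{iξ·x})`, divergence-free for the index `false` and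
nonlocal gradients for the index `true`. -/
def field (w : ℝ → ℝ) (δ : ℝ) (n : Plane) (k : Freq × Bool) : Plane → Plane :=
  vmode (casConst • dir w δ n k.2 k.1) k.1

/-- The basis fields as elements of `L²`. -/
def fieldL (w : ℝ → ℝ) (δ : ℝ) (n : Plane) (k : Freq × Bool) : L2Zero Plane :=
  vmodeL (casConst • dir w δ n k.2 k.1) k.1

theorem isTest_field (k : Freq × Bool) : IsTest (field w δ n k) := isTest_vmode _ _

theorem coeFn_fieldL (k : Freq × Bool) :
    ((fieldL w δ n k : L2 Plane) : Plane → Plane) =ᵐ[volume.restrict cell] field w δ n k :=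
  coeFn_vmodeL _ _

theorem inner_fieldL (k : Freq × Bool) (u : L2Zero Plane) :
    inner ℝ (fieldL w δ n k) u = (2 * Real.pi) ^ 2 *
      (casConst * inner ℂ (fourierCoeff (u : L2 Plane) k.1) (dir w δ n k.2 k.1)).re := by
  rw [fieldL, inner_vmodeL, inner_smul_right]

theorem inner_fieldL_neg (ξ : Freq) (i : Bool) (u : L2Zero Plane) :
    inner ℝ (fieldL w δ n (-ξ, i)) u = (2 * Real.pi) ^ 2 * (casConst * (starRingEnd ℂ)
      (inner ℂ (fourierCoeff (u : L2 Plane) ξ) (dir w δ n i ξ))).re := by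
  have h : inner ℂ (fourierCoeff (u : L2 Plane) (-ξ : Freq).1) (dir w δ n i (-ξ : Freq).1) =
      (starRingEnd ℂ) (inner ℂ (fourierCoeff (u : L2 Plane) ξ) (dir w δ n i ξ)) := by
    have e : ((-ξ : Freq) : Fin 2 → ℤ) = -ξ := rfl
    simp only [e, PiLp.inner_apply, RCLike.inner_apply, dir_neg, fourierCoeff_neg, map_sum,
      map_mul]
  rw [inner_fieldL, h]

theorem inner_fieldL_sq_add (ξ : Freq) (i : Bool) (u : L2Zero Plane) :
    inner ℝ (fieldL w δ n (ξ, i)) u ^ 2 + inner ℝ (fieldL w δ n (-ξ, i)) u ^ 2 =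
      2 * (2 * Real.pi) ^ 2 * ‖inner ℂ (fourierCoeff (u : L2 Plane) ξ) (dir w δ n i ξ)‖ ^ 2 := by
  have h := casConst_sq_add (inner ℂ (fourierCoeff (u : L2 Plane) ξ) (dir w δ n i ξ))
  rw [inner_fieldL, inner_fieldL_neg]
  have hpi := Real.pi_ne_zero
  have e : 2 * (2 * Real.pi) ^ 2 = ((2 * Real.pi) ^ 2) ^ 2 * (2 / (2 * Real.pi) ^ 2) := by
    field_simp
  rw [e, mul_assoc, ← h]
  ring

theorem orthonormal_fieldL (hs : ∀ ξ : Freq, symbol w δ n ξ ≠ 0) :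
    Orthonormal ℝ (fieldL w δ n) := by
  classical
  rw [orthonormal_iff_ite]
  rintro ⟨ξ, i⟩ ⟨η, j⟩
  have hpi := Real.pi_ne_zero
  have hne : ¬ ((ξ : Fin 2 → ℤ) = -ξ) := fun h => ξ.2 (self_eq_neg.1 h)
  rw [inner_fieldL, fourierCoeff_congr (coeFn_fieldL _), field]
  have hc := inner_dir (hs ξ) j i
  by_cases h : ξ = η
  · subst h
    have e : fourierCoeff (vmode (casConst • dir w δ n j ξ) ξ) ξ =
        (casConst / 2) • dir w δ n j ξ := by
      ext k
      rw [fourierCoeff_vmode, if_pos rfl, if_neg hne]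
      simp only [PiLp.smul_apply, smul_eq_mul]; ring
    rw [e, inner_smul_left, hc, ← mul_assoc, map_div₀, mul_div_assoc', casConst_mul_conj]
    rw [map_ofNat, ← Complex.ofReal_ofNat, ← Complex.ofReal_div, Complex.re_ofReal_mul]
    by_cases hij : i = j
    · subst hij
      simp
      field_simp
    · have hji : ¬ j = i := fun h => hij h.symm
      simp [hij, hji]
  · have h1 : ¬ ((η : Fin 2 → ℤ) = ξ) := fun h' => h (Subtype.ext h'.symm)
    rw [if_neg (fun h' => h (Prod.ext_iff.1 h').1)]
    by_cases h2 : (η : Fin 2 → ℤ) = -ξ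
    · have e : fourierCoeff (vmode (casConst • dir w δ n j η) η) ξ =
          ((starRingEnd ℂ) casConst / 2) • dir w δ n j ξ := by
        ext k
        rw [fourierCoeff_vmode, if_neg h1, if_pos h2]
        simp only [PiLp.smul_apply, smul_eq_mul, h2, dir_neg, map_mul, Complex.conj_conj]
        ring
      rw [e, inner_smul_left, hc, ← mul_assoc, map_div₀, Complex.conj_conj, mul_div_assoc',
        map_ofNat]
      have h3 : (casConst * casConst / 2 * if j = i then (1 : ℂ) else 0).re = 0 := by
        split_ifs
        · rw [mul_one, ← Complex.ofReal_ofNat, Complex.div_ofReal_re, casConst_mul_self_re,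
            zero_div]
        · simp
      rw [h3, mul_zero]
    · have e : fourierCoeff (vmode (casConst • dir w δ n j η) η) ξ = 0 := by
        ext k
        rw [fourierCoeff_vmode, if_neg h1, if_neg h2]
        simp
      rw [e, inner_zero_left]
      simp

/-- The Hilbert basis of divergence-free and gradient modes of the vector fields of zero mean. -/
def vbasis (hs : ∀ ξ : Freq, symbol w δ n ξ ≠ 0) : HilbertBasis (Freq × Bool) ℝ (L2Zero Plane) :=
  HilbertBasis.mkOfOrthogonalEqBot (orthonormal_fieldL hs) (by
    rw [Submodule.eq_bot_iff]
    intro u hu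
    have h : ∀ k, inner ℝ (fieldL w δ n k) u = 0 := fun k =>
      (Submodule.mem_orthogonal _ _).1 hu _ (Submodule.subset_span ⟨k, rfl⟩)
    have h1 : ∀ ξ, fourierCoeff (u : L2 Plane) ξ = 0 := by
      intro ξ
      by_cases hξ : ξ = 0
      · rw [hξ, fourierCoeff_zero_L2Zero]
      · have h2 : ∀ i, ‖inner ℂ (fourierCoeff (u : L2 Plane) ξ) (dir w δ n i ξ)‖ ^ 2 = 0 := by
          intro i
          have h3 := inner_fieldL_sq_add (w := w) (δ := δ) (n := n) ⟨ξ, hξ⟩ i u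
          rw [h, h] at h3
          have h4 : (0 : ℝ) < 2 * (2 * Real.pi) ^ 2 := by positivity
          exact (mul_eq_zero.1 (h3.symm.trans (by norm_num))).resolve_left h4.ne'
        have h3 := sum_norm_sq_inner_dir (hs ⟨ξ, hξ⟩) (fourierCoeff (u : L2 Plane) ξ)
        rw [h2, h2] at h3
        simpa using h3.symm
    have h2 : ∀ j, (fun x => (u : L2 Plane) x j) =ᵐ[volume.restrict cell] 0 := fun j =>
      ae_eq_zero_of_scalarCoeff_eq_zero
        ((EuclideanSpace.proj j : Plane →L[ℝ] ℝ).comp_memLp' (Lp.memLp (u : L2 Plane)))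
        fun ξ => by rw [← fourierCoeff_apply, h1]; rfl
    refine Subtype.ext ((Lp.eq_zero_iff_ae_eq_zero).2 ?_)
    filter_upwards [h2 0, h2 1] with x h3 h4
    ext j
    fin_cases j
    · exact h3
    · exact h4)

theorem vbasis_apply (hs : ∀ ξ : Freq, symbol w δ n ξ ≠ 0) (k : Freq × Bool) :
    vbasis hs k = fieldL w δ n k :=
  congrFun (HilbertBasis.coe_mkOfOrthogonalEqBot _ _) k

/-! ### The operators in the bases -/

theorem smode_ofReal_mul (r : ℝ) (z : ℂ) (ξ : Fin 2 → ℤ) (x : Plane) :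
    smode ((r : ℂ) * z) ξ x = r * smode z ξ x := by
  rw [smode, mul_assoc, Complex.re_ofReal_mul, smode]

theorem grad_sbasis (hw : IsKernel w) (hδ : 0 < δ) (ξ : Freq) (hξ : symbol w δ n ξ ≠ 0)
    (x : Plane) : grad w δ n (smode casConst ξ) x =
      ‖symbol w δ n ξ‖ • field w δ n (ξ, true) x := by
  have h0 : ((‖symbol w δ n ξ‖ : ℝ) : ℂ) ≠ 0 := by simpa using hξ
  rw [grad_smode hw hδ]
  ext j
  rw [PiLp.smul_apply, field, vmode_apply, vmode_apply, smul_eq_mul, ← smode_ofReal_mul]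
  congr 1
  simp only [dir, PiLp.smul_apply, smul_eq_mul, if_true]
  push_cast
  field_simp

theorem div_field_false (hw : IsKernel w) (hδ : 0 < δ) (ξ : Freq) (hξ : symbol w δ n ξ ≠ 0)
    (x : Plane) : div w δ n (field w δ n (ξ, false)) x = 0 := by
  rw [field, div_vmode hw hδ, inner_smul_right, inner_symbol_dir hξ]
  simp [smode]

theorem div_field_true (hw : IsKernel w) (hδ : 0 < δ) (ξ : Freq) (hξ : symbol w δ n ξ ≠ 0)
    (x : Plane) : div w δ n (field w δ n (ξ, true)) x =
      -(‖symbol w δ n ξ‖ * smode casConst ξ x) := by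
  rw [field, div_vmode hw hδ, inner_smul_right, inner_symbol_dir hξ,
    ← smode_ofReal_mul]
  simp only [if_true]
  simp only [smode, ← Complex.neg_re]
  congr 1
  ring

theorem vlap_field (hw : IsKernel w) (hδ : 0 < δ) (k : Freq × Bool) (x : Plane) :
    vlap w δ n (field w δ n k) x = (-‖symbol w δ n k.1‖ ^ 2) • field w δ n k x :=
  vlap_vmode hw hδ _ _ x

/-- The coefficients of the nonlocal divergence of a test field. -/
theorem setIntegral_smode_mul_div (hw : IsKernel w) (hδ : 0 < δ) (ξ : Freq)
    (hξ : symbol w δ n ξ ≠ 0) {φ : Plane → Plane} (hφ : IsTest φ) :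
    ∫ x in cell, smode casConst ξ x * div w δ n φ x =
      -(‖symbol w δ n ξ‖ * ∫ x in cell, inner ℝ (field w δ n (ξ, true) x) (φ x)) := by
  obtain ⟨L₁, h1⟩ := hφ.exists_lipschitzWith
  have ht := isTest_smode casConst ξ
  obtain ⟨L₂, h2⟩ := ht.exists_lipschitzWith
  have h := setIntegral_div_mul (n := n) hw hδ h1 hφ.periodic h2 ht.periodic
  simp only [grad_sbasis hw hδ ξ hξ, real_inner_smul_right] at h
  rw [integral_const_mul] at h
  simp only [mul_comm (smode casConst ξ _), h, real_inner_comm]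

/-- The nonlocal gradient of a test function is orthogonal to the divergence-free modes. -/
theorem setIntegral_inner_field_grad (hw : IsKernel w) (hδ : 0 < δ) (ξ : Freq)
    (hξ : symbol w δ n ξ ≠ 0) {φ : Plane → ℝ} (hφ : IsTest φ) :
    ∫ x in cell, inner ℝ (field w δ n (ξ, false) x) (grad w δ n φ x) = 0 := by
  have ht := isTest_field (w := w) (δ := δ) (n := n) (ξ, false)
  obtain ⟨L₁, h1⟩ := ht.exists_lipschitzWith
  obtain ⟨L₂, h2⟩ := hφ.exists_lipschitzWith
  have h := setIntegral_div_mul (n := n) hw hδ h1 ht.periodic h2 hφ.periodic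
  simp only [div_field_false hw hδ ξ hξ, zero_mul, integral_zero] at h
  linarith

theorem continuous_vlap (hw : IsKernel w) (hδ : 0 < δ) {φ : Plane → Plane} (hφ : IsTest φ) :
    Continuous (vlap w δ n φ) := by
  have h : ∀ j, Continuous (lap w δ n fun y => φ y j) := fun j => by
    obtain ⟨L, hL⟩ := (hφ.coord j).exists_lipschitzWith_grad (n := n) hw hδ
    exact continuous_div hw hδ hL
  exact (PiLp.continuous_toLp 2 _).comp (continuous_pi h)

/-- The nonlocal diffusion operator is symmetric on test fields. -/
theorem setIntegral_inner_vlap (hw : IsKernel w) (hδ : 0 < δ) {φ ψ : Plane → Plane}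
    (hφ : IsTest φ) (hψ : IsTest ψ) :
    ∫ x in cell, inner ℝ (ψ x) (vlap w δ n φ x) = ∫ x in cell, inner ℝ (vlap w δ n ψ x) (φ x) := by
  have key : ∀ {f g : Plane → ℝ}, IsTest f → IsTest g →
      ∫ x in cell, lap w δ n f x * g x = ∫ x in cell, f x * lap w δ n g x := by
    intro f g hf hg
    obtain ⟨L₁, h1⟩ := hf.exists_lipschitzWith_grad (n := n) hw hδ
    obtain ⟨L₂, h2⟩ := hg.exists_lipschitzWith_grad (n := n) hw hδ
    obtain ⟨L₃, h3⟩ := hf.exists_lipschitzWith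
    obtain ⟨L₄, h4⟩ := hg.exists_lipschitzWith
    have e1 := setIntegral_div_mul (n := n) hw hδ h1 hf.periodic.grad h4 hg.periodic
    have e2 := setIntegral_div_mul (n := n) hw hδ h2 hg.periodic.grad h3 hf.periodic
    simp only [mul_comm (f _)]
    rw [lap, lap, e1, e2]
    simp only [real_inner_comm]
  have hi : ∀ {f g : Plane → ℝ}, Continuous f → Continuous g →
      Integrable (fun x => f x * g x) (volume.restrict cell) := fun hf hg =>
    (memLp_cell (hf.mul hg)).integrable (by norm_num)
  have hc : ∀ {χ : Plane → Plane}, IsTest χ → ∀ j, Continuous (lap w δ n fun y => χ y j) :=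
    fun hχ j => by
      obtain ⟨L, hL⟩ := (hχ.coord j).exists_lipschitzWith_grad (n := n) hw hδ
      exact continuous_div hw hδ hL
  have hk := fun j => key (hφ.coord j) (hψ.coord j)
  simp only [PiLp.inner_apply, RCLike.inner_apply, conj_trivial, Fin.sum_univ_two, vlap]
  rw [integral_add (hi (hc hφ 0) (hψ.coord 0).smooth.continuous)
      (hi (hc hφ 1) (hψ.coord 1).smooth.continuous),
    integral_add (hi (hφ.coord 0).smooth.continuous (hc hψ 0))
      (hi (hφ.coord 1).smooth.continuous (hc hψ 1)), hk, hk]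

/-- The coefficients of the nonlocal diffusion operator applied to a test field. -/
theorem setIntegral_inner_field_vlap (hw : IsKernel w) (hδ : 0 < δ) (k : Freq × Bool)
    {φ : Plane → Plane} (hφ : IsTest φ) :
    ∫ x in cell, inner ℝ (field w δ n k x) (vlap w δ n φ x) =
      -(‖symbol w δ n k.1‖ ^ 2 * ∫ x in cell, inner ℝ (field w δ n k x) (φ x)) := by
  rw [setIntegral_inner_vlap hw hδ hφ (isTest_field k)]
  simp only [vlap_field hw hδ, real_inner_smul_left]
  rw [integral_const_mul]
  ring

end VectorBasis

/-! ### The energy space in the basis of modes -/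

section Energy

variable {w : ℝ → ℝ} {δ : ℝ} {n : Plane}

/-- The real sequence space `ℓ²(κ)`. -/
abbrev Seq (κ : Type) : Type := lp (fun _ : κ => ℝ) 2

theorem memℓp_two_iff {κ : Type} (a : κ → ℝ) : Memℓp a 2 ↔ Summable fun k => a k ^ 2 := by
  rw [memℓp_gen_iff (by norm_num)]
  simp

theorem Seq.norm_sq {κ : Type} (a : Seq κ) : ‖a‖ ^ 2 = ∑' k, a k ^ 2 := by
  have h := lp.norm_rpow_eq_tsum (p := 2) (by norm_num) a
  simpa using h

theorem Seq.hasSum_inner {κ : Type} (a b : Seq κ) : HasSum (fun k => a k * b k) (inner ℝ a b) := by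
  have h := lp.hasSum_inner (𝕜 := ℝ) a b
  simpa only [RCLike.inner_apply, conj_trivial, mul_comm] using h

/-- The energy of the modes with frequencies `ξ` and `-ξ` together. -/
theorem energy_pair (hs : ∀ ξ : Freq, symbol w δ n ξ ≠ 0) (u : L2Zero Plane) (ξ : Freq) :
    ((‖symbol w δ n ξ‖ * inner ℝ (fieldL w δ n (ξ, true)) u) ^ 2 +
      (‖symbol w δ n ξ‖ * inner ℝ (fieldL w δ n (ξ, false)) u) ^ 2) +
    ((‖symbol w δ n (-ξ : Freq)‖ * inner ℝ (fieldL w δ n (-ξ, true)) u) ^ 2 +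
      (‖symbol w δ n (-ξ : Freq)‖ * inner ℝ (fieldL w δ n (-ξ, false)) u) ^ 2) =
    2 * ((2 * Real.pi) ^ 2 *
      (‖symbol w δ n ξ‖ ^ 2 * ‖fourierCoeff (u : L2 Plane) ξ‖ ^ 2)) := by
  have e : ‖symbol w δ n (-ξ : Freq)‖ = ‖symbol w δ n ξ‖ := norm_symbol_neg _
  rw [e, ← sum_norm_sq_inner_dir (hs ξ) (fourierCoeff (u : L2 Plane) ξ)]
  have h1 := inner_fieldL_sq_add (w := w) (δ := δ) (n := n) ξ true u
  have h2 := inner_fieldL_sq_add (w := w) (δ := δ) (n := n) ξ false u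
  simp only [mul_pow]
  linear_combination ‖symbol w δ n ξ‖ ^ 2 * h1 + ‖symbol w δ n ξ‖ ^ 2 * h2

theorem hasSum_freq_iff (u : L2Zero Plane) (s : ℝ) :
    HasSum (fun ξ : Fin 2 → ℤ => ‖symbol w δ n ξ‖ ^ 2 * ‖fourierCoeff (u : L2 Plane) ξ‖ ^ 2) s ↔
    HasSum (fun ξ : Freq => ‖symbol w δ n ξ‖ ^ 2 * ‖fourierCoeff (u : L2 Plane) ξ‖ ^ 2) s := by
  refine (hasSum_subtype_iff_of_support_subset (f := fun ξ : Fin 2 → ℤ =>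
    ‖symbol w δ n ξ‖ ^ 2 * ‖fourierCoeff (u : L2 Plane) ξ‖ ^ 2) (s := {ξ | ξ ≠ 0}) ?_).symm
  intro ξ hξ h0
  apply hξ
  simp only [h0, fourierCoeff_zero_L2Zero]
  simp

/-- The energy norm in the basis of modes. Each frequency pair `±ξ` carries the same energy in
the Fourier coefficients and in the modes. -/
theorem summable_energy_iff (hs : ∀ ξ : Freq, symbol w δ n ξ ≠ 0) (u : L2Zero Plane) :
    (Summable fun ξ : Fin 2 → ℤ =>
      ‖symbol w δ n ξ‖ ^ 2 * ‖fourierCoeff (u : L2 Plane) ξ‖ ^ 2) ↔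
    Summable fun k : Freq × Bool =>
      (‖symbol w δ n k.1‖ * inner ℝ (fieldL w δ n k) u) ^ 2 := by
  set B : Freq × Bool → ℝ := fun k => (‖symbol w δ n k.1‖ * inner ℝ (fieldL w δ n k) u) ^ 2
  have hB0 : ∀ k, 0 ≤ B k := fun k => sq_nonneg _
  set A : Freq → ℝ := fun ξ => ‖symbol w δ n ξ‖ ^ 2 * ‖fourierCoeff (u : L2 Plane) ξ‖ ^ 2
  have hpair : ∀ ξ, (B (ξ, true) + B (ξ, false)) + (B (-ξ, true) + B (-ξ, false)) =
      2 * ((2 * Real.pi) ^ 2 * A ξ) := energy_pair hs u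
  have h1 : (Summable fun ξ : Fin 2 → ℤ =>
      ‖symbol w δ n ξ‖ ^ 2 * ‖fourierCoeff (u : L2 Plane) ξ‖ ^ 2) ↔ Summable A :=
    exists_congr fun s => hasSum_freq_iff u s
  rw [h1, summable_prod_of_nonneg hB0]
  simp only [tsum_bool]
  constructor
  · intro hA
    refine ⟨fun ξ => (hasSum_fintype _).summable, Summable.of_nonneg_of_le
      (fun ξ => add_nonneg (hB0 _) (hB0 _)) (fun ξ => ?_)
      ((hA.mul_left ((2 * Real.pi) ^ 2)).mul_left 2)⟩
    have := hpair ξ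
    have h2 := hB0 (-ξ, true)
    have h3 := hB0 (-ξ, false)
    linarith
  · rintro ⟨-, hB⟩
    have h2 : Summable fun ξ : Freq => B (-ξ, false) + B (-ξ, true) :=
      hB.comp_injective neg_injective
    have h3 := (hB.add h2).mul_left (2 * (2 * Real.pi) ^ 2)⁻¹
    refine h3.congr fun ξ => ?_
    have h4 := hpair ξ
    have := Real.pi_ne_zero
    have e : B (ξ, false) + B (ξ, true) + (B (-ξ, false) + B (-ξ, true)) =
      2 * ((2 * Real.pi) ^ 2 * A ξ) := by linarith
    rw [e]
    field_simp

theorem tsum_energy (hs : ∀ ξ : Freq, symbol w δ n ξ ≠ 0) (u : L2Zero Plane)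
    (h : Summable fun ξ : Fin 2 → ℤ =>
      ‖symbol w δ n ξ‖ ^ 2 * ‖fourierCoeff (u : L2 Plane) ξ‖ ^ 2) :
    ∑' k : Freq × Bool, (‖symbol w δ n k.1‖ * inner ℝ (fieldL w δ n k) u) ^ 2 =
    (2 * Real.pi) ^ 2 * ∑' ξ : Fin 2 → ℤ,
      ‖symbol w δ n ξ‖ ^ 2 * ‖fourierCoeff (u : L2 Plane) ξ‖ ^ 2 := by
  have hB := (summable_energy_iff hs u).1 h
  set B : Freq × Bool → ℝ := fun k => (‖symbol w δ n k.1‖ * inner ℝ (fieldL w δ n k) u) ^ 2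
  have hB0 : ∀ k, 0 ≤ B k := fun k => sq_nonneg _
  have hA := (hasSum_freq_iff u _).1 h.hasSum
  set S := ∑' ξ : Fin 2 → ℤ, ‖symbol w δ n ξ‖ ^ 2 * ‖fourierCoeff (u : L2 Plane) ξ‖ ^ 2
  rw [hB.tsum_prod]
  have hB2 := ((summable_prod_of_nonneg hB0).1 hB).2
  simp only [tsum_bool] at hB2 ⊢
  have h2 : HasSum (fun ξ : Freq => B (-ξ, false) + B (-ξ, true))
      (∑' ξ : Freq, (B (ξ, false) + B (ξ, true))) :=
    ((Equiv.neg Freq).hasSum_iff (f := fun ξ : Freq => B (ξ, false) + B (ξ, true))).2 hB2.hasSum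
  have h3 := hB2.hasSum.add h2
  have h4 := (hA.mul_left ((2 * Real.pi) ^ 2)).mul_left 2
  have h5 : (fun ξ : Freq => B (ξ, false) + B (ξ, true) + (B (-ξ, false) + B (-ξ, true))) =
      fun ξ : Freq => 2 * ((2 * Real.pi) ^ 2 *
        (‖symbol w δ n ξ‖ ^ 2 * ‖fourierCoeff (u : L2 Plane) ξ‖ ^ 2)) := by
    funext ξ
    have := energy_pair hs u ξ
    simp only [B]
    linarith
  rw [h5] at h3
  have h6 := h3.unique h4
  linarith

theorem EnergySpace.summable (v : EnergySpace w δ n) : Summable fun ξ : Fin 2 → ℤ =>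
    ‖symbol w δ n ξ‖ ^ 2 * ‖fourierCoeff (v.toL2 : L2 Plane) ξ‖ ^ 2 := v.2

/-- The weighted coordinates `|λ| (v, e)` of an element of the energy space. -/
def EnergySpace.coordₗ (hs : ∀ ξ : Freq, symbol w δ n ξ ≠ 0) :
    EnergySpace w δ n →ₗ[ℝ] Seq (Freq × Bool) where
  toFun v := ⟨fun k => ‖symbol w δ n k.1‖ * inner ℝ (fieldL w δ n k) v.toL2,
    (memℓp_two_iff _).2 ((summable_energy_iff hs v.toL2).1 v.summable)⟩
  map_add' u v := by
    ext k
    simp only [map_add, inner_add_right, mul_add]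
    rfl
  map_smul' c v := by
    ext k
    change ‖symbol w δ n k.1‖ * inner ℝ (fieldL w δ n k) (c • v.toL2) =
      c * (‖symbol w δ n k.1‖ * inner ℝ (fieldL w δ n k) v.toL2)
    exact (congrArg _ (real_inner_smul_right (fieldL w δ n k) v.toL2 c)).trans (mul_left_comm _ _ _)

theorem EnergySpace.norm_coordₗ (hs : ∀ ξ : Freq, symbol w δ n ξ ≠ 0) (v : EnergySpace w δ n) :
    ‖EnergySpace.coordₗ hs v‖ = 2 * Real.pi * ‖v‖ := by
  have h1 : ‖EnergySpace.coordₗ hs v‖ ^ 2 = (2 * Real.pi * ‖v‖) ^ 2 := by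
    rw [Seq.norm_sq, mul_pow, EnergySpace.norm_eq,
      Real.sq_sqrt (tsum_nonneg fun ξ => by positivity)]
    exact tsum_energy hs v.toL2 v.summable
  exact (sq_eq_sq₀ (norm_nonneg _) (by positivity)).1 h1

/-- The weighted coordinates, as a continuous linear map; a multiple of an isometry. -/
def EnergySpace.coord (hs : ∀ ξ : Freq, symbol w δ n ξ ≠ 0) :
    EnergySpace w δ n →L[ℝ] Seq (Freq × Bool) :=
  (EnergySpace.coordₗ hs).mkContinuous (2 * Real.pi) fun v => (EnergySpace.norm_coordₗ hs v).le

theorem EnergySpace.norm_coord (hs : ∀ ξ : Freq, symbol w δ n ξ ≠ 0) (v : EnergySpace w δ n) :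
    ‖EnergySpace.coord hs v‖ = 2 * Real.pi * ‖v‖ :=
  EnergySpace.norm_coordₗ hs v

theorem EnergySpace.coord_apply (hs : ∀ ξ : Freq, symbol w δ n ξ ≠ 0) (v : EnergySpace w δ n)
    (k : Freq × Bool) : EnergySpace.coord hs v k =
      ‖symbol w δ n k.1‖ * inner ℝ (fieldL w δ n k) v.toL2 := rfl

theorem inner_fieldL_fieldL (hs : ∀ ξ : Freq, symbol w δ n ξ ≠ 0) (k l : Freq × Bool) :
    inner ℝ (fieldL w δ n k) (fieldL w δ n l) = if k = l then 1 else 0 :=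
  (orthonormal_iff_ite.1 (orthonormal_fieldL hs)) k l

/-- The basis fields as elements of the energy space. -/
def fieldS (hs : ∀ ξ : Freq, symbol w δ n ξ ≠ 0) (k : Freq × Bool) : EnergySpace w δ n :=
  (⟨fieldL w δ n k, (summable_energy_iff hs _).2 (summable_of_ne_finset_zero (s := {k})
    fun l hl => by
      rw [inner_fieldL_fieldL hs, if_neg (by simpa using hl), mul_zero, zero_pow two_ne_zero])⟩ :
    energySubmodule w δ n)

theorem toL2_fieldS (hs : ∀ ξ : Freq, symbol w δ n ξ ≠ 0) (k : Freq × Bool) :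
    (fieldS hs k).toL2 = fieldL w δ n k := rfl

theorem coord_fieldS (hs : ∀ ξ : Freq, symbol w δ n ξ ≠ 0) (k : Freq × Bool) :
    EnergySpace.coord hs (fieldS hs k) = lp.single 2 k ‖symbol w δ n k.1‖ := by
  ext l
  rw [EnergySpace.coord_apply, toL2_fieldS, inner_fieldL_fieldL hs, lp.single_apply]
  by_cases h : l = k
  · subst h; simp
  · simp [h]

/-- The expansion in modes converges in the energy norm. -/
theorem EnergySpace.hasSum (hs : ∀ ξ : Freq, symbol w δ n ξ ≠ 0) (v : EnergySpace w δ n) :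
    HasSum (fun k => (inner ℝ (fieldL w δ n k) v.toL2 : ℝ) • fieldS hs k) v := by
  have h1 := lp.hasSum_single (p := 2) (by norm_num) (EnergySpace.coord hs v)
  have h2 : ∀ s : Finset (Freq × Bool), ∑ k ∈ s, lp.single 2 k (EnergySpace.coord hs v k) =
      EnergySpace.coord hs (∑ k ∈ s, (inner ℝ (fieldL w δ n k) v.toL2 : ℝ) • fieldS hs k) := by
    intro s
    rw [map_sum]
    refine Finset.sum_congr rfl fun k _ => ?_
    rw [map_smul, coord_fieldS, EnergySpace.coord_apply, ← lp.single_smul, smul_eq_mul, mul_comm]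
  rw [HasSum, SummationFilter.unconditional_filter, tendsto_iff_norm_sub_tendsto_zero] at h1 ⊢
  simp only [h2, ← map_sub, EnergySpace.norm_coord] at h1
  have h3 := h1.const_mul (2 * Real.pi)⁻¹
  simpa only [← mul_assoc, inv_mul_cancel₀ Real.two_pi_pos.ne', one_mul, mul_zero] using h3

/-- The sequence `⟨f, e⟩ / |λ|` of weighted coordinates of a functional on the energy space is
square summable, as one sees by testing `f` with its own partial sums. -/
theorem sum_sq_dual_le (hs : ∀ ξ : Freq, symbol w δ n ξ ≠ 0) (f : EnergyDual w δ n)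
    (s : Finset (Freq × Bool)) :
    ∑ k ∈ s, (f (fieldS hs k) / ‖symbol w δ n k.1‖) ^ 2 ≤ ‖f‖ ^ 2 := by
  set a : Freq × Bool → ℝ := fun k => f (fieldS hs k) / ‖symbol w δ n k.1‖
  set Q := ∑ k ∈ s, a k ^ 2 with hQ
  have hQ0 : 0 ≤ Q := Finset.sum_nonneg fun k _ => sq_nonneg _
  let x : EnergySpace w δ n := ∑ k ∈ s, (a k / ‖symbol w δ n k.1‖) • fieldS hs k
  have h1 : f x = Q := by
    rw [map_sum]
    refine Finset.sum_congr rfl fun k _ => ?_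
    rw [map_smul, smul_eq_mul]
    simp only [a]
    ring
  have h2 : EnergySpace.coord hs x = ∑ k ∈ s, lp.single 2 k (a k) := by
    rw [map_sum]
    refine Finset.sum_congr rfl fun k _ => ?_
    have : ‖symbol w δ n k.1‖ ≠ 0 := norm_ne_zero_iff.2 (hs k.1)
    rw [map_smul, coord_fieldS, ← lp.single_smul, smul_eq_mul, div_mul_cancel₀ _ this]
  have h3 : ‖EnergySpace.coord hs x‖ ^ 2 = Q := by
    have := lp.norm_sum_single (p := 2) (by norm_num) a s
    rw [h2]
    simpa using this
  rw [EnergySpace.norm_coord] at h3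
  have h4 : Q ≤ ‖f‖ * ‖x‖ := by
    rw [← h1]; exact (le_abs_self _).trans (f.le_opNorm x)
  have h5 : ‖x‖ ^ 2 ≤ Q := by
    rw [← h3, mul_pow]
    have : (1 : ℝ) ≤ (2 * Real.pi) ^ 2 := by nlinarith [Real.pi_gt_three]
    nlinarith [sq_nonneg ‖x‖]
  have h6 : Q ^ 2 ≤ ‖f‖ ^ 2 * Q := by
    calc Q ^ 2 ≤ (‖f‖ * ‖x‖) ^ 2 := pow_le_pow_left₀ hQ0 h4 2
      _ = ‖f‖ ^ 2 * ‖x‖ ^ 2 := mul_pow _ _ _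
      _ ≤ ‖f‖ ^ 2 * Q := mul_le_mul_of_nonneg_left h5 (sq_nonneg _)
  rcases hQ0.eq_or_lt with h0 | h0
  · rw [← h0]; positivity
  · nlinarith

/-- The weighted coordinates of a functional, as a linear map. -/
def dualCoordₗ (hs : ∀ ξ : Freq, symbol w δ n ξ ≠ 0) :
    EnergyDual w δ n →ₗ[ℝ] Seq (Freq × Bool) where
  toFun f := ⟨fun k => f (fieldS hs k) / ‖symbol w δ n k.1‖,
    (memℓp_two_iff _).2 (summable_of_sum_le (fun _ => sq_nonneg _) (sum_sq_dual_le hs f))⟩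
  map_add' f g := by
    ext k
    exact add_div _ _ _
  map_smul' c f := by
    ext k
    exact mul_div_assoc _ _ _

/-- The weighted coordinates `⟨f, e⟩ / |λ|` of a functional on the energy space. -/
def dualCoord (hs : ∀ ξ : Freq, symbol w δ n ξ ≠ 0) :
    EnergyDual w δ n →L[ℝ] Seq (Freq × Bool) :=
  (dualCoordₗ hs).mkContinuous 1 fun f => by
    rw [one_mul]
    refine (sq_le_sq₀ (norm_nonneg _) (norm_nonneg _)).1 ?_
    rw [Seq.norm_sq]
    exact Real.tsum_le_of_sum_le (fun _ => sq_nonneg _) (sum_sq_dual_le hs f)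

theorem dualCoord_apply (hs : ∀ ξ : Freq, symbol w δ n ξ ≠ 0) (f : EnergyDual w δ n)
    (k : Freq × Bool) : dualCoord hs f k = f (fieldS hs k) / ‖symbol w δ n k.1‖ := rfl

/-- The restriction of a sequence over the modes to the gradient modes. -/
def gradPart : Seq (Freq × Bool) →L[ℝ] Seq Freq :=
  LinearMap.mkContinuous
    { toFun := fun a => ⟨fun ξ => a (ξ, true), (memℓp_two_iff _).2
        (((memℓp_two_iff _).1 (lp.memℓp a)).comp_injective (i := fun ξ : Freq => (ξ, true))
          fun _ _ h => (Prod.ext_iff.1 h).1)⟩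
      map_add' := fun _ _ => rfl
      map_smul' := fun _ _ => rfl } 1 fun a => by
    rw [one_mul]
    refine (sq_le_sq₀ (norm_nonneg _) (norm_nonneg _)).1 ?_
    rw [Seq.norm_sq, Seq.norm_sq]
    have hinj : Function.Injective fun ξ : Freq => (ξ, true) := fun _ _ h => (Prod.ext_iff.1 h).1
    have ha := (memℓp_two_iff _).1 (lp.memℓp a)
    exact (ha.comp_injective hinj).tsum_le_tsum_of_inj _ hinj (fun _ _ => sq_nonneg _)
      (fun _ => le_rfl) ha

theorem gradPart_apply (a : Seq (Freq × Bool)) (ξ : Freq) : gradPart a ξ = a (ξ, true) := rfl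

end Energy

/-! ### The weak operators in the basis of modes -/

section Weak

variable {w : ℝ → ℝ} {δ : ℝ} {n : Plane}

theorem inner_toL2_of_ae {F : Type} [NormedAddCommGroup F] [InnerProductSpace ℝ F]
    {u : L2 F} {g h : Plane → F} (hu : u =ᵐ[volume.restrict cell] h) (hg : Continuous g) :
    inner ℝ u (toL2 g hg) = ∫ x in cell, inner ℝ (h x) (g x) := by
  rw [inner_toL2]
  refine integral_congr_ae ?_
  filter_upwards [hu] with x hx
  rw [hx]

theorem inner_fieldL_of_ae {v : L2Zero Plane} {φ : Plane → Plane}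
    (hv : ((v : L2 Plane) : Plane → Plane) =ᵐ[volume.restrict cell] φ) (k : Freq × Bool) :
    inner ℝ (fieldL w δ n k) v = ∫ x in cell, inner ℝ (field w δ n k x) (φ x) := by
  rw [real_inner_comm]
  have h := inner_toL2_of_ae hv (isTest_field (w := w) (δ := δ) (n := n) k).smooth.continuous
  refine h.trans ?_
  simp only [real_inner_comm]

/-- Pairings of square integrable fields expand in the modes. -/
theorem hasSum_setIntegral_inner (hs : ∀ ξ : Freq, symbol w δ n ξ ≠ 0) (u : L2Zero Plane)
    {g : Plane → Plane} (hg : Continuous g) :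
    HasSum (fun k => inner ℝ (fieldL w δ n k) u * ∫ x in cell, inner ℝ (field w δ n k x) (g x))
      (∫ x in cell, inner ℝ ((u : L2 Plane) x) (g x)) := by
  have h1 := (vbasis hs).hasSum_repr u
  have h2 : Continuous fun u : L2Zero Plane => inner ℝ (u : L2 Plane) (toL2 g hg) := by fun_prop
  let A : L2Zero Plane →+ ℝ :=
    { toFun := fun u => inner ℝ (u : L2 Plane) (toL2 g hg)
      map_zero' := by simp
      map_add' := fun u v => by rw [Submodule.coe_add, inner_add_left] }
  have h3 := h1.map A h2
  have h4 : A u = ∫ x in cell, inner ℝ ((u : L2 Plane) x) (g x) := inner_toL2 _ _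
  rw [h4] at h3
  refine h3.congr_fun fun k => ?_
  have h5 : A ((vbasis hs).repr u k • vbasis hs k) =
      (vbasis hs).repr u k * inner ℝ ((vbasis hs k : L2Zero Plane) : L2 Plane) (toL2 g hg) :=
    real_inner_smul_left ((vbasis hs k : L2Zero Plane) : L2 Plane) (toL2 g hg)
      ((vbasis hs).repr u k)
  rw [Function.comp, h5, HilbertBasis.repr_apply_apply, vbasis_apply,
    inner_toL2_of_ae (coeFn_fieldL k)]

theorem hasSum_setIntegral_mul (p : L2Zero ℝ) {g : Plane → ℝ} (hg : Continuous g) :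
    HasSum (fun ξ => sbasis.repr p ξ * ∫ x in cell, smode casConst ξ x * g x)
      (∫ x in cell, (p : L2 ℝ) x * g x) := by
  have h1 := sbasis.hasSum_repr p
  have h2 : Continuous fun p : L2Zero ℝ => inner ℝ (p : L2 ℝ) (toL2 g hg) := by fun_prop
  let A : L2Zero ℝ →+ ℝ :=
    { toFun := fun p => inner ℝ (p : L2 ℝ) (toL2 g hg)
      map_zero' := by simp
      map_add' := fun u v => by rw [Submodule.coe_add, inner_add_left] }
  have h3 := h1.map A h2
  have hcomm : ∀ a b : ℝ, inner ℝ a b = a * b := fun a b => by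
    rw [RCLike.inner_apply, conj_trivial, mul_comm]
  have h4 : A p = ∫ x in cell, (p : L2 ℝ) x * g x := by
    refine (inner_toL2 _ _).trans ?_
    simp only [hcomm]
  rw [h4] at h3
  refine h3.congr_fun fun k => ?_
  have h5 : A (sbasis.repr p k • sbasis k) =
      sbasis.repr p k * inner ℝ ((sbasis k : L2Zero ℝ) : L2 ℝ) (toL2 g hg) :=
    real_inner_smul_left ((sbasis k : L2Zero ℝ) : L2 ℝ) (toL2 g hg) (sbasis.repr p k)
  rw [Function.comp, h5, sbasis_apply, inner_toL2_of_ae (coeFn_smodeL _ _)]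
  simp only [hcomm]

/-- Divergence-free fields are orthogonal to the gradient modes. -/
theorem IsDivFree.inner_fieldL (hw : IsKernel w) (hδ : 0 < δ)
    (hs : ∀ ξ : Freq, symbol w δ n ξ ≠ 0) {u : L2Zero Plane} (hu : IsDivFree w δ n u)
    (ξ : Freq) : inner ℝ (fieldL w δ n (ξ, true)) u = 0 := by
  have h := hu _ (isTest_smode casConst ξ)
  simp only [divPairing, neg_neg, grad_sbasis hw hδ ξ (hs ξ), real_inner_smul_right] at h
  rw [integral_const_mul] at h
  have h1 := (mul_eq_zero.1 h).resolve_left (norm_ne_zero_iff.2 (hs ξ))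
  rw [real_inner_comm]
  exact (inner_toL2 (u : L2 Plane) (isTest_field (ξ, true)).smooth.continuous).trans h1

theorem isDivFree_of_inner_fieldL (hw : IsKernel w) (hδ : 0 < δ)
    (hs : ∀ ξ : Freq, symbol w δ n ξ ≠ 0) {u : L2Zero Plane}
    (hu : ∀ ξ : Freq, inner ℝ (fieldL w δ n (ξ, true)) u = 0) : IsDivFree w δ n u := by
  intro φ hφ
  obtain ⟨L, hL⟩ := hφ.exists_lipschitzWith_grad (n := n) hw hδ
  have h := hasSum_setIntegral_inner hs u hL.continuous
  rw [divPairing, neg_neg]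
  refine h.unique ?_
  have h0 : ∀ k : Freq × Bool, inner ℝ (fieldL w δ n k) u *
      ∫ x in cell, inner ℝ (field w δ n k x) (grad w δ n φ x) = 0 := by
    rintro ⟨ξ, i⟩
    cases i
    · rw [setIntegral_inner_field_grad hw hδ ξ (hs ξ) hφ, mul_zero]
    · rw [hu ξ, zero_mul]
  simp only [h0]
  exact hasSum_zero

theorem lapPairing_field (hw : IsKernel w) (hδ : 0 < δ) (u : L2Zero Plane) (k : Freq × Bool) :
    lapPairing w δ n u (field w δ n k) =
      -(‖symbol w δ n k.1‖ ^ 2 * inner ℝ (fieldL w δ n k) u) := by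
  simp only [lapPairing, vlap_field hw hδ, real_inner_smul_right]
  rw [integral_const_mul, real_inner_comm]
  have h := inner_toL2 (u : L2 Plane) (isTest_field (w := w) (δ := δ) (n := n) k).smooth.continuous
  rw [← h, neg_mul]
  rfl

theorem gradPairing_field_false (hw : IsKernel w) (hδ : 0 < δ) (ξ : Freq)
    (hξ : symbol w δ n ξ ≠ 0) (p : L2 ℝ) : gradPairing w δ n p (field w δ n (ξ, false)) = 0 := by
  simp [gradPairing, div_field_false hw hδ ξ hξ]

theorem gradPairing_field_true (hw : IsKernel w) (hδ : 0 < δ) (ξ : Freq)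
    (hξ : symbol w δ n ξ ≠ 0) (p : L2Zero ℝ) :
    gradPairing w δ n p (field w δ n (ξ, true)) = ‖symbol w δ n ξ‖ * sbasis.repr p ξ := by
  have h := inner_toL2 (p : L2 ℝ) (isTest_smode casConst ξ).smooth.continuous
  simp only [RCLike.inner_apply, conj_trivial] at h
  rw [HilbertBasis.repr_apply_apply, sbasis_apply, real_inner_comm]
  simp only [gradPairing, div_field_true hw hδ ξ hξ, mul_neg, integral_neg, neg_neg]
  simp only [mul_left_comm _ ‖symbol w δ n ξ‖]
  rw [integral_const_mul]
  simp only [mul_comm ((p : L2 ℝ) _)]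
  exact congrArg _ h.symm

/-- The weak diffusion operator is the energy form. -/
theorem lapPairing_eq (hw : IsKernel w) (hδ : 0 < δ) (hs : ∀ ξ : Freq, symbol w δ n ξ ≠ 0)
    (u v : EnergySpace w δ n) {φ : Plane → Plane} (hφ : IsTest φ)
    (hv : ((v.toL2 : L2 Plane) : Plane → Plane) =ᵐ[volume.restrict cell] φ) :
    lapPairing w δ n (u.toL2 : L2 Plane) φ =
      -inner ℝ (EnergySpace.coord hs u) (EnergySpace.coord hs v) := by
  have h1 := hasSum_setIntegral_inner hs u.toL2 (continuous_vlap (n := n) hw hδ hφ)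
  have h2 := (Seq.hasSum_inner (EnergySpace.coord hs u) (EnergySpace.coord hs v)).neg
  refine h1.unique (h2.congr_fun fun k => ?_)
  rw [setIntegral_inner_field_vlap hw hδ k hφ, ← inner_fieldL_of_ae hv,
    EnergySpace.coord_apply, EnergySpace.coord_apply]
  ring

/-- The weak gradient of the pressure in the basis of modes. -/
theorem gradPairing_eq (hw : IsKernel w) (hδ : 0 < δ) (hs : ∀ ξ : Freq, symbol w δ n ξ ≠ 0)
    (p : L2Zero ℝ) (v : EnergySpace w δ n) {φ : Plane → Plane} (hφ : IsTest φ)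
    (hv : ((v.toL2 : L2 Plane) : Plane → Plane) =ᵐ[volume.restrict cell] φ) :
    gradPairing w δ n (p : L2 ℝ) φ =
      inner ℝ (sbasis.repr p) (gradPart (EnergySpace.coord hs v)) := by
  obtain ⟨L, hL⟩ := hφ.exists_lipschitzWith
  have h1 := (hasSum_setIntegral_mul p (continuous_div (n := n) hw hδ hL)).neg
  have h2 := Seq.hasSum_inner (sbasis.repr p) (gradPart (EnergySpace.coord hs v))
  refine h1.unique (h2.congr_fun fun ξ => ?_)
  rw [setIntegral_smode_mul_div hw hδ ξ (hs ξ) hφ, ← inner_fieldL_of_ae hv, gradPart_apply,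
    EnergySpace.coord_apply]
  ring

/-- The functional `v ↦ ⟨a, coord v⟩` on the energy space. -/
def coordAdj (hs : ∀ ξ : Freq, symbol w δ n ξ ≠ 0) :
    Seq (Freq × Bool) →L[ℝ] EnergyDual w δ n :=
  ((ContinuousLinearMap.compL ℝ (EnergySpace w δ n) (Seq (Freq × Bool)) ℝ).flip
    (EnergySpace.coord hs)).comp (innerSL ℝ)

theorem coordAdj_apply (hs : ∀ ξ : Freq, symbol w δ n ξ ≠ 0) (a : Seq (Freq × Bool))
    (v : EnergySpace w δ n) : coordAdj hs a v = inner ℝ a (EnergySpace.coord hs v) := rfl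

/-- The functional `v ↦ ∑ a(ξ) (coord v)(ξ)` on the energy space, summed over the gradient modes. -/
def gradAdj (hs : ∀ ξ : Freq, symbol w δ n ξ ≠ 0) : Seq Freq →L[ℝ] EnergyDual w δ n :=
  ((ContinuousLinearMap.compL ℝ (EnergySpace w δ n) (Seq Freq) ℝ).flip
    (gradPart.comp (EnergySpace.coord hs))).comp (innerSL ℝ)

theorem gradAdj_apply (hs : ∀ ξ : Freq, symbol w δ n ξ ≠ 0) (a : Seq Freq)
    (v : EnergySpace w δ n) :
    gradAdj hs a v = inner ℝ a (gradPart (EnergySpace.coord hs v)) := rfl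

theorem coordAdj_fieldS (hs : ∀ ξ : Freq, symbol w δ n ξ ≠ 0) (a : Seq (Freq × Bool))
    (k : Freq × Bool) : coordAdj hs a (fieldS hs k) = a k * ‖symbol w δ n k.1‖ := by
  rw [coordAdj_apply, coord_fieldS, lp.inner_single_right, RCLike.inner_apply, conj_trivial,
    mul_comm]

theorem gradAdj_fieldS_false (hs : ∀ ξ : Freq, symbol w δ n ξ ≠ 0) (a : Seq Freq) (ξ : Freq) :
    gradAdj hs a (fieldS hs (ξ, false)) = 0 := by
  have h : gradPart (EnergySpace.coord hs (fieldS hs (ξ, false))) = 0 := by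
    ext η
    rw [gradPart_apply, coord_fieldS, lp.single_apply, Pi.single_eq_of_ne (by simp)]
    rfl
  rw [gradAdj_apply, h, inner_zero_right]

theorem gradAdj_fieldS_true (hs : ∀ ξ : Freq, symbol w δ n ξ ≠ 0) (a : Seq Freq) (ξ : Freq) :
    gradAdj hs a (fieldS hs (ξ, true)) = a ξ * ‖symbol w δ n ξ‖ := by
  have h : gradPart (EnergySpace.coord hs (fieldS hs (ξ, true))) =
      lp.single 2 ξ ‖symbol w δ n ξ‖ := by
    ext η
    rw [gradPart_apply, coord_fieldS, lp.single_apply, lp.single_apply]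
    by_cases h : η = ξ
    · subst h; simp
    · have h' : (η, true) ≠ (ξ, true) := fun h2 => h (Prod.ext_iff.1 h2).1
      rw [Pi.single_eq_of_ne h, Pi.single_eq_of_ne h']
  rw [gradAdj_apply, h, lp.inner_single_right, RCLike.inner_apply, conj_trivial, mul_comm]

/-! ### The weak time derivative -/

/-- Composition with a continuous linear map. The energy space and its dual carry only a seminorm,
so this and the next statements are needed for seminormed spaces. -/
theorem memLp_clm_comp {α E F : Type*} [MeasurableSpace α] {ν : Measure α}
    [SeminormedAddCommGroup E] [NormedSpace ℝ E] [SeminormedAddCommGroup F] [NormedSpace ℝ F]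
    {p : ENNReal} (A : E →L[ℝ] F) {g : α → E} (hg : MemLp g p ν) :
    MemLp (fun t => A (g t)) p ν :=
  hg.of_le_mul' (A.continuous.comp_aestronglyMeasurable hg.1)
    (Filter.Eventually.of_forall fun t => (A.le_opENorm (g t) : _ ≤ (‖A‖₊ : ENNReal) * ‖g t‖ₑ))

theorem memLp_norm {α E : Type*} [MeasurableSpace α] {ν : Measure α}
    [SeminormedAddCommGroup E] {p : ENNReal} {g : α → E} (hg : MemLp g p ν) :
    MemLp (fun t => ‖g t‖) p ν :=
  hg.of_le_enorm (continuous_norm.comp_aestronglyMeasurable hg.1)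
    (Filter.Eventually.of_forall fun t => by simp)

/-- The evaluation of functionals at a point. -/
def evalDual (v : EnergySpace w δ n) : EnergyDual w δ n →L[ℝ] ℝ :=
  (ContinuousLinearMap.apply ℝ ℝ) v

/-- A weak time derivative may be checked on the modes, because the expansion in modes
converges both in `L²` and in the energy norm. -/
theorem isTimeDeriv_of_modes (hs : ∀ ξ : Freq, symbol w δ n ξ ≠ 0) {T : ℝ}
    {u : ℝ → L2Zero Plane} {u' : ℝ → EnergyDual w δ n} (hu : ContinuousOn u (Icc 0 T))
    (hu' : MemLp u' 2 (volume.restrict (Ioo 0 T)))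
    (h : ∀ (k : Freq × Bool) (η : ℝ → ℝ), ContDiff ℝ ∞ η → tsupport η ⊆ Ioo 0 T →
      ∫ t in Ioo 0 T, deriv η t * inner ℝ (fieldL w δ n k) (u t) =
        -∫ t in Ioo 0 T, η t * u' t (fieldS hs k)) :
    IsTimeDeriv T u u' := by
  intro v η hη hηc hηs
  have i1 : Integrable (fun t => deriv η t • u t) (volume.restrict (Ioo 0 T)) :=
    (((hη.continuous_deriv (by simp)).continuousOn.smul hu).integrableOn_compact
      isCompact_Icc).mono_set Ioo_subset_Icc_self
  obtain ⟨C, hC⟩ := hη.continuous.bounded_above_of_compact_support hηc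
  have i2 : ∀ x, Integrable (fun t => η t * u' t x) (volume.restrict (Ioo 0 T)) := fun x =>
    ((memLp_clm_comp (evalDual x) hu').integrable (by norm_num)).bdd_mul
      hη.continuous.aestronglyMeasurable (Filter.Eventually.of_forall hC)
  have i3 : Integrable (fun t => ‖u' t‖) (volume.restrict (Ioo 0 T)) :=
    (memLp_norm hu').integrable (by norm_num)
  -- `Z = ∫ η u'`, defined pointwise because the dual of a seminormed space has no Bochner integral
  let Z : EnergySpace w δ n →L[ℝ] ℝ := LinearMap.mkContinuous
    { toFun := fun x => ∫ t in Ioo 0 T, η t * u' t x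
      map_add' := fun x y => by
        rw [← integral_add (i2 x) (i2 y)]
        simp only [map_add, mul_add]
      map_smul' := fun c x => by
        simp only [map_smul, smul_eq_mul, RingHom.id_apply, mul_left_comm (η _)]
        rw [integral_const_mul] } (C * ∫ t in Ioo 0 T, ‖u' t‖) fun x => by
    refine (norm_integral_le_of_norm_le ((i3.const_mul C).mul_const ‖x‖)
      (Filter.Eventually.of_forall fun t => ?_)).trans_eq ?_
    · rw [norm_mul, mul_assoc]
      exact mul_le_mul (hC t) ((u' t).le_opNorm x) (norm_nonneg _)
        ((norm_nonneg _).trans (hC t))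
    · rw [integral_mul_const, integral_const_mul]
  set W := ∫ t in Ioo 0 T, deriv η t • u t with hW
  have hWv : ∀ x : L2Zero Plane, ∫ t in Ioo 0 T, deriv η t * inner ℝ (u t) x = inner ℝ W x := by
    intro x
    rw [hW, real_inner_comm, ← integral_inner i1]
    refine integral_congr_ae (Filter.Eventually.of_forall fun t => ?_)
    change _ = inner ℝ x (deriv η t • u t)
    refine Eq.trans ?_ (real_inner_smul_right x (u t) (deriv η t)).symm
    rw [real_inner_comm]
  have hZv : ∀ x : EnergySpace w δ n, ∫ t in Ioo 0 T, η t * u' t x = Z x := fun _ => rfl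
  rw [hWv, hZv]
  have hmode : ∀ k, inner ℝ W (fieldL w δ n k) = -Z (fieldS hs k) := by
    intro k
    rw [← hWv, ← hZv, ← h k η hη hηs]
    simp only [real_inner_comm]
  have h1 := (EnergySpace.hasSum hs v).mapL Z
  have h2 := ((vbasis hs).hasSum_repr v.toL2).mapL (innerSL ℝ W)
  have h3 : HasSum (fun k => (innerSL ℝ W) ((vbasis hs).repr v.toL2 k • vbasis hs k)) (-Z v) := by
    refine h1.neg.congr_fun fun k => ?_
    rw [map_smul, map_smul, vbasis_apply, HilbertBasis.repr_apply_apply, vbasis_apply,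
      innerSL_apply_apply, hmode, smul_eq_mul, smul_eq_mul, mul_neg]
  exact h2.unique h3

end Weak

/-! ### Uniqueness -/

section Uniqueness

variable {w : ℝ → ℝ} {δ : ℝ} {n : Plane} {T : ℝ} {f : ℝ → EnergyDual w δ n}
  {u₀ : L2Zero Plane} {u : ℝ → L2Zero Plane} {p : ℝ → L2Zero ℝ}

theorem integrable_testFunction_mul {η g : ℝ → ℝ} (hη : Continuous η) (hηc : HasCompactSupport η)
    (hg : IntegrableOn g (Ioo 0 T)) : IntegrableOn (fun t => η t * g t) (Ioo 0 T) := by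
  obtain ⟨C, hC⟩ := hη.bounded_above_of_compact_support hηc
  exact Integrable.bdd_mul hg hη.aestronglyMeasurable (Filter.Eventually.of_forall hC)

theorem integrable_apply (hf : MemLp f 2 (volume.restrict (Ioo 0 T))) (v : EnergySpace w δ n) :
    IntegrableOn (fun t => f t v) (Ioo 0 T) :=
  (memLp_clm_comp (evalDual v) hf).integrable (by norm_num)

theorem continuousOn_inner (hu : ContinuousOn u (Icc 0 T)) (e : L2Zero Plane) :
    ContinuousOn (fun t => (inner ℝ e (u t) : ℝ)) (Icc 0 T) :=
  (innerSL ℝ e).continuous.comp_continuousOn hu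

/-- A continuous function that vanishes almost everywhere on `(0, T)` vanishes on `[0, T]`. -/
theorem eq_zero_of_ae_eq_zero (hT : 0 < T) {y : ℝ → ℝ} (hy : ContinuousOn y (Icc 0 T))
    (h : ∀ᵐ t ∂volume.restrict (Ioo 0 T), y t = 0) : ∀ t ∈ Icc 0 T, y t = 0 := by
  have h1 : EqOn y (fun _ => 0) (Ioo 0 T) :=
    Measure.eqOn_open_of_ae_eq h isOpen_Ioo (hy.mono Ioo_subset_Icc_self) continuousOn_const
  have h2 : EqOn y (fun _ => 0) (closure (Ioo 0 T)) := h1.of_subset_closure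
    (by rwa [closure_Ioo hT.ne]) continuousOn_const subset_closure subset_rfl
  rw [closure_Ioo hT.ne] at h2
  exact h2

/-- The velocity of a solution has no gradient modes, at any time. -/
theorem IsSolution.inner_gradient_mode (hw : IsKernel w) (hδ : 0 < δ)
    (hs : ∀ ξ : Freq, symbol w δ n ξ ≠ 0) (hT : 0 < T) (h : IsSolution T f u₀ u p) (ξ : Freq) :
    ∀ t ∈ Icc 0 T, inner ℝ (fieldL w δ n (ξ, true)) (u t) = 0 := by
  refine eq_zero_of_ae_eq_zero hT (continuousOn_inner h.velocity_continuous _) ?_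
  filter_upwards [h.divergence] with t ht
  exact IsDivFree.inner_fieldL hw hδ hs ht ξ

/-- The equation for a solenoidal mode does not contain the pressure. -/
theorem IsSolution.weak_solenoidal_mode (hw : IsKernel w) (hδ : 0 < δ)
    (hs : ∀ ξ : Freq, symbol w δ n ξ ≠ 0) (h : IsSolution T f u₀ u p) (ξ : Freq) {η : ℝ → ℝ}
    (hη : ContDiff ℝ ∞ η) (hηc : HasCompactSupport η) (hηs : tsupport η ⊆ Ioo 0 T) :
    ∫ t in Ioo 0 T, deriv η t * inner ℝ (fieldL w δ n (ξ, false)) (u t) =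
      -∫ t in Ioo 0 T, η t * (f t (fieldS hs (ξ, false)) -
        ‖symbol w δ n ξ‖ ^ 2 * inner ℝ (fieldL w δ n (ξ, false)) (u t)) := by
  obtain ⟨u', -, hd, hm⟩ := h.momentum
  have h1 := hd (fieldS hs (ξ, false)) η hη hηc hηs
  simp only [toL2_fieldS] at h1
  simp only [real_inner_comm (fieldL w δ n (ξ, false))] at h1 ⊢
  rw [h1]
  congr 1
  refine integral_congr_ae ?_
  filter_upwards [hm] with t ht
  have h2 := ht (fieldS hs (ξ, false)) _ (isTest_field (ξ, false)) (coeFn_fieldL _)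
  rw [lapPairing_field hw hδ, gradPairing_field_false hw hδ ξ (hs ξ)] at h2
  rw [← h2]
  ring

/-- The pressure is determined by the gradient modes of the force. -/
theorem IsSolution.pressure_mode (hw : IsKernel w) (hδ : 0 < δ)
    (hs : ∀ ξ : Freq, symbol w δ n ξ ≠ 0) (hT : 0 < T)
    (h : IsSolution T f u₀ u p) (ξ : Freq) :
    ∀ᵐ t ∂volume.restrict (Ioo 0 T),
      ‖symbol w δ n ξ‖ * sbasis.repr (p t) ξ = f t (fieldS hs (ξ, true)) := by
  obtain ⟨u', hu', hd, hm⟩ := h.momentum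
  have h0 := h.inner_gradient_mode hw hδ hs hT ξ
  have h3 := isOpen_Ioo.ae_eq_zero_of_integral_contDiff_smul_eq_zero (μ := volume)
    (f := fun t => u' t (fieldS hs (ξ, true))) (U := Ioo 0 T)
    (integrable_apply hu' _).locallyIntegrableOn fun η hη hηc hηs => by
      have h1 := hd (fieldS hs (ξ, true)) η hη hηc hηs
      have h2 : ∫ t in Ioo 0 T, deriv η t * inner ℝ (u t) (fieldS hs (ξ, true)).toL2 = 0 := by
        refine setIntegral_eq_zero_of_forall_eq_zero fun t ht => ?_
        rw [toL2_fieldS, real_inner_comm, h0 t (Ioo_subset_Icc_self ht), mul_zero]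
      rw [h2, zero_eq_neg] at h1
      rw [← h1, setIntegral_eq_integral_of_forall_compl_eq_zero]
      · rfl
      · intro t ht
        rw [image_eq_zero_of_notMem_tsupport fun h => ht (hηs h), zero_mul]
  rw [← ae_restrict_iff' measurableSet_Ioo] at h3
  filter_upwards [h3, hm, ae_restrict_mem measurableSet_Ioo] with t ht htm htI
  have h2 := htm (fieldS hs (ξ, true)) _ (isTest_field (ξ, true)) (coeFn_fieldL _)
  rw [lapPairing_field hw hδ, gradPairing_field_true hw hδ ξ (hs ξ), ht,
    h0 t (Ioo_subset_Icc_self htI)] at h2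
  linarith

theorem IsSolution.pressure_unique (hw : IsKernel w) (hδ : 0 < δ)
    (hs : ∀ ξ : Freq, symbol w δ n ξ ≠ 0) (hT : 0 < T) {v : ℝ → L2Zero Plane}
    {q : ℝ → L2Zero ℝ} (h : IsSolution T f u₀ u p) (h' : IsSolution T f u₀ v q) :
    ∀ᵐ t ∂volume.restrict (Ioo 0 T), q t = p t := by
  filter_upwards [ae_all_iff.2 (h.pressure_mode hw hδ hs hT),
    ae_all_iff.2 (h'.pressure_mode hw hδ hs hT)] with t h1 h2
  apply sbasis.repr.injective
  ext ξ
  exact mul_left_cancel₀ (norm_ne_zero_iff.2 (hs ξ)) ((h2 ξ).trans (h1 ξ).symm)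

theorem IsSolution.velocity_unique (hw : IsKernel w) (hδ : 0 < δ)
    (hs : ∀ ξ : Freq, symbol w δ n ξ ≠ 0) (hT : 0 < T)
    (hf : MemLp f 2 (volume.restrict (Ioo 0 T))) {v : ℝ → L2Zero Plane}
    {q : ℝ → L2Zero ℝ} (h : IsSolution T f u₀ u p) (h' : IsSolution T f u₀ v q) :
    ∀ t ∈ Icc 0 T, v t = u t := by
  have hmode : ∀ k, ∀ t ∈ Icc 0 T,
      inner ℝ (fieldL w δ n k) (v t) - inner ℝ (fieldL w δ n k) (u t) = 0 := by
    rintro ⟨ξ, i⟩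
    cases i
    · have hcu := continuousOn_inner h.velocity_continuous (fieldL w δ n (ξ, false))
      have hcv := continuousOn_inner h'.velocity_continuous (fieldL w δ n (ξ, false))
      refine eq_zero_of_weak_decay hT (μ := ‖symbol w δ n ξ‖ ^ 2) (hcv.sub hcu) ?_ ?_
      · rw [h.initial, h'.initial, sub_self]
      · intro η hη hηc hηs
        have iu := (hcu.integrableOn_compact (μ := volume) isCompact_Icc).mono_set
          Ioo_subset_Icc_self
        have iv := (hcv.integrableOn_compact (μ := volume) isCompact_Icc).mono_set
          Ioo_subset_Icc_self
        have jf := integrable_apply hf (fieldS hs (ξ, false))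
        have dη := hη.continuous_deriv (by simp)
        simp only [mul_sub (deriv η _)]
        have jv := integrable_testFunction_mul (g := fun t => f t (fieldS hs (ξ, false)) -
          ‖symbol w δ n ξ‖ ^ 2 * inner ℝ (fieldL w δ n (ξ, false)) (v t))
          hη.continuous hηc (jf.sub (iv.const_mul _))
        have ju := integrable_testFunction_mul (g := fun t => f t (fieldS hs (ξ, false)) -
          ‖symbol w δ n ξ‖ ^ 2 * inner ℝ (fieldL w δ n (ξ, false)) (u t))
          hη.continuous hηc (jf.sub (iu.const_mul _))
        rw [integral_sub (integrable_testFunction_mul dη hηc.deriv iv)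
          (integrable_testFunction_mul dη hηc.deriv iu),
          h.weak_solenoidal_mode hw hδ hs ξ hη hηc hηs,
          h'.weak_solenoidal_mode hw hδ hs ξ hη hηc hηs, sub_neg_eq_add, neg_add_eq_sub,
          ← neg_sub, ← integral_sub jv ju]
        congr 1
        refine integral_congr_ae (Filter.Eventually.of_forall fun t => ?_)
        simp only
        ring
    · intro t ht
      rw [h.inner_gradient_mode hw hδ hs hT ξ t ht, h'.inner_gradient_mode hw hδ hs hT ξ t ht,
        sub_self]
  intro t ht
  apply (vbasis hs).repr.injective
  ext k
  rw [HilbertBasis.repr_apply_apply, HilbertBasis.repr_apply_apply, vbasis_apply]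
  exact sub_eq_zero.1 (hmode k t ht)

end Uniqueness

/-! ### Existence -/

section Existence

variable {w : ℝ → ℝ} {δ : ℝ} {n : Plane} {T : ℝ}

/-- A curve in `L²` with weighted coordinates in `L²(0,T;ℓ²)` lifts to a square integrable curve
in the energy space. -/
theorem exists_energy_lift (hs : ∀ ξ : Freq, symbol w δ n ξ ≠ 0) {u : ℝ → L2Zero Plane}
    (hu : ContinuousOn u (Icc 0 T))
    (h1 : ∀ᵐ t ∂volume.restrict (Ioo 0 T), Summable fun k : Freq × Bool =>
      ‖symbol w δ n k.1‖ ^ 2 * inner ℝ (fieldL w δ n k) (u t) ^ 2)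
    (h2 : ∫⁻ t in Ioo 0 T, ∑' k : Freq × Bool, ENNReal.ofReal
      (‖symbol w δ n k.1‖ ^ 2 * inner ℝ (fieldL w δ n k) (u t) ^ 2) < ⊤) :
    ∃ U : ℝ → EnergySpace w δ n, MemLp U 2 (volume.restrict (Ioo 0 T)) ∧
      ∀ᵐ t ∂volume.restrict (Ioo 0 T), (U t).toL2 = u t := by
  classical
  -- off a null set of times `u t` has finite energy; the value `0` elsewhere is arbitrary
  let U : ℝ → EnergySpace w δ n := fun t =>
    if h : u t ∈ energySubmodule w δ n then (⟨u t, h⟩ : energySubmodule w δ n) else 0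
  have hU : ∀ᵐ t ∂volume.restrict (Ioo 0 T), (U t).toL2 = u t := by
    filter_upwards [h1] with t ht
    have h : u t ∈ energySubmodule w δ n := (summable_energy_iff hs (u t)).2
      (by simpa only [mul_pow] using ht)
    have hUt : U t = (⟨u t, h⟩ : energySubmodule w δ n) := dif_pos h
    rw [hUt]
    rfl
  refine ⟨U, ⟨?_, ?_⟩, hU⟩
  · -- the partial sums of the expansion in modes are measurable and converge in the energy norm
    refine aestronglyMeasurable_of_tendsto_ae Filter.atTop
      (f := fun (s : Finset (Freq × Bool)) t =>
        ∑ k ∈ s, (inner ℝ (fieldL w δ n k) (u t) : ℝ) • fieldS hs k) (fun s => ?_) ?_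
    · refine Finset.aestronglyMeasurable_fun_sum s fun k _ => ?_
      exact AEStronglyMeasurable.smul_const (((continuousOn_inner hu _).mono
        Ioo_subset_Icc_self).aestronglyMeasurable measurableSet_Ioo) _
    · filter_upwards [hU] with t ht
      have := EnergySpace.hasSum hs (U t)
      rw [ht] at this
      exact this
  · rw [eLpNorm_lt_top_iff_lintegral_rpow_enorm_lt_top (by norm_num) (by norm_num)]
    refine lt_of_le_of_lt (lintegral_mono_ae ?_) h2
    filter_upwards [hU, h1] with t ht hst
    have h3 := Seq.norm_sq (EnergySpace.coord hs (U t))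
    simp only [EnergySpace.coord_apply, EnergySpace.norm_coord, ht, mul_pow] at h3
    rw [← ENNReal.ofReal_tsum_of_nonneg (fun k => by positivity) hst, ← h3]
    rw [← ofReal_norm, ENNReal.ofReal_rpow_of_nonneg (norm_nonneg _) (by norm_num)]
    refine ENNReal.ofReal_le_ofReal ?_
    rw [ENNReal.toReal_ofNat, Real.rpow_two]
    refine le_mul_of_one_le_left (sq_nonneg _) ?_
    nlinarith [Real.pi_gt_three]

/-- The part of the force that drives the velocity: its values on the solenoidal modes, and zero on
the gradient modes. -/
def modeForce (hs : ∀ ξ : Freq, symbol w δ n ξ ≠ 0) (f : ℝ → EnergyDual w δ n)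
    (k : Freq × Bool) (t : ℝ) : ℝ :=
  if k.2 then 0 else f t (fieldS hs k)

theorem memLp_modeForce (hs : ∀ ξ : Freq, symbol w δ n ξ ≠ 0) {f : ℝ → EnergyDual w δ n}
    (hf : MemLp f 2 (volume.restrict (Ioo 0 T))) (k : Freq × Bool) :
    MemLp (modeForce hs f k) 2 (volume.restrict (Ioo 0 T)) := by
  rcases k with ⟨ξ, i⟩
  cases i
  · exact memLp_clm_comp (evalDual (fieldS hs (ξ, false))) hf
  · exact MemLp.zero

theorem summable_modeForce (hs : ∀ ξ : Freq, symbol w δ n ξ ≠ 0) {f : ℝ → EnergyDual w δ n}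
    (hf : MemLp f 2 (volume.restrict (Ioo 0 T))) :
    Summable fun k : Freq × Bool =>
      (‖symbol w δ n k.1‖ ^ 2)⁻¹ * ∫ s in Ioo 0 T, modeForce hs f k s ^ 2 := by
  refine summable_of_sum_le (c := ∫ t in Ioo 0 T, ‖f t‖ ^ 2)
    (fun k => mul_nonneg (by positivity) (integral_nonneg fun t => sq_nonneg _)) fun s => ?_
  simp only [← integral_const_mul]
  rw [← integral_finsetSum _ fun k _ => ((memLp_modeForce hs hf k).integrable_sq).const_mul _]
  refine integral_mono (integrable_finsetSum _ fun k _ =>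
    ((memLp_modeForce hs hf k).integrable_sq).const_mul _) (memLp_norm hf).integrable_sq
    fun t => ?_
  refine le_trans (Finset.sum_le_sum fun k _ => ?_) (sum_sq_dual_le hs (f t) s)
  rw [div_pow, div_eq_inv_mul]
  refine mul_le_mul_of_nonneg_left ?_ (by positivity)
  unfold modeForce
  split_ifs
  · rw [zero_pow two_ne_zero]; exact sq_nonneg _
  · exact le_rfl

theorem duhamel_zero_zero (μ t : ℝ) : duhamel μ 0 (fun _ => 0) t = 0 := by
  simp [duhamel]

/-- The coordinates of the pressure, the inverse gradient of the gradient part of the force. -/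
def pressureSeq (hs : ∀ ξ : Freq, symbol w δ n ξ ≠ 0) : EnergyDual w δ n →L[ℝ] Seq Freq :=
  gradPart.comp (dualCoord hs)

theorem pressureSeq_mul (hs : ∀ ξ : Freq, symbol w δ n ξ ≠ 0) (g : EnergyDual w δ n)
    (ξ : Freq) : pressureSeq hs g ξ * ‖symbol w δ n ξ‖ = g (fieldS hs (ξ, true)) := by
  have hP : pressureSeq hs g ξ = g (fieldS hs (ξ, true)) / ‖symbol w δ n ξ‖ := by
    rw [← dualCoord_apply hs g (ξ, true), pressureSeq, ContinuousLinearMap.comp_apply,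
      gradPart_apply]
  rw [hP, div_mul_cancel₀ _ (norm_ne_zero_iff.2 (hs ξ))]

/-- The time derivative `g + lap V - grad p` prescribed by the equation. -/
def stokesRate (hs : ∀ ξ : Freq, symbol w δ n ξ ≠ 0) (g : EnergyDual w δ n)
    (V : EnergySpace w δ n) : EnergyDual w δ n :=
  g + (-coordAdj hs (EnergySpace.coord hs V) + -gradAdj hs (pressureSeq hs g))

theorem stokesRate_apply (hs : ∀ ξ : Freq, symbol w δ n ξ ≠ 0) (g : EnergyDual w δ n)
    (V v : EnergySpace w δ n) : stokesRate hs g V v = g v -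
      coordAdj hs (EnergySpace.coord hs V) v - gradAdj hs (pressureSeq hs g) v := by
  rw [stokesRate, add_apply, add_apply,
    neg_apply, neg_apply]
  ring

theorem stokesRate_fieldS (hs : ∀ ξ : Freq, symbol w δ n ξ ≠ 0) (f : ℝ → EnergyDual w δ n)
    (t : ℝ) (V : EnergySpace w δ n) (k : Freq × Bool) :
    stokesRate hs (f t) V (fieldS hs k) = modeForce hs f k t -
      ‖symbol w δ n k.1‖ ^ 2 * inner ℝ (fieldL w δ n k) V.toL2 := by
  rcases k with ⟨ξ, i⟩
  rw [stokesRate_apply, coordAdj_fieldS, EnergySpace.coord_apply]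
  cases i
  · rw [gradAdj_fieldS_false]
    simp only [modeForce, Bool.false_eq_true, if_false]
    ring
  · rw [gradAdj_fieldS_true, pressureSeq_mul]
    simp only [modeForce, if_true]
    ring

theorem memLp_neg_seminormed {α E : Type*} [MeasurableSpace α] {ν : Measure α}
    [SeminormedAddCommGroup E] {p : ENNReal} {g : α → E} (hg : MemLp g p ν) :
    MemLp (fun t => -g t) p ν :=
  hg.of_le_enorm (continuous_neg.comp_aestronglyMeasurable hg.1)
    (Filter.Eventually.of_forall fun t => by simp)

theorem memLp_add_seminormed {α E : Type*} [MeasurableSpace α] {ν : Measure α}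
    [SeminormedAddCommGroup E] {p : ENNReal} {g h : α → E} (hg : MemLp g p ν)
    (hh : MemLp h p ν) : MemLp (fun t => g t + h t) p ν := by
  refine ((memLp_norm hg).add (memLp_norm hh)).of_le_enorm (hg.1.add hh.1)
    (Filter.Eventually.of_forall fun t => ?_)
  refine (enorm_le_iff_norm_le.2 ?_)
  rw [Pi.add_apply, Real.norm_of_nonneg (add_nonneg (norm_nonneg _) (norm_nonneg _))]
  exact norm_add_le _ _

theorem memLp_stokesRate (hs : ∀ ξ : Freq, symbol w δ n ξ ≠ 0) {f : ℝ → EnergyDual w δ n}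
    (hf : MemLp f 2 (volume.restrict (Ioo 0 T))) {U : ℝ → EnergySpace w δ n}
    (hU : MemLp U 2 (volume.restrict (Ioo 0 T))) :
    MemLp (fun t => stokesRate hs (f t) (U t)) 2 (volume.restrict (Ioo 0 T)) := by
  have h1 : MemLp (fun t => -coordAdj hs (EnergySpace.coord hs (U t))) 2
      (volume.restrict (Ioo 0 T)) :=
    memLp_neg_seminormed (memLp_clm_comp (coordAdj hs) (memLp_clm_comp (EnergySpace.coord hs) hU))
  have h2 : MemLp (fun t => -gradAdj hs (pressureSeq hs (f t))) 2
      (volume.restrict (Ioo 0 T)) :=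
    memLp_neg_seminormed (memLp_clm_comp (gradAdj hs) (memLp_clm_comp (pressureSeq hs) hf))
  exact memLp_add_seminormed hf (memLp_add_seminormed h1 h2)

/-- The velocity solves the heat equation on the solenoidal modes, and the pressure balances the
gradient modes of the force. -/
theorem exists_isSolution (hw : IsKernel w) (hδ : 0 < δ)
    (hs : ∀ ξ : Freq, symbol w δ n ξ ≠ 0) (hT : 0 < T) {f : ℝ → EnergyDual w δ n}
    (hf : MemLp f 2 (volume.restrict (Ioo 0 T))) {u₀ : L2Zero Plane}
    (hu₀ : IsDivFree w δ n u₀) :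
    ∃ (u : ℝ → L2Zero Plane) (p : ℝ → L2Zero ℝ), IsSolution T f u₀ u p := by
  have hμ : ∀ k : Freq × Bool, 0 < ‖symbol w δ n k.1‖ ^ 2 := fun k =>
    pow_pos (norm_pos_iff.2 (hs k.1)) 2
  have hG := memLp_modeForce hs hf
  have hsum := summable_modeForce hs hf
  obtain ⟨u, huc, hu0, hu⟩ := exists_continuousOn_duhamel (vbasis hs) hT.le hμ u₀ hG hsum
  simp only [vbasis_apply] at hu
  have hy₀ : Summable fun k => (inner ℝ (fieldL w δ n k) u₀ : ℝ) ^ 2 := by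
    simpa only [vbasis_apply] using (hasSum_sq_inner (vbasis hs) u₀).summable
  have hgrad : ∀ t ∈ Icc 0 T, ∀ ξ : Freq, inner ℝ (fieldL w δ n (ξ, true)) (u t) = 0 := by
    intro t ht ξ
    rw [hu t ht, IsDivFree.inner_fieldL hw hδ hs hu₀ ξ]
    exact duhamel_zero_zero _ _
  have hlift1 : ∀ᵐ t ∂volume.restrict (Ioo 0 T), Summable fun k : Freq × Bool =>
      ‖symbol w δ n k.1‖ ^ 2 * (inner ℝ (fieldL w δ n k) (u t) : ℝ) ^ 2 := by
    filter_upwards [ae_summable_duhamel hT.le hμ hy₀ hG hsum,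
      ae_restrict_mem measurableSet_Ioo] with t ht htI
    simpa only [hu t (Ioo_subset_Icc_self htI)] using ht
  have hlift2 : ∫⁻ t in Ioo 0 T, ∑' k : Freq × Bool, ENNReal.ofReal
      (‖symbol w δ n k.1‖ ^ 2 * (inner ℝ (fieldL w δ n k) (u t) : ℝ) ^ 2) < ⊤ := by
    refine (setLIntegral_congr_fun measurableSet_Ioo fun t ht => ?_).trans_lt
      (lintegral_tsum_duhamel_lt_top hT.le hμ hy₀ hG hsum)
    exact tsum_congr fun k => by rw [hu t (Ioo_subset_Icc_self ht) k]
  obtain ⟨U, hUm, hU⟩ := exists_energy_lift hs huc hlift1 hlift2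
  refine ⟨u, fun t => sbasis.repr.symm (pressureSeq hs (f t)), huc, ⟨U, hUm, hU⟩, ?_,
    ⟨fun t => stokesRate hs (f t) (U t), memLp_stokesRate hs hf hUm, ?_, ?_⟩, ?_, hu0⟩
  · exact memLp_clm_comp ((sbasis.repr.symm.toContinuousLinearEquiv :
      Seq Freq →L[ℝ] L2Zero ℝ).comp (pressureSeq hs)) hf
  · refine isTimeDeriv_of_modes hs huc (memLp_stokesRate hs hf hUm) fun k η hη hηs => ?_
    have hl : ∫ t in Ioo 0 T, deriv η t * inner ℝ (fieldL w δ n k) (u t) =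
        ∫ t in Ioo 0 T, deriv η t * duhamel (‖symbol w δ n k.1‖ ^ 2)
          (inner ℝ (fieldL w δ n k) u₀) (modeForce hs f k) t :=
      setIntegral_congr_fun measurableSet_Ioo fun t ht =>
        congrArg (deriv η t * ·) (hu t (Ioo_subset_Icc_self ht) k)
    have hi : IntervalIntegrable (modeForce hs f k) volume 0 T := by
      rw [intervalIntegrable_iff_integrableOn_Ioo_of_le hT.le]
      exact (hG k).integrable (by norm_num)
    rw [hl, integral_deriv_mul_duhamel hT.le hi hη hηs]
    congr 1
    refine integral_congr_ae ?_
    filter_upwards [hU, ae_restrict_mem measurableSet_Ioo] with t ht htI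
    rw [stokesRate_fieldS, ht, hu t (Ioo_subset_Icc_self htI) k]
  · filter_upwards [hU] with t ht v φ hφ hv
    rw [← ht, lapPairing_eq hw hδ hs (U t) v hφ hv, gradPairing_eq hw hδ hs _ v hφ hv,
      LinearIsometryEquiv.apply_symm_apply, stokesRate_apply, coordAdj_apply, gradAdj_apply]
    ring
  · filter_upwards [ae_restrict_mem measurableSet_Ioo] with t ht
    exact isDivFree_of_inner_fieldL hw hδ hs (hgrad t (Ioo_subset_Icc_self ht))

end Existence

end NonlocalStokes

end

theorem mainTheorem4 (w : ℝ → ℝ) (hw : NonlocalStokes.IsKernel w) (δ : ℝ) (hδ : 0 < δ)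
    (n : NonlocalStokes.Plane) (hn : ‖n‖ = 1) (T : ℝ) (hT : 0 < T)
    (f : ℝ → NonlocalStokes.EnergyDual w δ n) (hf : MemLp f 2 (volume.restrict (Ioo 0 T)))
    (u₀ : NonlocalStokes.L2Zero NonlocalStokes.Plane)
    (hu₀ : NonlocalStokes.IsDivFree w δ n u₀) :
    ∃ (u : ℝ → NonlocalStokes.L2Zero NonlocalStokes.Plane) (p : ℝ → NonlocalStokes.L2Zero ℝ),
      NonlocalStokes.IsSolution T f u₀ u p ∧
      ∀ (v : ℝ → NonlocalStokes.L2Zero NonlocalStokes.Plane) (q : ℝ → NonlocalStokes.L2Zero ℝ),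
        NonlocalStokes.IsSolution T f u₀ v q →
          (∀ t ∈ Icc 0 T, v t = u t) ∧ ∀ᵐ t ∂volume.restrict (Ioo 0 T), q t = p t := by
  have hs : ∀ ξ : NonlocalStokes.Freq, NonlocalStokes.symbol w δ n ξ ≠ 0 := fun ξ =>
    NonlocalStokes.symbol_ne_zero hw hδ hn ξ.2
  obtain ⟨u, p, h⟩ := NonlocalStokes.exists_isSolution hw hδ hs hT hf hu₀
  exact ⟨u, p, h, fun v q h' => ⟨h.velocity_unique hw hδ hs hT hf h',
    h.pressure_unique hw hδ hs hT h'⟩⟩
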